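/- \textbf{Setting.} Let $n\ge 1$ and let $\mathbb{R}_n$ be the real Clifford algebra with units $e_1,\dots,e_n$, $e_i^2=-1$, $e_ie_j=-e_je_i$ ($i\ne j$), basis $e_A=e_{i_1}\cdots e_{i_r}$ ($A=\{i_1<\dots<i_r\}$), conjugation $\overline{s}=\sum_A(-1)^{|A|(|A|+1)/2}s_Ae_A$ and $|s|^2=\sum_A s_A^2$. Let $\mathbb{R}^{n+1}=\{s_0+s_1e_1+\dots+s_ne_n\}\subseteq\mathbb{R}_n$ be the paravectors and $\mathbb{S}=\{J\in\mathbb{R}^{n+1}: J_0=0,\ |J|=1\}$, and for $J\in\mathbb S$ put $\mathbb{C}_J=\{x+Jy: x,y\in\mathbb{R}\}$. For a real Banach space $V_{\mathbb R}$ let $V=V_{\mathbb R}\otimes\mathbb{R}_n$ be the Clifford module with norm $\|\sum_A v_A\otimes e_A\|^2=\sum_A\|v_A\|^2$ and its left and right multiplications by $\mathbb{R}_n$. $\mathcal{K}(V)$ denotes the closed right-linear operators $T:\operatorname{dom}(T)\to V$ with two-sided linear domain, $\mathcal{B}(V)$ the bounded everywhere defined ones; for a Clifford number $a$, $(Ta)v=T(av)$,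 and a Clifford number itself acts by left multiplication. The product $AB$ of unbounded operators has domain $\{v\in\operatorname{dom}B: Bv\in\operatorname{dom}A\}$, and $A\subseteq B$ means that $B$ extends $A$. \textbf{Bisectorial operators.} For $T\in\mathcal{K}(V)$ and $s\in\mathbb{R}^{n+1}$ let $Q_s[T]=T^2-2s_0T+|s|^2$ on $\operatorname{dom}(T^2)$, $\rho_S(T)=\{s\in\mathbb{R}^{n+1}: Q_s[T]^{-1}\in\mathcal{B}(V)\}$, $\sigma_S(T)=\mathbb{R}^{n+1}\setminus\rho_S(T)$ and $S_L^{-1}(s,T)=Q_s[T]^{-1}\overline{s}-TQ_s[T]^{-1}$ for $s\in\rho_S(T)$. For $\theta\in(0,\frac{\pi}{2})$ let $I_\theta=(-\theta,\theta)\cup(\pi-\theta,\pi+\theta)$ and $D_\theta=\{te^{J\phi}: t>0,\ J\in\mathbb{S},\ \phi\in I_\theta\}$. $T$ is bisectorial of angle $\omega\in(0,\frac{\pi}{2})$ if $\sigma_S(T)\subseteq\overline{D_\omega}$ and for every $\varphi\in(\omega,\frac{\pi}{2})$ there is $C_\varphi\ge0$ with $\|S_L^{-1}(s,T)\|\le C_\varphi/|s|$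 for all $s\in\mathbb{R}^{n+1}\setminus(D_\varphi\cup\{0\})$. \textbf{Functions.} $\mathcal{SH}_L(D_\theta)$ is the set of $f:D_\theta\to\mathbb{R}_n$ of the form $f(x+Jy)=f_0(x,y)+Jf_1(x,y)$ for all $J\in\mathbb{S}$, where $f_0,f_1$ are continuously differentiable $\mathbb{R}_n$-valued functions on $\{(x,y)\in\mathbb{R}^2: x+\mathbb{S}y\subseteq D_\theta\}$, $f_0$ is even and $f_1$ odd in $y$, and $\partial_xf_0=\partial_yf_1$, $\partial_yf_0=-\partial_xf_1$. $\mathcal{N}(D_\theta)$ (intrinsic functions) is the subset for which $f_0,f_1$ are real valued. $\mathcal{SH}_L^0(D_\theta)$ (resp. $\mathcal{N}^0(D_\theta)$) is the set of bounded $f\in\mathcal{SH}_L(D_\theta)$ (resp. $\mathcal{N}(D_\theta)$) with $\int_0^\infty|f(te^{J\phi})|\frac{dt}{t}<\infty$ for all $J\in\mathbb{S}$, $\phi\in I_\theta$. $\mathcal{SH}_L^{\rm bnd}(D_\theta)$ (resp. $\mathcal{N}^{\rm bnd}(D_\theta)$) is the set of $f(s)=f_\infty+\frac{1}{1+s^2}(f_0-f_\infty)+\widetilde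 f(s)$ with $f_0,f_\infty\in\mathbb{R}_n$, $\widetilde f\in\mathcal{SH}_L^0(D_\theta)$ (resp. $f_0,f_\infty\in\mathbb{R}$, $\widetilde f\in\mathcal{N}^0(D_\theta)$); $f_0,f_\infty,\widetilde f$ are unique. \textbf{Functional calculi.} Let $T$ be bisectorial of angle $\omega$ and $\theta\in(\omega,\frac{\pi}{2})$. For $f\in\mathcal{SH}_L^0(D_\theta)$ let $$f(T)=\frac{1}{2\pi}\int_{\partial D_\varphi\cap\mathbb{C}_J}S_L^{-1}(s,T)\,ds_J\,f(s),\qquad ds_J=\frac{ds}{J},$$ with $\varphi\in(\omega,\theta)$, $J\in\mathbb{S}$ arbitrary and $\partial D_\varphi\cap\mathbb C_J$ positively oriented; for $f\in\mathcal{SH}_L^{\rm bnd}(D_\theta)$ let $f(T)=f_\infty+(1+T^2)^{-1}(f_0-f_\infty)+\widetilde f(T)\in\mathcal{B}(V)$. A regularizer of $f\in\mathcal{SH}_L(D_\theta)$ is a function $e\in\mathcal{N}^{\rm bnd}(D_\theta)$ with $ef\in\mathcal{SH}_L^{\rm bnd}(D_\theta)$ and $e(T)$ injective. $\mathcal{SH}_L^{\rm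 reg}(D_\theta)$ is the set of $f\in\mathcal{SH}_L(D_\theta)$ that have a regularizer, and $\mathcal{N}^{\rm reg}(D_\theta)$ the set of $g\in\mathcal{N}(D_\theta)$ that have a regularizer $e$ with $eg\in\mathcal{N}^{\rm bnd}(D_\theta)$. For $f\in\mathcal{SH}_L^{\rm reg}(D_\theta)$ the $H^\infty$-functional calculus is $$f(T)=e(T)^{-1}(ef)(T),\qquad e\text{ a regularizer of }f.$$ These operators do not depend on the choices of $\varphi$, $J$ and $e$. \textbf{Theorem.} Let $T\in\mathcal{K}(V)$ be bisectorial of angle $\omega\in(0,\frac{\pi}{2})$, let $\theta\in(\omega,\frac{\pi}{2})$, $g\in\mathcal{N}^{\rm reg}(D_\theta)$ and $f\in\mathcal{SH}_L^{\rm reg}(D_\theta)$. Then $gf\in\mathcal{SH}_L^{\rm reg}(D_\theta)$, there holds the product rule $$(gf)(T)\supseteq g(T)f(T),$$ and the domains are connected by $$\operatorname{dom}(g(T)f(T))=\operatorname{dom}((gf)(T))\cap\operatorname{dom}(f(T)).$$ This holds for every admissible choice of $\varphi\in(\omega,\theta)$ and $J\in\mathbb{S}$ (the same for all operators involved), and of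 regularizers of $f$, $g$ and $gf$ in the definition of the three operators. -/

import Mathlib

open MeasureTheory Set

noncomputable section

namespace CliffordCalc

/-! ## Clifford numbers and Clifford modules -/

/-- For a real Banach space `W`, the Clifford module `W ⊗ ℝ_n`: its elements are the formal sums
`∑_A v_A ⊗ e_A` over the subsets `A` of the index set, `v_A ∈ W`, and
`‖v‖² = ∑_A ‖v_A‖²`. -/
abbrev CliffordModule (n : ℕ) (W : Type*) : Type _ := PiLp 2 (fun _ : Finset (Fin n) => W)

/-- The Clifford numbers `s = ∑_A s_A e_A` with real coefficients and `|s|² = ∑_A s_A²`. -/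
abbrev Cl (n : ℕ) : Type := CliffordModule n ℝ

/-- The sign in `e_A e_B = cliffordSign A B • e_{A ∆ B}`, determined by `e_i e_j = - e_j e_i` for
`i ≠ j` and `e_i² = -1`: sorting the product `e_A e_B` takes one transposition for every pair
`i ∈ A`, `j ∈ B` with `j < i`, and every common index `i = j` contributes one factor `-1`. -/
def cliffordSign {n : ℕ} (A B : Finset (Fin n)) : ℝ :=
  (-1) ^ ((A ×ˢ B).filter fun p => p.2 ≤ p.1).card

section Module

variable {n : ℕ} {W : Type*} [NormedAddCommGroup W] [NormedSpace ℝ W]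

/-- Left multiplication `v ↦ a v = ∑_{A,B} (a_A v_B) ⊗ (e_A e_B)`; the coefficient at `e_C`
collects the pairs `(A, B)` with `B = A ∆ C`. -/
def leftMul (a : Cl n) : CliffordModule n W →L[ℝ] CliffordModule n W :=
  ((PiLp.continuousLinearEquiv 2 ℝ (fun _ : Finset (Fin n) => W)).symm :
      (Finset (Fin n) → W) →L[ℝ] CliffordModule n W) ∘L
    ContinuousLinearMap.pi fun C => ∑ A : Finset (Fin n),
      (cliffordSign A (symmDiff A C) * a A) •
        PiLp.proj (𝕜 := ℝ) 2 (fun _ : Finset (Fin n) => W) (symmDiff A C)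

/-- Right multiplication `v ↦ v a = ∑_{A,B} (v_A a_B) ⊗ (e_A e_B)`; the coefficient at `e_C`
collects the pairs `(A, B)` with `A = C ∆ B`. -/
def rightMul (a : Cl n) : CliffordModule n W →L[ℝ] CliffordModule n W :=
  ((PiLp.continuousLinearEquiv 2 ℝ (fun _ : Finset (Fin n) => W)).symm :
      (Finset (Fin n) → W) →L[ℝ] CliffordModule n W) ∘L
    ContinuousLinearMap.pi fun C => ∑ B : Finset (Fin n),
      (cliffordSign (symmDiff C B) B * a B) •
        PiLp.proj (𝕜 := ℝ) 2 (fun _ : Finset (Fin n) => W) (symmDiff C B)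

theorem leftMul_apply (a : Cl n) (v : CliffordModule n W) (C : Finset (Fin n)) :
    leftMul a v C =
      ∑ A : Finset (Fin n), (cliffordSign A (symmDiff A C) * a A) • v (symmDiff A C) := by
  simp [leftMul]

theorem rightMul_apply (a : Cl n) (v : CliffordModule n W) (C : Finset (Fin n)) :
    rightMul a v C =
      ∑ B : Finset (Fin n), (cliffordSign (symmDiff C B) B * a B) • v (symmDiff C B) := by
  simp [rightMul]

end Module

variable {n : ℕ}

/-- The basis element `e_A`. -/
def basisElt (A : Finset (Fin n)) : Cl n := EuclideanSpace.single A (1 : ℝ)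

/-- The unit is `e_∅`. -/
instance : One (Cl n) := ⟨basisElt ∅⟩

/-- The product of two Clifford numbers. -/
instance : Mul (Cl n) := ⟨fun a b => leftMul a b⟩

/-- The multiplication table of the basis elements. -/
theorem basisElt_mul (A B : Finset (Fin n)) :
    basisElt A * basisElt B = cliffordSign A B • basisElt (symmDiff A B) := by
  ext C
  change leftMul (basisElt A) (basisElt B) C = _
  rw [leftMul_apply, Finset.sum_eq_single A]
  · by_cases h : symmDiff A C = B
    · subst h
      simp [basisElt]
    · have h' : C ≠ symmDiff A B := by
        rintro rfl
        simp at h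
      simp [basisElt, h, h']
  · intro A' _ hA'
    simp [basisElt, hA']
  · simp

/-- The conjugate `∑_A (-1)^{|A|(|A|+1)/2} s_A e_A`. -/
def conj (s : Cl n) : Cl n :=
  WithLp.toLp 2 fun A => (-1 : ℝ) ^ (A.card * (A.card + 1) / 2) * s A

/-- The paravectors `s_0 + s_1 e_1 + ⋯ + s_n e_n`, i.e. the space `ℝ^{n+1}` inside `ℝ_n`. -/
def paravectors (n : ℕ) : Set (Cl n) := {s | ∀ A : Finset (Fin n), 1 < A.card → s A = 0}

/-- The real part `s_0`. -/
def re (s : Cl n) : ℝ := s ∅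

/-- The sphere `𝕊` of purely imaginary paravectors of modulus one. -/
def unitSphere (n : ℕ) : Set (Cl n) := {J | J ∈ paravectors n ∧ re J = 0 ∧ ‖J‖ = 1}

/-- The inverse `s̄ / |s|²` of a nonzero paravector. -/
def paraInv (s : Cl n) : Cl n := (‖s‖ ^ 2)⁻¹ • conj s

/-- The point `x + J y` of the plane `ℂ_J`. -/
def planePoint (J : Cl n) (x y : ℝ) : Cl n := x • (1 : Cl n) + y • J

/-- The point `t e^{Jφ} = t (cos φ + J sin φ)`. -/
def polar (J : Cl n) (t φ : ℝ) : Cl n := planePoint J (t * Real.cos φ) (t * Real.sin φ)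

/-! ## The double sector and slice hyperholomorphic functions -/

/-- The set of angles `I_θ = (-θ, θ) ∪ (π - θ, π + θ)`. -/
def angles (θ : ℝ) : Set ℝ := Ioo (-θ) θ ∪ Ioo (Real.pi - θ) (Real.pi + θ)

/-- The double sector `D_θ`: nonzero paravectors whose argument, in a plane `ℂ_J` that contains
them, lies in `I_θ`. -/
def doubleSector (n : ℕ) (θ : ℝ) : Set (Cl n) :=
  {s | ∃ J ∈ unitSphere n, ∃ t : ℝ, 0 < t ∧ ∃ φ ∈ angles θ, s = polar J t φ}

/-- The set of all `(x, y) ∈ ℝ²` with `x + 𝕊 y ⊆ U`. -/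
def sliceDomain (U : Set (Cl n)) : Set (ℝ × ℝ) :=
  {p | ∀ J ∈ unitSphere n, planePoint J p.1 p.2 ∈ U}

/-- `f` is left slice hyperholomorphic on the (open, axially symmetric) set `U` of paravectors,
with components `f₀`, `f₁`. Values of `f` outside `U` are irrelevant. -/
structure IsSliceWith (U : Set (Cl n)) (f : Cl n → Cl n) (f₀ f₁ : ℝ × ℝ → Cl n) : Prop where
  contDiffOn_fst : ContDiffOn ℝ 1 f₀ (sliceDomain U)
  contDiffOn_snd : ContDiffOn ℝ 1 f₁ (sliceDomain U)
  repr : ∀ p ∈ sliceDomain U, ∀ J ∈ unitSphere n,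
    f (planePoint J p.1 p.2) = f₀ p + J * f₁ p
  even : ∀ p ∈ sliceDomain U, f₀ (p.1, -p.2) = f₀ p
  odd : ∀ p ∈ sliceDomain U, f₁ (p.1, -p.2) = -f₁ p
  cauchyRiemann₁ : ∀ p ∈ sliceDomain U, fderiv ℝ f₀ p (1, 0) = fderiv ℝ f₁ p (0, 1)
  cauchyRiemann₂ : ∀ p ∈ sliceDomain U, fderiv ℝ f₀ p (0, 1) = -fderiv ℝ f₁ p (1, 0)

/-- `f ∈ SH_L(U)`: left slice hyperholomorphic functions. -/
def SH (U : Set (Cl n)) (f : Cl n → Cl n) : Prop := ∃ f₀ f₁, IsSliceWith U f f₀ f₁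

/-- `f ∈ N(U)`: intrinsic functions, i.e. the components are real valued. -/
def Intrinsic (U : Set (Cl n)) (f : Cl n → Cl n) : Prop :=
  ∃ u v : ℝ × ℝ → ℝ, IsSliceWith U f (fun p => u p • (1 : Cl n)) (fun p => v p • (1 : Cl n))

/-- `f` is bounded on `D_θ`, and `∫₀^∞ |f(t e^{Jφ})| dt/t < ∞` for all `J ∈ 𝕊`, `φ ∈ I_θ`. -/
def Decays (θ : ℝ) (f : Cl n → Cl n) : Prop :=
  (∃ C : ℝ, ∀ s ∈ doubleSector n θ, ‖f s‖ ≤ C) ∧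
    ∀ J ∈ unitSphere n, ∀ φ ∈ angles θ,
      IntegrableOn (fun t : ℝ => ‖f (polar J t φ)‖ / t) (Ioi 0)

/-- The class `SH_L^0(D_θ)`. -/
def SHZero (θ : ℝ) (f : Cl n → Cl n) : Prop := SH (doubleSector n θ) f ∧ Decays θ f

/-- The class `N^0(D_θ)`. -/
def NZero (θ : ℝ) (f : Cl n → Cl n) : Prop := Intrinsic (doubleSector n θ) f ∧ Decays θ f

/-- The representation `f(s) = f_∞ + (1 + s²)⁻¹ (f_0 - f_∞) + f̃(s)` on `D_θ`. -/
def HasBndForm (θ : ℝ) (f : Cl n → Cl n) (f0 finf : Cl n) (ftilde : Cl n → Cl n) : Prop :=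
  ∀ s ∈ doubleSector n θ, f s = finf + paraInv (1 + s * s) * (f0 - finf) + ftilde s

/-- The class `SH_L^bnd(D_θ)`. -/
def SHBnd (θ : ℝ) (f : Cl n → Cl n) : Prop :=
  ∃ (f0 finf : Cl n) (ftilde : Cl n → Cl n), SHZero θ ftilde ∧ HasBndForm θ f f0 finf ftilde

/-- The class `N^bnd(D_θ)`. -/
def NBnd (θ : ℝ) (g : Cl n → Cl n) : Prop :=
  ∃ (g0 ginf : ℝ) (gtilde : Cl n → Cl n),
    NZero θ gtilde ∧ HasBndForm θ g (g0 • (1 : Cl n)) (ginf • (1 : Cl n)) gtilde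

/-! ## Unbounded operators -/

section PartialMaps

variable {V : Type*} [NormedAddCommGroup V] [NormedSpace ℝ V]

/-- The product `A B` of unbounded operators, with domain `{v ∈ dom B | B v ∈ dom A}`. -/
def pcomp (A B : V →ₗ.[ℝ] V) : V →ₗ.[ℝ] V :=
  A.comp (B.domRestrict ((A.domain.comap B.toFun).map B.domain.subtype)) (by
    rintro ⟨x, ⟨y, hy, hyx⟩, hx⟩
    have hy' : B y ∈ A.domain := hy
    have hxy : y = ⟨x, hx⟩ := Subtype.ext hyx
    subst hxy
    exact hy')

/-- A bounded operator as an everywhere defined one. -/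
def ofBounded (B : V →L[ℝ] V) : V →ₗ.[ℝ] V := (B : V →ₗ[ℝ] V).toPMap ⊤

/-- `B` is the everywhere defined bounded inverse of the operator `A`. -/
def IsBoundedInverse (A : V →ₗ.[ℝ] V) (B : V →L[ℝ] V) : Prop :=
  (∀ v : V, ∃ h : B v ∈ A.domain, A ⟨B v, h⟩ = v) ∧ ∀ u : A.domain, B (A u) = u

end PartialMaps

/-- The set `K(V)` of closed right-linear operators with two-sided linear domain in
`V = W ⊗ ℝ_n`. -/
structure ClosedOp (n : ℕ) (W : Type*) [NormedAddCommGroup W] [NormedSpace ℝ W] where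
  toPMap : CliffordModule n W →ₗ.[ℝ] CliffordModule n W
  leftMul_mem : ∀ (a : Cl n), ∀ v ∈ toPMap.domain, leftMul a v ∈ toPMap.domain
  rightMul_mem : ∀ (a : Cl n), ∀ v ∈ toPMap.domain, rightMul a v ∈ toPMap.domain
  map_rightMul : ∀ (a : Cl n) (v : toPMap.domain),
    toPMap ⟨rightMul a v, rightMul_mem a v v.2⟩ = rightMul a (toPMap v)
  isClosed : toPMap.IsClosed

section Operators

variable {W : Type*} [NormedAddCommGroup W] [NormedSpace ℝ W]

/-- `Q_s[T] = T² - 2 s_0 T + |s|²` with domain `dom(T²)`. -/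
def Qop (T : ClosedOp n W) (s : Cl n) : CliffordModule n W →ₗ.[ℝ] CliffordModule n W :=
  pcomp T.toPMap T.toPMap - (2 * re s) • T.toPMap
    + ofBounded ((‖s‖ ^ 2) • ContinuousLinearMap.id ℝ (CliffordModule n W))

/-- The `S`-resolvent set: the paravectors `s` for which `Q_s[T]` has a bounded inverse. -/
def resolventSet (T : ClosedOp n W) : Set (Cl n) :=
  {s | s ∈ paravectors n ∧ ∃ B, IsBoundedInverse (Qop T s) B}

/-- The `S`-spectrum. -/
def sSpectrum (T : ClosedOp n W) : Set (Cl n) := paravectors n \ resolventSet T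

open Classical in
/-- The bounded operator `Q_s[T]⁻¹` for `s` in the `S`-resolvent set (and `0` otherwise). -/
def qInv (T : ClosedOp n W) (s : Cl n) : CliffordModule n W →L[ℝ] CliffordModule n W :=
  if h : ∃ B, IsBoundedInverse (Qop T s) B then h.choose else 0

theorem qInv_mem (T : ClosedOp n W) (s : Cl n) (v : CliffordModule n W) :
    qInv T s v ∈ T.toPMap.domain := by
  unfold qInv
  split_ifs with h
  · obtain ⟨hm, -⟩ := h.choose_spec.1 v
    exact hm.1.2
  · simp

/-- The operator `T Q_s[T]⁻¹` as an everywhere defined linear map. -/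
def tqInvLin (T : ClosedOp n W) (s : Cl n) : CliffordModule n W →ₗ[ℝ] CliffordModule n W :=
  T.toPMap.toFun ∘ₗ
    LinearMap.codRestrict T.toPMap.domain (qInv T s : CliffordModule n W →ₗ[ℝ] _) (qInv_mem T s)

theorem isClosed_graph_tqInvLin (T : ClosedOp n W) (s : Cl n) :
    IsClosed ((tqInvLin T s).graph : Set (CliffordModule n W × CliffordModule n W)) := by
  have h : ((tqInvLin T s).graph : Set (CliffordModule n W × CliffordModule n W)) =
      (fun p : CliffordModule n W × CliffordModule n W => (qInv T s p.1, p.2)) ⁻¹'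
        (T.toPMap.graph : Set (CliffordModule n W × CliffordModule n W)) := by
    ext ⟨v, w⟩
    simp only [SetLike.mem_coe, LinearMap.mem_graph_iff, mem_preimage, LinearPMap.mem_graph_iff]
    constructor
    · rintro rfl
      exact ⟨⟨_, qInv_mem T s v⟩, rfl, rfl⟩
    · rintro ⟨y, hy, rfl⟩
      have : y = ⟨_, qInv_mem T s v⟩ := Subtype.ext hy
      rw [this]
      rfl
  rw [h]
  exact T.isClosed.preimage (by fun_prop)

variable [CompleteSpace W]

/-- The operator `T Q_s[T]⁻¹`, bounded by the closed graph theorem. -/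
def tqInv (T : ClosedOp n W) (s : Cl n) : CliffordModule n W →L[ℝ] CliffordModule n W :=
  ContinuousLinearMap.ofIsClosedGraph (isClosed_graph_tqInvLin T s)

/-- The left `S`-resolvent operator `S_L⁻¹(s, T) = Q_s[T]⁻¹ s̄ - T Q_s[T]⁻¹`. -/
def sResolvent (T : ClosedOp n W) (s : Cl n) : CliffordModule n W →L[ℝ] CliffordModule n W :=
  qInv T s ∘L leftMul (conj s) - tqInv T s

/-- `T` is bisectorial of angle `ω`. -/
structure IsBisectorial (T : ClosedOp n W) (ω : ℝ) : Prop where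
  spectrum_subset : sSpectrum T ⊆ closure (doubleSector n ω)
  resolvent_bound : ∀ φ ∈ Ioo ω (Real.pi / 2), ∃ C : ℝ, 0 ≤ C ∧
    ∀ s ∈ paravectors n, s ∉ doubleSector n φ → s ≠ 0 → ‖sResolvent T s‖ ≤ C / ‖s‖

/-! ## The functional calculi -/

/-- The integral of `S_L⁻¹(s, T) ds_J f(s)` along the ray `s = t e^{Jψ}`, `t` from `0` to `∞`;
there `ds_J = s'(t) / J dt` and `e^{Jψ} / J = sin ψ - J cos ψ`. -/
def rayIntegral (T : ClosedOp n W) (J : Cl n) (ψ : ℝ) (f : Cl n → Cl n) :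
    CliffordModule n W →L[ℝ] CliffordModule n W :=
  ∫ t in Ioi (0 : ℝ), sResolvent T (polar J t ψ) ∘L
    leftMul (planePoint J (Real.sin ψ) (-Real.cos ψ) * f (polar J t ψ))

/-- The `ω`-functional calculus `f(T) = (2π)⁻¹ ∫_{∂D_φ ∩ ℂ_J} S_L⁻¹(s, T) ds_J f(s)`. The positively
oriented boundary of `D_φ` in `ℂ_J` runs inwards along the rays of angles `φ` and `π + φ`, and
outwards along those of angles `-φ` and `π - φ`. -/
def omegaCalc (T : ClosedOp n W) (φ : ℝ) (J : Cl n) (f : Cl n → Cl n) :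
    CliffordModule n W →L[ℝ] CliffordModule n W :=
  (2 * Real.pi)⁻¹ • (rayIntegral T J (-φ) f - rayIntegral T J φ f
    + rayIntegral T J (Real.pi - φ) f - rayIntegral T J (Real.pi + φ) f)

open Classical in
/-- The extended `ω`-functional calculus
`f(T) = f_∞ + (1 + T²)⁻¹ (f_0 - f_∞) + f̃(T)` of `f ∈ SH_L^bnd(D_θ)`, where `1 + T² = Q_J[T]`
(and `0` for other functions). -/
def extCalc (T : ClosedOp n W) (θ φ : ℝ) (J : Cl n) (f : Cl n → Cl n) :
    CliffordModule n W →L[ℝ] CliffordModule n W :=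
  if h : SHBnd θ f then
    leftMul h.choose_spec.choose
      + qInv T J ∘L leftMul (h.choose - h.choose_spec.choose)
      + omegaCalc T φ J h.choose_spec.choose_spec.choose
  else 0

/-- `e` is a regularizer of `f`: `e ∈ N^bnd(D_θ)`, `e f ∈ SH_L^bnd(D_θ)`, `e(T)` injective. -/
def IsRegularizer (T : ClosedOp n W) (θ φ : ℝ) (J : Cl n) (e f : Cl n → Cl n) : Prop :=
  NBnd θ e ∧ SHBnd θ (fun s => e s * f s) ∧ Function.Injective (extCalc T θ φ J e)

/-- The class `SH_L^reg(D_θ)` of regularizable left slice hyperholomorphic functions. -/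
def SHReg (T : ClosedOp n W) (θ φ : ℝ) (J : Cl n) (f : Cl n → Cl n) : Prop :=
  SH (doubleSector n θ) f ∧ ∃ e, IsRegularizer T θ φ J e f

/-- The class `N^reg(D_θ)` of regularizable intrinsic functions. -/
def NReg (T : ClosedOp n W) (θ φ : ℝ) (J : Cl n) (g : Cl n → Cl n) : Prop :=
  Intrinsic (doubleSector n θ) g ∧ ∃ e, NBnd θ e ∧ NBnd θ (fun s => e s * g s) ∧
    Function.Injective (extCalc T θ φ J e)

/-- The `H^∞`-functional calculus `f(T) = e(T)⁻¹ (e f)(T)`, formed with the regularizer `e`. -/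
def hInfty (T : ClosedOp n W) (θ φ : ℝ) (J : Cl n) (e f : Cl n → Cl n) :
    CliffordModule n W →ₗ.[ℝ] CliffordModule n W :=
  pcomp (ofBounded (extCalc T θ φ J e)).inverse
    (ofBounded (extCalc T θ φ J fun s => e s * f s))

end Operators

end CliffordCalc

end

open MeasureTheory Set

noncomputable section

namespace CliffordCalc

open Filter Topology ComplexConjugate

/-! Let `e₁`, `e₂`, `e₃` regularize `f`, `g` and `gf`. Since `e₁(T)` is injective, `(v, w)` lies in
the graph of `f(T)` exactly when `e₁(T) w = (e₁ f)(T) v` (`mem_graph_hInfty`). The theorem thereby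
becomes a statement about bounded operators: `e₃(T) (e₂ g)(T) (e₁ f)(T) = e₁(T) e₂(T) (e₃ g f)(T)`,
because both sides are `(e₁ e₂ e₃ g f)(T)`. Operators of intrinsic functions commute, and the
injective ones can be cancelled; this yields the inclusion and the domain formula (`product_rule`).
The product of a regularizer of `g` and one of `f` regularizes `gf` (`SHReg.mul`).

What remains is that the bounded calculus is multiplicative when the left factor is intrinsic. Every
left slice hyperholomorphic `f` is a sum of terms `F_A e_A`, where `F_A` is a holomorphic function
on a planar double sector, symmetric under conjugation and read in the plane `ℂ_J`. Intrinsic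
functions have the single component `A = ∅`, and multiplication by them from the left multiplies
every `F_A`. When the boundary rays are combined in conjugate pairs, one finds `f(T) = ∑ F_A(T) e_A`
(`omegaCalc_eq`, `extCalc_eq`), where `F_A(T)` involves only `q z = Q_z[T]⁻¹` and `p z = T q z`. The
noncommutativity of the Clifford numbers has disappeared, and the task is a scalar calculus with
values in a real Banach algebra (`holCalc`).

In that algebra only the imaginary part of `c (conj z * q z - p z)`, formally of `c (z - T)⁻¹`, is
available, so the integrals run over the rays in the upper half plane. Multiplicativity
(`ResolventPair.holCalc_mul`) is the classical argument: two contours at different angles, the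
resolvent equation, Fubini and Cauchy's formula. The resolvent equation leaves extra terms, but
their coefficients are imaginary parts of integrals that can be rotated to the real axis, where the
integrand is real (`im_integral_ray_eq_zero`, by `integral_ray_eq`).

Limits at `0` and `∞` bring in `ρ = (1 + z²)⁻¹`. As `ρ² = ρ - κ²` with `κ = z (1 + z²)⁻¹` decaying,
the extended calculus is closed under products (`ResolventPair.isExt_mul`) once `κ(T) = T (1 +
T²)⁻¹` is known (`ResolventPair.holCalc_kappa`). -/

/-! ## Rotation of ray integrals -/

/-- The point `t e^{iψ}` of the complex plane. -/
def ray (ψ t : ℝ) : ℂ := t * Complex.exp (ψ * Complex.I)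

/-- Since `Re w² = (Re w)² - (Im w)²`, the Gaussian decays along a horizontal strip and grows only
with the bounded height. -/
theorem norm_exp_neg_mul_sq_le {δ : ℝ} (hδ : 0 ≤ δ) (w : ℂ) {B : ℝ} (hB : |w.im| ≤ B) :
    ‖Complex.exp (-δ * w ^ 2)‖ ≤ Real.exp (δ * B ^ 2) * Real.exp (-δ * w.re ^ 2) := by
  have h2 : w.im ^ 2 ≤ B ^ 2 := by
    rw [← sq_abs]; gcongr
  rw [Complex.norm_exp, ← Real.exp_add, Real.exp_le_exp]
  have : (-(δ : ℂ) * w ^ 2).re = -δ * (w.re ^ 2 - w.im ^ 2) := by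
    simp [pow_two]
  rw [this]
  nlinarith

/-- A bounded holomorphic function on a strip with a Gaussian factor has the same integral over both
boundary lines. -/
theorem integral_strip_gaussian {a b δ M : ℝ} (hab : a ≤ b) (hδ : 0 < δ) {g : ℂ → ℂ}
    (hg : DifferentiableOn ℂ g {w | w.im ∈ Icc a b}) (hM : ∀ w : ℂ, w.im ∈ Icc a b → ‖g w‖ ≤ M)
    (ha : Integrable fun x : ℝ => g (x + a * Complex.I))
    (hb : Integrable fun x : ℝ => g (x + b * Complex.I)) :
    ∫ x : ℝ, Complex.exp (-δ * (x + a * Complex.I) ^ 2) * g (x + a * Complex.I) =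
      ∫ x : ℝ, Complex.exp (-δ * (x + b * Complex.I) ^ 2) * g (x + b * Complex.I) := by
  set h : ℂ → ℂ := fun w => Complex.exp (-δ * w ^ 2) * g w with hh
  set B := max |a| |b| with hBdef
  have hBy : ∀ y ∈ Icc a b, |y| ≤ B := fun y hy => abs_le_max_abs_abs hy.1 hy.2
  have hhd : DifferentiableOn ℂ h {w | w.im ∈ Icc a b} := by
    apply DifferentiableOn.mul _ hg
    fun_prop
  have hint : ∀ y ∈ Icc a b, Integrable (fun x : ℝ => g (x + y * Complex.I)) →
      Integrable fun x : ℝ => h (x + y * Complex.I) := by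
    intro y hy hi
    refine hi.bdd_mul (c := Real.exp (δ * B ^ 2)) (by fun_prop) (ae_of_all _ fun x => ?_)
    refine (norm_exp_neg_mul_sq_le hδ.le _ (B := B) (by simpa using hBy y hy)).trans ?_
    refine mul_le_of_le_one_right (Real.exp_pos _).le ?_
    rw [Real.exp_le_one_iff]
    have : 0 ≤ δ * x ^ 2 := by positivity
    simpa using this
  have hla := intervalIntegral_tendsto_integral (hint a ⟨le_rfl, hab⟩ ha)
    tendsto_neg_atTop_atBot tendsto_id
  have hlb := intervalIntegral_tendsto_integral (hint b ⟨hab, le_rfl⟩ hb)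
    tendsto_neg_atTop_atBot tendsto_id
  have hM0 : 0 ≤ M := (norm_nonneg _).trans (hM (a * Complex.I) (by simp [hab]))
  -- The vertical sides at `R` and `-R` vanish in the limit: `g` is merely bounded, and all decay
  -- comes from the Gaussian factor.
  have hvert : ∀ σ : ℝ → ℝ, (∀ R, σ R ^ 2 = R ^ 2) →
      Tendsto (fun R : ℝ => ∫ y in a..b, h (σ R + y * Complex.I)) atTop (𝓝 0) := by
    intro σ hσ
    have hlim : Tendsto (fun R : ℝ => Real.exp (δ * B ^ 2) * Real.exp (-δ * R ^ 2) * M * |b - a|)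
        atTop (𝓝 0) := by
      have : Tendsto (fun R : ℝ => Real.exp (-δ * R ^ 2)) atTop (𝓝 0) := by
        apply Real.tendsto_exp_atBot.comp
        simp only [neg_mul]
        exact tendsto_neg_atTop_atBot.comp
          ((tendsto_pow_atTop two_ne_zero).const_mul_atTop hδ)
      simpa using ((this.const_mul (Real.exp (δ * B ^ 2))).mul_const M).mul_const |b - a|
    refine squeeze_zero_norm (fun R => ?_) hlim
    refine intervalIntegral.norm_integral_le_of_norm_le_const fun y hy => ?_
    rw [uIoc_of_le hab] at hy
    have hy' : y ∈ Icc a b := ⟨hy.1.le, hy.2⟩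
    rw [hh]
    simp only [norm_mul]
    gcongr
    · refine (norm_exp_neg_mul_sq_le hδ.le _ (B := B) (by simpa using hBy y hy')).trans ?_
      simp [hσ]
    · exact hM _ (by simpa using hy')
  have hv1 := hvert (fun R => R) (fun _ => rfl)
  have hv2 := hvert (fun R => -R) (fun _ => by ring)
  have key : ∀ R : ℝ, (∫ x : ℝ in -R..R, h (x + a * Complex.I)) -
      (∫ x : ℝ in -R..R, h (x + b * Complex.I)) +
      Complex.I • (∫ y : ℝ in a..b, h (R + y * Complex.I)) -
      Complex.I • (∫ y : ℝ in a..b, h ((-R : ℝ) + y * Complex.I)) = 0 := by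
    intro R
    have := Complex.integral_boundary_rect_eq_zero_of_differentiableOn h (⟨-R, a⟩ : ℂ) ⟨R, b⟩
      (hhd.mono fun w hw => by simpa [uIcc_of_le hab] using hw.2)
    simpa using this
  have hl := ((hla.sub hlb).add (hv1.const_smul Complex.I)).sub (hv2.const_smul Complex.I)
  have hl' := hl.congr (f₂ := fun _ => 0) (fun R => by simpa using key R)
  have h0 := tendsto_nhds_unique hl' tendsto_const_nhds
  have h1 : ∫ x : ℝ, h (x + a * Complex.I) = ∫ x : ℝ, h (x + b * Complex.I) := by
    simpa [sub_eq_zero] using h0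
  exact h1

/-- The Gaussian factor was needed only for the vertical sides. It is removed by dominated
convergence as `δ` tends to `0` from the right; for `δ < 1` it is at most `exp (y ^ 2)` on the line
of height `y`. -/
theorem integral_strip {a b M : ℝ} (hab : a ≤ b) {g : ℂ → ℂ}
    (hg : DifferentiableOn ℂ g {w | w.im ∈ Icc a b}) (hM : ∀ w : ℂ, w.im ∈ Icc a b → ‖g w‖ ≤ M)
    (ha : Integrable fun x : ℝ => g (x + a * Complex.I))
    (hb : Integrable fun x : ℝ => g (x + b * Complex.I)) :
    ∫ x : ℝ, g (x + a * Complex.I) = ∫ x : ℝ, g (x + b * Complex.I) := by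
  have lim : ∀ y : ℝ, Integrable (fun x : ℝ => g (x + y * Complex.I)) →
      Tendsto (fun δ : ℝ => ∫ x : ℝ,
        Complex.exp (-δ * (x + y * Complex.I) ^ 2) * g (x + y * Complex.I)) (𝓝[>] 0)
        (𝓝 (∫ x : ℝ, g (x + y * Complex.I))) := by
    intro y hi
    refine tendsto_integral_filter_of_dominated_convergence
      (fun x => Real.exp (y ^ 2) * ‖g (x + y * Complex.I)‖) ?_ ?_ (hi.norm.const_mul _) ?_
    · exact Eventually.of_forall fun δ =>
        (Continuous.aestronglyMeasurable (by fun_prop)).mul hi.aestronglyMeasurable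
    · filter_upwards [Ioo_mem_nhdsGT (zero_lt_one' ℝ)] with δ hδ
      refine ae_of_all _ fun x => ?_
      rw [norm_mul]
      gcongr
      refine (norm_exp_neg_mul_sq_le hδ.1.le _ (B := |y|) (by simp)).trans ?_
      rw [← Real.exp_add, Real.exp_le_exp, sq_abs]
      have h1 : 0 ≤ δ * ((x : ℂ) + y * Complex.I).re ^ 2 := mul_nonneg hδ.1.le (sq_nonneg _)
      have h2 := hδ.2
      nlinarith [sq_nonneg y]
    · refine ae_of_all _ fun x => ?_
      have : Continuous fun δ : ℝ =>
          Complex.exp (-δ * (x + y * Complex.I) ^ 2) * g (x + y * Complex.I) := by fun_prop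
      have := (this.tendsto 0).mono_left (nhdsWithin_le_nhds (s := Ioi 0))
      simpa using this
  refine tendsto_nhds_unique (lim a ha) ((lim b hb).congr' ?_)
  filter_upwards [self_mem_nhdsWithin] with δ hδ
  exact (integral_strip_gaussian hab hδ hg hM ha hb).symm

/-! ### Logarithmic coordinates on rays -/

theorem exp_image_univ : Real.exp '' univ = Ioi 0 := by
  rw [image_univ, Real.range_exp]

theorem integrableOn_Ioi_iff_comp_exp {F : ℝ → ℂ} :
    IntegrableOn F (Ioi 0) ↔ Integrable fun x : ℝ => (Real.exp x : ℂ) * F (Real.exp x) := by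
  rw [← exp_image_univ, integrableOn_image_iff_integrableOn_abs_deriv_smul MeasurableSet.univ
    (fun x _ => (Real.hasDerivAt_exp x).hasDerivWithinAt) Real.exp_injective.injOn,
    integrableOn_univ]
  simp

theorem integral_Ioi_eq_comp_exp (F : ℝ → ℂ) :
    ∫ t in Ioi 0, F t = ∫ x : ℝ, (Real.exp x : ℂ) * F (Real.exp x) := by
  rw [← exp_image_univ, integral_image_eq_integral_abs_deriv_smul MeasurableSet.univ
    (fun x _ => (Real.hasDerivAt_exp x).hasDerivWithinAt) Real.exp_injective.injOn,
    setIntegral_univ]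
  simp

theorem exp_add_mul_I (x ψ : ℝ) : Complex.exp (x + ψ * Complex.I) = ray ψ (Real.exp x) := by
  simp [ray, Complex.exp_add]

theorem norm_ray (ψ t : ℝ) : ‖ray ψ t‖ = |t| := by simp [ray, Complex.norm_exp_ofReal_mul_I]

theorem continuous_ray (ψ : ℝ) : Continuous (ray ψ) := by unfold ray; fun_prop

theorem ray_re (ψ t : ℝ) : (ray ψ t).re = t * Real.cos ψ := by
  simp [ray, Complex.exp_ofReal_mul_I_re]

theorem ray_im (ψ t : ℝ) : (ray ψ t).im = t * Real.sin ψ := by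
  simp [ray, Complex.exp_ofReal_mul_I_im]

/-- The integral `∫ F(z) dz` along a ray does not change under rotation of the ray inside a
sector of holomorphy in which `z F(z)` is bounded. -/
theorem integral_ray_eq {α β M : ℝ} (hab : α ≤ β) {F : ℂ → ℂ} {U : Set ℂ} (hU : IsOpen U)
    (hF : DifferentiableOn ℂ F U) (hmem : ∀ ψ ∈ Icc α β, ∀ t : ℝ, 0 < t → ray ψ t ∈ U)
    (hM : ∀ ψ ∈ Icc α β, ∀ t : ℝ, 0 < t → t * ‖F (ray ψ t)‖ ≤ M)
    (ha : IntegrableOn (fun t => F (ray α t)) (Ioi 0))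
    (hb : IntegrableOn (fun t => F (ray β t)) (Ioi 0)) :
    ∫ t in Ioi (0 : ℝ), Complex.exp (α * Complex.I) * F (ray α t) =
      ∫ t in Ioi (0 : ℝ), Complex.exp (β * Complex.I) * F (ray β t) := by
  -- With `z = exp w` the sector becomes the strip `α ≤ Im w ≤ β` and `F z dz` becomes `g w dw`. The
  -- bound on `z F z` is exactly boundedness of `g`.
  set g : ℂ → ℂ := fun w => Complex.exp w * F (Complex.exp w) with hg
  have hmem' : ∀ w : ℂ, w.im ∈ Icc α β → Complex.exp w ∈ U := by
    intro w hw
    have := hmem _ hw _ (Real.exp_pos w.re)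
    rwa [← exp_add_mul_I, Complex.re_add_im] at this
  have hgd : DifferentiableOn ℂ g {w | w.im ∈ Icc α β} := by
    intro w hw
    have : DifferentiableAt ℂ F (Complex.exp w) :=
      (hF _ (hmem' w hw)).differentiableAt (hU.mem_nhds (hmem' w hw))
    exact (Complex.differentiableAt_exp.mul
      (DifferentiableAt.comp w this Complex.differentiableAt_exp)).differentiableWithinAt
  have hgM : ∀ w : ℂ, w.im ∈ Icc α β → ‖g w‖ ≤ M := by
    intro w hw
    have := hM _ hw _ (Real.exp_pos w.re)
    rw [← exp_add_mul_I, Complex.re_add_im] at this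
    simpa [hg, Complex.norm_exp] using this
  have hgr : ∀ (ψ x : ℝ), g (x + ψ * Complex.I) =
      (Real.exp x : ℂ) * (Complex.exp (ψ * Complex.I) * F (ray ψ (Real.exp x))) := by
    intro ψ x
    simp only [hg, exp_add_mul_I]
    rw [show ray ψ (Real.exp x) = Real.exp x * Complex.exp (ψ * Complex.I) from rfl]
    ring
  have hi : ∀ ψ : ℝ, IntegrableOn (fun t => F (ray ψ t)) (Ioi 0) →
      Integrable fun x : ℝ => g (x + ψ * Complex.I) := by
    intro ψ h
    simp only [hgr]
    exact integrableOn_Ioi_iff_comp_exp.1 (h.const_mul (Complex.exp (ψ * Complex.I)))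
  have := integral_strip hab hgd hgM (hi α ha) (hi β hb)
  simp only [hgr] at this
  rw [integral_Ioi_eq_comp_exp, integral_Ioi_eq_comp_exp]
  exact this

/-! ## Cones in the complex plane -/

/-- The double sector of half opening angle `θ` in the complex plane. -/
def csector (θ : ℝ) : Set ℂ := {z | |z.im| * Real.cos θ < |z.re| * Real.sin θ}

/-- The double sector around the imaginary axis that consists of the nonzero points outside the
closure of `csector θ`. -/
def cocone (θ : ℝ) : Set ℂ := {z | |z.re| * Real.sin θ < |z.im| * Real.cos θ}

theorem isOpen_csector (θ : ℝ) : IsOpen (csector θ) := by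
  apply isOpen_lt <;> fun_prop

theorem isOpen_cocone (θ : ℝ) : IsOpen (cocone θ) := by
  apply isOpen_lt <;> fun_prop

theorem conj_mem_csector {θ : ℝ} {z : ℂ} (hz : z ∈ csector θ) : conj z ∈ csector θ := by
  simpa [csector] using hz

theorem conj_mem_cocone {θ : ℝ} {z : ℂ} (hz : z ∈ cocone θ) : conj z ∈ cocone θ := by
  simpa [cocone] using hz

theorem neg_mem_csector {θ : ℝ} {z : ℂ} (hz : z ∈ csector θ) : -z ∈ csector θ := by
  simpa [csector] using hz

theorem ne_zero_of_mem_csector {θ : ℝ} {z : ℂ} (hz : z ∈ csector θ) : z ≠ 0 := by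
  rintro rfl
  simp [csector] at hz

theorem ne_zero_of_mem_cocone {θ : ℝ} {z : ℂ} (hz : z ∈ cocone θ) : z ≠ 0 := by
  rintro rfl
  simp [cocone] at hz

theorem re_ne_zero_of_mem_csector {θ : ℝ} (hθ : θ ∈ Ioo 0 (Real.pi / 2)) {z : ℂ}
    (hz : z ∈ csector θ) : z.re ≠ 0 := by
  intro h
  have h1 : 0 ≤ |z.im| * Real.cos θ := mul_nonneg (abs_nonneg _)
    (Real.cos_nonneg_of_mem_Icc ⟨by linarith [hθ.1, Real.pi_pos], hθ.2.le⟩)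
  have h2 : |z.im| * Real.cos θ < |z.re| * Real.sin θ := hz
  rw [h] at h2
  simp only [abs_zero, zero_mul] at h2
  linarith

theorem ray_mem_csector {θ ψ t : ℝ} (hθ : θ ∈ Ioo 0 (Real.pi / 2)) (hψ : ψ ∈ Ioo (-θ) θ)
    (ht : 0 < t) : ray ψ t ∈ csector θ := by
  have h1 : 0 < Real.sin (θ - ψ) :=
    Real.sin_pos_of_pos_of_lt_pi (by linarith [hψ.2]) (by linarith [hψ.1, hθ.2])
  have h2 : 0 < Real.sin (θ + ψ) :=
    Real.sin_pos_of_pos_of_lt_pi (by linarith [hψ.1]) (by linarith [hψ.2, hθ.2])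
  have h3 : 0 < Real.cos ψ :=
    Real.cos_pos_of_mem_Ioo ⟨by linarith [hψ.1, hθ.2], by linarith [hψ.2, hθ.2]⟩
  rw [Real.sin_sub] at h1
  rw [Real.sin_add] at h2
  simp only [csector, mem_ofPred_eq, ray_re, ray_im, abs_mul, abs_of_pos ht, abs_of_pos h3]
  rw [mul_assoc, mul_assoc]
  refine mul_lt_mul_of_pos_left ?_ ht
  rcases abs_cases (Real.sin ψ) with ⟨h, _⟩ | ⟨h, _⟩ <;> rw [h] <;> linarith

theorem ray_add_pi (ψ t : ℝ) : ray (Real.pi + ψ) t = -ray ψ t := by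
  apply Complex.ext <;> simp [ray_re, ray_im, add_comm Real.pi ψ]

theorem ray_neg (ψ t : ℝ) : ray (-ψ) t = conj (ray ψ t) := by
  apply Complex.ext <;> simp [ray_re, ray_im]

theorem ray_pi_mem_csector {θ ψ t : ℝ} (hθ : θ ∈ Ioo 0 (Real.pi / 2))
    (hψ : ψ ∈ Ioo (Real.pi - θ) (Real.pi + θ)) (ht : 0 < t) : ray ψ t ∈ csector θ := by
  have := neg_mem_csector
    (ray_mem_csector hθ (ψ := ψ - Real.pi) ⟨by linarith [hψ.1], by linarith [hψ.2]⟩ ht)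
  rwa [← ray_add_pi, add_sub_cancel] at this

theorem ray_mem_csector_of_mem_angles {θ ψ t : ℝ} (hθ : θ ∈ Ioo 0 (Real.pi / 2))
    (hψ : ψ ∈ angles θ) (ht : 0 < t) : ray ψ t ∈ csector θ :=
  hψ.elim (fun h => ray_mem_csector hθ h ht) (fun h => ray_pi_mem_csector hθ h ht)

theorem ray_mem_cocone {θ ψ t : ℝ} (hθ : θ ∈ Ioo 0 (Real.pi / 2))
    (hψ : ψ ∈ Ioo θ (Real.pi - θ)) (ht : 0 < t) : ray ψ t ∈ cocone θ := by
  have h1 : 0 < Real.sin (ψ - θ) :=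
    Real.sin_pos_of_pos_of_lt_pi (by linarith [hψ.1]) (by linarith [hψ.2, hθ.1])
  have h2 : 0 < Real.sin (ψ + θ) :=
    Real.sin_pos_of_pos_of_lt_pi (by linarith [hψ.1, hθ.1]) (by linarith [hψ.2])
  have h3 : 0 < Real.sin ψ :=
    Real.sin_pos_of_pos_of_lt_pi (by linarith [hψ.1, hθ.1]) (by linarith [hψ.2, hθ.1])
  rw [Real.sin_sub] at h1
  rw [Real.sin_add] at h2
  simp only [cocone, mem_ofPred_eq, ray_re, ray_im, abs_mul, abs_of_pos ht, abs_of_pos h3]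
  rw [mul_assoc, mul_assoc]
  refine mul_lt_mul_of_pos_left ?_ ht
  rcases abs_cases (Real.cos ψ) with ⟨h, _⟩ | ⟨h, _⟩ <;> rw [h] <;> linarith

/-- The points of two cones with trivial intersection are apart. -/
theorem exists_dist_cones {α β : ℝ} (hα : 0 < α) (hαβ : α < β) (hβ : β < Real.pi / 2) :
    ∃ δ : ℝ, 0 < δ ∧ ∀ z μ : ℂ, |z.im| * Real.cos α ≤ |z.re| * Real.sin α →
      |μ.re| * Real.sin β ≤ |μ.im| * Real.cos β → δ * (‖z‖ + ‖μ‖) ≤ ‖z - μ‖ := by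
  -- The lines at the angles `±χ` separate the two cones with a margin `h` on either side. The
  -- linear form `x sin χ - y cos χ` in `x = |Re|`, `y = |Im|` is bounded below on the first cone by
  -- a multiple of the norm, and so is its negative on the second.
  set χ := (α + β) / 2 with hχ
  set h := (β - α) / 2 with hh
  have hpi := Real.pi_pos
  have hs : 0 < Real.sin h := Real.sin_pos_of_pos_of_lt_pi (by linarith) (by linarith)
  have hc : 0 < Real.cos h := Real.cos_pos_of_mem_Ioo ⟨by linarith, by linarith⟩
  set m := min (Real.sin h) (Real.cos h) with hm
  have hm0 : 0 < m := lt_min hs hc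
  -- Used with the coordinates `a`, `b` of a point in axes rotated to the edge of its cone, so that
  -- `a ^ 2 + b ^ 2` is the squared norm and the right side is the linear form at angle `χ`, up to
  -- sign.
  have key : ∀ a b : ℝ, 0 ≤ a → 0 ≤ b →
      m * Real.sqrt (a ^ 2 + b ^ 2) ≤ Real.cos h * a + Real.sin h * b := by
    intro a b ha hb
    have h1 : Real.sqrt (a ^ 2 + b ^ 2) ≤ a + b := by
      rw [Real.sqrt_le_left (by positivity)]
      nlinarith [mul_nonneg ha hb]
    have h2 : m * a ≤ Real.cos h * a := by gcongr; exact min_le_right _ _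
    have h3 : m * b ≤ Real.sin h * b := by gcongr; exact min_le_left _ _
    nlinarith
  -- The factor `1 / 2` arises because the differences of the real and of the imaginary parts are
  -- each estimated by `‖z - μ‖`.
  refine ⟨m / 2, by positivity, fun z μ hz hμ => ?_⟩
  have hcα : 0 < Real.cos α := Real.cos_pos_of_mem_Ioo ⟨by linarith, by linarith⟩
  have hsα : 0 < Real.sin α := Real.sin_pos_of_pos_of_lt_pi (by linarith) (by linarith)
  have hcβ : 0 < Real.cos β := Real.cos_pos_of_mem_Ioo ⟨by linarith, by linarith⟩
  have hsβ : 0 < Real.sin β := Real.sin_pos_of_pos_of_lt_pi (by linarith) (by linarith)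
  have hz' : m * ‖z‖ ≤ |z.re| * Real.sin χ - |z.im| * Real.cos χ := by
    have := key (|z.re| * Real.sin α - |z.im| * Real.cos α)
      (|z.re| * Real.cos α + |z.im| * Real.sin α) (by linarith) (by positivity)
    have e1 : (|z.re| * Real.sin α - |z.im| * Real.cos α) ^ 2 +
        (|z.re| * Real.cos α + |z.im| * Real.sin α) ^ 2 = z.re ^ 2 + z.im ^ 2 := by
      have := Real.sin_sq_add_cos_sq α
      rw [← sq_abs z.re, ← sq_abs z.im]
      linear_combination (|z.re| ^ 2 + |z.im| ^ 2) * this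
    have e2 : χ = α + h := by rw [hχ, hh]; ring
    rw [e1, ← Complex.norm_eq_sqrt_sq_add_sq] at this
    rw [e2, Real.sin_add, Real.cos_add]
    linarith
  have hμ' : m * ‖μ‖ ≤ |μ.im| * Real.cos χ - |μ.re| * Real.sin χ := by
    have := key (|μ.im| * Real.cos β - |μ.re| * Real.sin β)
      (|μ.re| * Real.cos β + |μ.im| * Real.sin β) (by linarith) (by positivity)
    have e1 : (|μ.im| * Real.cos β - |μ.re| * Real.sin β) ^ 2 +
        (|μ.re| * Real.cos β + |μ.im| * Real.sin β) ^ 2 = μ.re ^ 2 + μ.im ^ 2 := by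
      have := Real.sin_sq_add_cos_sq β
      rw [← sq_abs μ.re, ← sq_abs μ.im]
      linear_combination (|μ.re| ^ 2 + |μ.im| ^ 2) * this
    have e2 : χ = β - h := by rw [hχ, hh]; ring
    rw [e1, ← Complex.norm_eq_sqrt_sq_add_sq] at this
    rw [e2, Real.sin_sub, Real.cos_sub]
    linarith
  have hre : |z.re| - |μ.re| ≤ ‖z - μ‖ :=
    (abs_sub_abs_le_abs_sub _ _).trans (by simpa using Complex.abs_re_le_norm (z - μ))
  have him : |μ.im| - |z.im| ≤ ‖z - μ‖ :=
    (abs_sub_abs_le_abs_sub _ _).trans (by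
      rw [abs_sub_comm]; simpa using Complex.abs_im_le_norm (z - μ))
  have hcχ : 0 ≤ Real.cos χ := Real.cos_nonneg_of_mem_Icc ⟨by linarith, by linarith⟩
  have hsχ : 0 ≤ Real.sin χ := Real.sin_nonneg_of_nonneg_of_le_pi (by linarith) (by linarith)
  have i1 : (|z.re| - |μ.re|) * Real.sin χ ≤ ‖z - μ‖ := by
    refine (mul_le_mul_of_nonneg_right hre hsχ).trans ?_
    exact mul_le_of_le_one_right (norm_nonneg _) (Real.sin_le_one _)
  have i2 : (|μ.im| - |z.im|) * Real.cos χ ≤ ‖z - μ‖ := by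
    refine (mul_le_mul_of_nonneg_right him hcχ).trans ?_
    exact mul_le_of_le_one_right (norm_nonneg _) (Real.cos_le_one _)
  linarith

/-! ## Cauchy's formula for sectors -/

/-- The difference of the two sides is the sum of squares `(t - Re w)² + (|w|² - t Re w)²`. -/
theorem one_add_sq_le_normSq_sub (t : ℝ) (w : ℂ) :
    w.im ^ 2 * (1 + t ^ 2) ≤ (1 + ‖w‖ ^ 2) * ‖(t : ℂ) - w‖ ^ 2 := by
  simp only [← Complex.normSq_eq_norm_sq, Complex.normSq_apply, Complex.sub_re, Complex.sub_im,
    Complex.ofReal_re, Complex.ofReal_im]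
  nlinarith [sq_nonneg (t - w.re), sq_nonneg (-w.re * t + w.re ^ 2 + w.im ^ 2)]

theorem one_add_sq_le_norm_sq_sub (t : ℝ) (w : ℂ) :
    w.im ^ 2 * (1 + t ^ 2) ≤ (1 + ‖w‖ ^ 2) * ‖(t : ℂ) ^ 2 - w ^ 2‖ := by
  have h1 := one_add_sq_le_normSq_sub t w
  have h2 := one_add_sq_le_normSq_sub t (-w)
  rw [norm_neg, Complex.neg_im, neg_sq, sub_neg_eq_add] at h2
  have h3 : (t : ℂ) ^ 2 - w ^ 2 = (t - w) * (t + w) := by ring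
  rw [h3, norm_mul]
  have := mul_le_mul h1 h2 (by positivity) (by positivity)
  rw [← pow_le_pow_iff_left₀ (by positivity) (by positivity) two_ne_zero]
  calc _ = _ := by ring
    _ ≤ _ := this
    _ = _ := by ring

/-- Turns the ray of direction `u` into the real axis, where the preceding lower bound applies. -/
theorem sq_sub_sq_eq {u s : ℂ} (hu : ‖u‖ = 1) (t : ℝ) :
    ((t : ℂ) * u) ^ 2 - s ^ 2 = u ^ 2 * ((t : ℂ) ^ 2 - (s * conj u) ^ 2) := by
  have h : u * conj u = 1 := by
    rw [Complex.mul_conj, Complex.normSq_eq_norm_sq, hu]; simp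
  linear_combination (s ^ 2 * (1 + u * conj u)) * h

theorem sq_sub_sq_ne_zero {u s : ℂ} (hu : ‖u‖ = 1) (hs : (s * conj u).im ≠ 0) (t : ℝ) :
    ((t : ℂ) * u) ^ 2 - s ^ 2 ≠ 0 := by
  have hu0 : u ≠ 0 := by rintro rfl; simp at hu
  rw [sq_sub_sq_eq hu]
  refine mul_ne_zero (pow_ne_zero _ hu0) fun h => ?_
  have := one_add_sq_le_norm_sq_sub t (s * conj u)
  rw [h, norm_zero, mul_zero] at this
  have h2 : 0 < (s * conj u).im ^ 2 * (1 + t ^ 2) := by positivity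
  linarith

theorem integrableOn_two_mul_div {u s : ℂ} (hu : ‖u‖ = 1) (hs : (s * conj u).im ≠ 0) :
    IntegrableOn (fun t : ℝ => 2 * s / ((t * u) ^ 2 - s ^ 2)) (Ioi 0) := by
  refine Integrable.integrableOn ?_
  set w := s * conj u with hw
  have hI := integrable_inv_one_add_sq.const_mul (2 * ‖s‖ * ((1 + ‖w‖ ^ 2) / w.im ^ 2))
  refine hI.mono' (Continuous.aestronglyMeasurable ?_) (ae_of_all _ fun t => ?_)
  · exact Continuous.div (by fun_prop) (by fun_prop) (sq_sub_sq_ne_zero hu hs)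
  · have h0 : 0 < w.im ^ 2 := by positivity
    have h1 := one_add_sq_le_norm_sq_sub t w
    have h2 : ‖((t : ℂ) * u) ^ 2 - s ^ 2‖ = ‖(t : ℂ) ^ 2 - w ^ 2‖ := by
      rw [sq_sub_sq_eq hu]; simp [hu, hw]
    have h3 : 0 < ‖(t : ℂ) ^ 2 - w ^ 2‖ := by
      rw [← h2]; exact norm_pos_iff.2 (sq_sub_sq_ne_zero hu hs t)
    have h4 : ‖(t : ℂ) ^ 2 - w ^ 2‖⁻¹ ≤ (1 + ‖w‖ ^ 2) / w.im ^ 2 * (1 + t ^ 2)⁻¹ :=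
      calc ‖(t : ℂ) ^ 2 - w ^ 2‖⁻¹ ≤ (w.im ^ 2 * (1 + t ^ 2) / (1 + ‖w‖ ^ 2))⁻¹ :=
            inv_anti₀ (by positivity) (by rw [div_le_iff₀ (by positivity)]; linarith)
        _ = _ := by field_simp
    rw [norm_div, h2, norm_mul, Complex.norm_ofNat, div_eq_mul_inv, mul_assoc (2 * ‖s‖)]
    exact mul_le_mul_of_nonneg_left h4 (by positivity)

/-- An antiderivative is the logarithm of the Möbius quotient `(t u - s) / (t u + s)`. The factor
`-I` in `m` makes the path start at `I`, end at `-I` and run through the open right half plane in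
between, so that the principal logarithm is smooth along it and the value is `log (-I) - log I`. -/
theorem integral_two_mul_div_of_pos {u s : ℂ} (hu : ‖u‖ = 1) (hs : 0 < (u * conj s).im) :
    ∫ t in Ioi (0 : ℝ), u * (2 * s / ((t * u) ^ 2 - s ^ 2)) = -(Real.pi * Complex.I) := by
  have hs' : (s * conj u).im ≠ 0 := by
    have : (s * conj u).im = -(u * conj s).im := by simp; ring
    rw [this]; linarith
  have hs0 : s ≠ 0 := by rintro rfl; simp at hs
  have hne := sq_sub_sq_ne_zero hu hs'
  have hne1 : ∀ t : ℝ, (t : ℂ) * u - s ≠ 0 := fun t h => hne t (by linear_combination (t * u + s) * h)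
  have hne2 : ∀ t : ℝ, (t : ℂ) * u + s ≠ 0 := fun t h => hne t (by linear_combination (t * u - s) * h)
  set m : ℝ → ℂ := fun t => -Complex.I * ((t * u - s) / (t * u + s)) with hm
  have hslit : ∀ t : ℝ, 0 ≤ t → m t ∈ Complex.slitPlane := by
    intro t ht
    rcases ht.eq_or_lt with rfl | ht
    · simp [hm, hs0, Complex.mem_slitPlane_iff]
    · left
      have h1 : m t = -Complex.I * ((t * u - s) * conj (t * u + s)) / (Complex.normSq (t * u + s)) := by
        rw [← Complex.mul_conj]
        have h := hne2 t
        have h' : conj ((t : ℂ) * u + s) ≠ 0 := (map_ne_zero _).2 h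
        simp only [hm]
        field_simp
      have h2 : 0 < Complex.normSq (t * u + s) := Complex.normSq_pos.2 (hne2 t)
      rw [h1, Complex.div_ofReal_re]
      apply div_pos _ h2
      have : (-Complex.I * ((t * u - s) * conj (t * u + s))).re = 2 * t * (u * conj s).im := by
        simp; ring
      rw [this]; positivity
  have hderiv : ∀ t ∈ Ici (0 : ℝ), HasDerivAt (fun t => Complex.log (m t))
      (u * (2 * s / ((t * u) ^ 2 - s ^ 2))) t := by
    intro t ht
    have h1 : HasDerivAt (fun t : ℝ => (t : ℂ) * u) u t := by
      simpa using (Complex.ofRealCLM.hasDerivAt (x := t)).mul_const u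
    have h2 : HasDerivAt m (-Complex.I * ((u * (t * u + s) - (t * u - s) * u) / (t * u + s) ^ 2)) t :=
      ((h1.sub_const s).div (h1.add_const s) (hne2 t)).const_mul _
    have h3 := HasDerivAt.clog_real h2 (hslit t ht)
    convert h3 using 1
    have := hne t
    have := hne1 t
    have := hne2 t
    simp only [hm]
    rw [show ((t : ℂ) * u) ^ 2 - s ^ 2 = (t * u - s) * (t * u + s) by ring]
    field_simp
    ring
  have hlim : Tendsto (fun t => Complex.log (m t)) atTop (𝓝 (Complex.log (-Complex.I))) := by
    have h1 : Tendsto (fun t : ℝ => ((t : ℂ))⁻¹) atTop (𝓝 0) := by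
      have := (Complex.continuous_ofReal.tendsto 0).comp tendsto_inv_atTop_zero
      simpa [Function.comp_def] using this
    have hu0 : u ≠ 0 := by rintro rfl; simp at hu
    have h2 : Tendsto (fun t : ℝ => -Complex.I * ((u - s * ((t : ℂ))⁻¹) / (u + s * ((t : ℂ))⁻¹)))
        atTop (𝓝 (-Complex.I * ((u - s * 0) / (u + s * 0)))) :=
      ((tendsto_const_nhds.sub (h1.const_mul s)).div (tendsto_const_nhds.add (h1.const_mul s))
        (by simpa using hu0)).const_mul _
    have h3 : Tendsto m atTop (𝓝 (-Complex.I)) := by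
      have h4 : -Complex.I * ((u - s * 0) / (u + s * 0)) = -Complex.I := by simp [hu0]
      rw [h4] at h2
      refine h2.congr' ?_
      filter_upwards [eventually_gt_atTop 0] with t ht
      have : (t : ℂ) ≠ 0 := by exact_mod_cast ht.ne'
      simp only [hm]
      congr 1
      rw [← mul_div_mul_left _ _ this]
      congr 1 <;> field_simp
    exact h3.clog (by simp [Complex.mem_slitPlane_iff])
  have := integral_Ioi_of_hasDerivAt_of_tendsto' hderiv
    ((integrableOn_two_mul_div hu hs').const_mul u) hlim
  rw [this]
  have h0 : m 0 = Complex.I := by simp [hm, hs0]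
  rw [h0, Complex.log_I, Complex.log_neg_I]
  ring

theorem integral_two_mul_div_of_neg {u s : ℂ} (hu : ‖u‖ = 1) (hs : (u * conj s).im < 0) :
    ∫ t in Ioi (0 : ℝ), u * (2 * s / ((t * u) ^ 2 - s ^ 2)) = Real.pi * Complex.I := by
  have := integral_two_mul_div_of_pos (s := -s) hu (by simpa using hs)
  rw [← neg_inj, ← this, ← integral_neg]
  refine integral_congr_ae (ae_of_all _ fun t => ?_)
  simp only [neg_sq, mul_neg, neg_div]

/-- The right half of `csector θ`. -/
def rsector (θ : ℝ) : Set ℂ := {z | |z.im| * Real.cos θ < z.re * Real.sin θ}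

theorem isOpen_rsector (θ : ℝ) : IsOpen (rsector θ) := by
  apply isOpen_lt <;> fun_prop

theorem re_pos_of_mem_rsector {θ : ℝ} (hθ : θ ∈ Ioo 0 (Real.pi / 2)) {z : ℂ}
    (hz : z ∈ rsector θ) : 0 < z.re := by
  have h1 : 0 ≤ |z.im| * Real.cos θ := mul_nonneg (abs_nonneg _)
    (Real.cos_nonneg_of_mem_Icc ⟨by linarith [hθ.1, Real.pi_pos], hθ.2.le⟩)
  have h2 : |z.im| * Real.cos θ < z.re * Real.sin θ := hz
  have h3 : 0 < Real.sin θ := Real.sin_pos_of_pos_of_lt_pi hθ.1 (by linarith [hθ.2, hθ.1])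
  exact pos_of_mul_pos_left (h1.trans_lt h2) h3.le

theorem rsector_subset (θ : ℝ) (hθ : θ ∈ Ioo 0 (Real.pi / 2)) : rsector θ ⊆ csector θ := by
  intro z hz
  have := re_pos_of_mem_rsector hθ hz
  simpa [csector, rsector, abs_of_pos this] using hz

theorem mem_rsector_of_re_pos {θ : ℝ} {z : ℂ} (hz : z ∈ csector θ) (h : 0 < z.re) :
    z ∈ rsector θ := by
  simpa [csector, rsector, abs_of_pos h] using hz

theorem ray_mem_rsector {θ ψ t : ℝ} (hθ : θ ∈ Ioo 0 (Real.pi / 2)) (hψ : ψ ∈ Ioo (-θ) θ)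
    (ht : 0 < t) : ray ψ t ∈ rsector θ := by
  refine mem_rsector_of_re_pos (ray_mem_csector hθ hψ ht) ?_
  rw [ray_re]
  exact mul_pos ht (Real.cos_pos_of_mem_Ioo ⟨by linarith [hψ.1, hθ.2], by linarith [hψ.2, hθ.2]⟩)

theorem rsector_mono {φ θ : ℝ} (hφ : 0 < φ) (hφθ : φ ≤ θ) (hθ : θ < Real.pi / 2) :
    rsector φ ⊆ rsector θ := by
  intro z hz
  have hre := re_pos_of_mem_rsector ⟨hφ, hφθ.trans_lt hθ⟩ hz
  have h1 : |z.im| * Real.cos φ < z.re * Real.sin φ := hz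
  have h2 : Real.cos θ ≤ Real.cos φ :=
    Real.cos_le_cos_of_nonneg_of_le_pi hφ.le (by linarith [Real.pi_pos]) hφθ
  have h3 : Real.sin φ ≤ Real.sin θ :=
    Real.sin_le_sin_of_le_of_le_pi_div_two (by linarith) hθ.le hφθ
  have h4 : |z.im| * Real.cos θ ≤ |z.im| * Real.cos φ := by gcongr
  have h5 : z.re * Real.sin φ ≤ z.re * Real.sin θ := by gcongr
  exact (h4.trans_lt h1).trans_le h5

theorem csector_mono {φ θ : ℝ} (hφ : 0 < φ) (hφθ : φ ≤ θ) (hθ : θ < Real.pi / 2) :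
    csector φ ⊆ csector θ := by
  intro z hz
  have h1 : |z.im| * Real.cos φ < |z.re| * Real.sin φ := hz
  have h2 : Real.cos θ ≤ Real.cos φ :=
    Real.cos_le_cos_of_nonneg_of_le_pi hφ.le (by linarith [Real.pi_pos]) hφθ
  have h3 : Real.sin φ ≤ Real.sin θ :=
    Real.sin_le_sin_of_le_of_le_pi_div_two (by linarith) hθ.le hφθ
  have h4 : |z.im| * Real.cos θ ≤ |z.im| * Real.cos φ := by gcongr
  have h5 : |z.re| * Real.sin φ ≤ |z.re| * Real.sin θ := by gcongr
  exact (h4.trans_lt h1).trans_le h5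

/-- On the boundary of the sector of half angle `φ`, the quotient `G(μ)/(μ - z)` is integrable. -/
theorem integrableOn_div_sub {G : ℂ → ℂ} {z : ℂ} {ψ δ : ℝ} (hδ : 0 < δ)
    (hd : ∀ t : ℝ, 0 < t → δ * t ≤ ‖ray ψ t - z‖)
    (hc : ContinuousOn (fun t => G (ray ψ t)) (Ioi 0))
    (hi : IntegrableOn (fun t => ‖G (ray ψ t)‖ / t) (Ioi 0)) :
    IntegrableOn (fun t => G (ray ψ t) / (ray ψ t - z)) (Ioi 0) := by
  have hne : ∀ t ∈ Ioi (0 : ℝ), ray ψ t - z ≠ 0 := fun t ht =>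
    norm_pos_iff.1 ((mul_pos hδ ht).trans_le (hd t ht))
  refine Integrable.mono' (hi.const_mul δ⁻¹) ?_ ?_
  · refine ContinuousOn.aestronglyMeasurable ?_ measurableSet_Ioi
    exact hc.div ((continuous_ray ψ).continuousOn.sub continuousOn_const) hne
  · refine (ae_restrict_iff' measurableSet_Ioi).2 (ae_of_all _ fun t ht => ?_)
    have ht' : 0 < t := ht
    rw [norm_div]
    calc ‖G (ray ψ t)‖ / ‖ray ψ t - z‖ ≤ ‖G (ray ψ t)‖ / (δ * t) := by
          gcongr
          exact hd t ht
      _ = _ := by field_simp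

theorem ray_boundary {φ ψ t : ℝ} (h : |Real.cos ψ| * Real.sin φ ≤ |Real.sin ψ| * Real.cos φ)
    (ht : 0 < t) : |(ray ψ t).re| * Real.sin φ ≤ |(ray ψ t).im| * Real.cos φ := by
  rw [ray_re, ray_im, abs_mul, abs_mul, abs_of_pos ht]
  nlinarith

/-- Cauchy's formula for a sector in the right half plane. -/
theorem cauchy_rsector {α φ θ M : ℝ} (hα : 0 < α) (hαφ : α < φ) (hφθ : φ < θ)
    (hθ : θ < Real.pi / 2) {G : ℂ → ℂ} (hG : DifferentiableOn ℂ G (rsector θ))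
    (hM : ∀ z ∈ rsector θ, ‖G z‖ ≤ M)
    (hi : ∀ ψ : ℝ, |ψ| = φ → IntegrableOn (fun t => ‖G (ray ψ t)‖ / t) (Ioi 0))
    {z : ℂ} (hz : z ∈ rsector α) :
    (∫ t in Ioi (0 : ℝ), Complex.exp (((-φ : ℝ) : ℂ) * Complex.I) *
        (G (ray (-φ) t) / (ray (-φ) t - z))) -
      (∫ t in Ioi (0 : ℝ), Complex.exp (φ * Complex.I) * (G (ray φ t) / (ray φ t - z))) =
      2 * Real.pi * Complex.I * G z := by
  have hφ0 : 0 < φ := hα.trans hαφ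
  have hθI : θ ∈ Ioo 0 (Real.pi / 2) := ⟨hφ0.trans hφθ, hθ⟩
  have hφI : φ ∈ Ioo 0 (Real.pi / 2) := ⟨hφ0, hφθ.trans hθ⟩
  have hzre : 0 < z.re := re_pos_of_mem_rsector ⟨hα, by linarith⟩ hz
  have hz0 : z ≠ 0 := by rintro rfl; simp at hzre
  have hzθ : z ∈ rsector θ := rsector_mono hα (by linarith) hθ hz
  obtain ⟨δ, hδ, hdist⟩ := exists_dist_cones hα hαφ hφI.2
  have hsφ : 0 < Real.sin φ := Real.sin_pos_of_pos_of_lt_pi hφ0 (by linarith [hφI.2])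
  have hcφ : 0 < Real.cos φ := Real.cos_pos_of_mem_Ioo ⟨by linarith, hφI.2⟩
  have hbd : ∀ ψ : ℝ, |ψ| = φ → ∀ t : ℝ, 0 < t → δ * t ≤ ‖ray ψ t - z‖ := by
    intro ψ hψ t ht
    have h1 := hdist z (ray ψ t) (by
      have : |z.im| * Real.cos α < z.re * Real.sin α := hz
      rw [abs_of_pos hzre]; exact this.le) (ray_boundary (by
        rcases eq_or_eq_neg_of_abs_eq hψ with rfl | rfl
        · rw [abs_of_pos hsφ, abs_of_pos hcφ]; linarith
        · rw [Real.sin_neg, Real.cos_neg, abs_neg, abs_of_pos hsφ, abs_of_pos hcφ]; linarith) ht)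
    rw [norm_sub_rev, norm_ray, abs_of_pos ht] at h1
    have := mul_nonneg hδ.le (norm_nonneg z)
    linarith
  set N : ℂ → ℂ := fun μ => G μ - G z * (2 * z / (μ + z)) with hN
  have hadd : ∀ μ ∈ rsector θ, z.re ≤ ‖μ + z‖ := fun μ hμ => by
    have := re_pos_of_mem_rsector hθI hμ
    have h2 := Complex.re_le_norm (μ + z)
    rw [Complex.add_re] at h2
    linarith
  have hadd0 : ∀ μ ∈ rsector θ, μ + z ≠ 0 := fun μ hμ =>
    norm_pos_iff.1 (hzre.trans_le (hadd μ hμ))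
  have hNd : DifferentiableOn ℂ N (rsector θ) :=
    hG.sub ((DifferentiableOn.div (by fun_prop) (by fun_prop) hadd0).const_mul _)
  have hNz : N z = 0 := by
    have : z + z ≠ 0 := hadd0 z hzθ
    simp only [hN]
    rw [show 2 * z = z + z by ring, div_self this]; ring
  set M' := M + ‖G z‖ * (2 * ‖z‖ / z.re) with hM'
  have hNM : ∀ μ ∈ rsector θ, ‖N μ‖ ≤ M' := by
    intro μ hμ
    refine (norm_sub_le _ _).trans (add_le_add (hM μ hμ) ?_)
    rw [norm_mul, norm_div, norm_mul, Complex.norm_ofNat]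
    gcongr
    exact hadd μ hμ
  have hM'0 : 0 ≤ M' := (norm_nonneg _).trans (hNM z hzθ)
  set D := dslope N z with hD
  have hDd : DifferentiableOn ℂ D (rsector θ) :=
    (Complex.differentiableOn_dslope ((isOpen_rsector θ).mem_nhds hzθ)).2 hNd
  have hDv : ∀ μ ∈ rsector θ, μ ≠ z →
      D μ = G μ / (μ - z) - G z * (2 * z / (μ ^ 2 - z ^ 2)) := by
    intro μ hμ hne
    have h1 : μ - z ≠ 0 := sub_ne_zero.2 hne
    have h2 := hadd0 μ hμ
    rw [hD, dslope_of_ne _ hne, slope_def_field, hNz, sub_zero]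
    simp only [hN]
    rw [show μ ^ 2 - z ^ 2 = (μ + z) * (μ - z) by ring]
    field_simp
  -- To bound `μ * D μ`, compactness is used in a small disc around `z`; outside it `‖μ - z‖`
  -- dominates a multiple of `‖μ‖`.
  obtain ⟨d, hd, hball⟩ := Metric.nhds_basis_closedBall.mem_iff.1 ((isOpen_rsector θ).mem_nhds hzθ)
  obtain ⟨B, hB⟩ := (isCompact_closedBall z d).exists_bound_of_continuousOn
    (hDd.continuousOn.mono hball)
  have hB0 : 0 ≤ B := (norm_nonneg _).trans (hB z (Metric.mem_closedBall_self hd.le))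
  have hmem : ∀ ψ ∈ Icc (-φ) φ, ∀ t : ℝ, 0 < t → ray ψ t ∈ rsector θ := fun ψ hψ t ht =>
    ray_mem_rsector hθI ⟨by linarith [hψ.1], by linarith [hψ.2]⟩ ht
  have hDM : ∀ μ ∈ rsector θ, ‖μ‖ * ‖D μ‖ ≤ (‖z‖ + d) * B + M' * (1 + ‖z‖ / d) := by
    intro μ hμ
    by_cases h : μ ∈ Metric.closedBall z d
    · have h1 : ‖μ‖ ≤ ‖z‖ + d := by
        rw [mem_closedBall_iff_norm] at h
        have := norm_le_norm_add_norm_sub' μ z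
        linarith
      have h2 : ‖μ‖ * ‖D μ‖ ≤ (‖z‖ + d) * B := by gcongr; exact hB μ h
      have h3 : 0 ≤ M' * (1 + ‖z‖ / d) := by positivity
      linarith
    · rw [mem_closedBall_iff_norm, not_le] at h
      have hpos : 0 < ‖μ - z‖ := hd.trans h
      have hne : μ ≠ z := by rintro rfl; simp at hpos
      rw [hD, dslope_of_ne _ hne, slope_def_field, hNz, sub_zero, norm_div]
      have h1 : ‖μ‖ ≤ ‖μ - z‖ * (1 + ‖z‖ / d) := by
        have := norm_le_norm_add_norm_sub' μ z
        have h4 : ‖z‖ ≤ ‖μ - z‖ * (‖z‖ / d) := by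
          rw [mul_div_assoc', le_div_iff₀ hd, mul_comm]; gcongr
        linarith
      have h2 : ‖μ‖ * (‖N μ‖ / ‖μ - z‖) ≤ M' * (1 + ‖z‖ / d) := by
        rw [mul_div_assoc', div_le_iff₀ hpos]
        calc ‖μ‖ * ‖N μ‖ ≤ (‖μ - z‖ * (1 + ‖z‖ / d)) * M' := by gcongr; exact hNM μ hμ
          _ = _ := by ring
      have h3 : 0 ≤ (‖z‖ + d) * B := by positivity
      linarith
  have hGc : ∀ ψ ∈ Icc (-φ) φ, ContinuousOn (fun t => G (ray ψ t)) (Ioi 0) := fun ψ hψ =>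
    hG.continuousOn.comp (continuous_ray ψ).continuousOn (hmem ψ hψ)
  have hmemabs : ∀ ψ : ℝ, |ψ| = φ → ψ ∈ Icc (-φ) φ := fun ψ h => abs_le.1 h.le
  have hint1 : ∀ ψ : ℝ, |ψ| = φ →
      IntegrableOn (fun t => G (ray ψ t) / (ray ψ t - z)) (Ioi 0) := fun ψ h =>
    integrableOn_div_sub hδ (hbd ψ h) (hGc ψ (hmemabs ψ h)) (hi ψ h)
  have hzim : |z.im| * Real.cos φ < z.re * Real.sin φ := rsector_mono hα hαφ.le hφI.2 hz
  have him : ∀ ψ : ℝ, (Complex.exp (ψ * Complex.I) * conj z).im =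
      Real.sin ψ * z.re - Real.cos ψ * z.im := by
    intro ψ; simp [Complex.exp_ofReal_mul_I_re, Complex.exp_ofReal_mul_I_im]; ring
  have him1 : 0 < (Complex.exp (φ * Complex.I) * conj z).im := by
    rw [him]
    have := le_abs_self z.im
    nlinarith
  have him2 : (Complex.exp ((-φ : ℝ) * Complex.I) * conj z).im < 0 := by
    rw [him, Real.sin_neg, Real.cos_neg]
    have := neg_abs_le z.im
    nlinarith
  have hint2 : ∀ ψ : ℝ, |ψ| = φ →
      IntegrableOn (fun t => 2 * z / (ray ψ t ^ 2 - z ^ 2)) (Ioi 0) := by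
    intro ψ h
    have hne : (Complex.exp (ψ * Complex.I) * conj z).im ≠ 0 := by
      rcases eq_or_eq_neg_of_abs_eq h with rfl | rfl
      · exact him1.ne'
      · exact him2.ne
    refine integrableOn_two_mul_div (Complex.norm_exp_ofReal_mul_I ψ) ?_
    have h2 : (z * conj (Complex.exp (ψ * Complex.I))).im =
      -(Complex.exp (ψ * Complex.I) * conj z).im := by simp; ring
    rw [h2]; exact neg_ne_zero.2 hne
  have hray_ne : ∀ ψ : ℝ, |ψ| = φ → ∀ t : ℝ, 0 < t → ray ψ t ≠ z := fun ψ h t ht he => by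
    have := hbd ψ h t ht
    rw [he, sub_self, norm_zero] at this
    have := mul_pos hδ ht
    linarith
  have hDeq : ∀ ψ : ℝ, |ψ| = φ → ∀ t ∈ Ioi (0 : ℝ), D (ray ψ t) =
      G (ray ψ t) / (ray ψ t - z) - G z * (2 * z / (ray ψ t ^ 2 - z ^ 2)) := fun ψ h t ht =>
    hDv _ (hmem ψ (hmemabs ψ h) t ht) (hray_ne ψ h t ht)
  have hDi : ∀ ψ : ℝ, |ψ| = φ → IntegrableOn (fun t => D (ray ψ t)) (Ioi 0) := fun ψ h =>
    ((hint1 ψ h).sub ((hint2 ψ h).const_mul (G z))).congr_fun (fun t ht => (hDeq ψ h t ht).symm)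
      measurableSet_Ioi
  have h1 : |φ| = φ := abs_of_pos hφ0
  have h2 : |-φ| = φ := by rw [abs_neg, h1]
  -- The regularized quotient has equal integrals over the two rays, so the entire difference comes
  -- from the comparison function, which contributes `π I` on the lower ray and `-π I` on the upper
  -- one.
  have key := integral_ray_eq (α := -φ) (β := φ) (by linarith) (isOpen_rsector θ) hDd hmem
    (M := (‖z‖ + d) * B + M' * (1 + ‖z‖ / d))
    (fun ψ hψ t ht => by
      have := hDM _ (hmem ψ hψ t ht); rwa [norm_ray, abs_of_pos ht] at this)
    (hDi _ h2) (hDi _ h1)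
  have hsplit : ∀ ψ : ℝ, |ψ| = φ → ∫ t in Ioi (0 : ℝ), Complex.exp (ψ * Complex.I) * D (ray ψ t) =
      (∫ t in Ioi (0 : ℝ), Complex.exp (ψ * Complex.I) * (G (ray ψ t) / (ray ψ t - z))) -
      G z * ∫ t in Ioi (0 : ℝ), Complex.exp (ψ * Complex.I) * (2 * z / (ray ψ t ^ 2 - z ^ 2)) := by
    intro ψ h
    rw [← integral_const_mul, ← integral_sub ((hint1 ψ h).const_mul _)
      (((hint2 ψ h).const_mul _).const_mul _)]
    refine setIntegral_congr_fun measurableSet_Ioi fun t ht => ?_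
    simp only [hDeq ψ h t ht]
    ring
  rw [hsplit _ h1, hsplit _ h2] at key
  have e1 : ∫ t in Ioi (0 : ℝ), Complex.exp (φ * Complex.I) * (2 * z / (ray φ t ^ 2 - z ^ 2)) =
      -(Real.pi * Complex.I) :=
    integral_two_mul_div_of_pos (Complex.norm_exp_ofReal_mul_I φ) him1
  have e2 : ∫ t in Ioi (0 : ℝ), Complex.exp ((-φ : ℝ) * Complex.I) *
      (2 * z / (ray (-φ) t ^ 2 - z ^ 2)) = Real.pi * Complex.I :=
    integral_two_mul_div_of_neg (Complex.norm_exp_ofReal_mul_I _) him2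
  rw [e1, e2] at key
  linear_combination key

/-- Cauchy's theorem for a sector in the right half plane and a pole in its opposite. -/
theorem cauchy_rsector_opposite {φ θ M : ℝ} (hφ0 : 0 < φ) (hφθ : φ < θ)
    (hθ : θ < Real.pi / 2) {G : ℂ → ℂ} (hG : DifferentiableOn ℂ G (rsector θ))
    (hM : ∀ z ∈ rsector θ, ‖G z‖ ≤ M)
    (hi : ∀ ψ : ℝ, |ψ| = φ → IntegrableOn (fun t => ‖G (ray ψ t)‖ / t) (Ioi 0))
    {z : ℂ} (hz : z.re < 0) :
    (∫ t in Ioi (0 : ℝ), Complex.exp (((-φ : ℝ) : ℂ) * Complex.I) *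
        (G (ray (-φ) t) / (ray (-φ) t - z))) -
      (∫ t in Ioi (0 : ℝ), Complex.exp (φ * Complex.I) * (G (ray φ t) / (ray φ t - z))) = 0 := by
  have hθI : θ ∈ Ioo 0 (Real.pi / 2) := ⟨hφ0.trans hφθ, hθ⟩
  have hcθ : 0 < Real.cos φ := Real.cos_pos_of_mem_Ioo ⟨by linarith, by linarith⟩
  have hmem : ∀ ψ ∈ Icc (-φ) φ, ∀ t : ℝ, 0 < t → ray ψ t ∈ rsector θ := fun ψ hψ t ht =>
    ray_mem_rsector hθI ⟨by linarith [hψ.1], by linarith [hψ.2]⟩ ht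
  have hM0 : 0 ≤ M := (norm_nonneg _).trans (hM _ (hmem 0 ⟨by linarith, hφ0.le⟩ 1 one_pos))
  have hd : ∀ ψ ∈ Icc (-φ) φ, ∀ t : ℝ, 0 < t → Real.cos φ * t ≤ ‖ray ψ t - z‖ := by
    intro ψ hψ t ht
    have h1 := Complex.re_le_norm (ray ψ t - z)
    rw [Complex.sub_re, ray_re] at h1
    have h2 : Real.cos φ ≤ Real.cos ψ := by
      rw [← Real.cos_abs ψ]
      exact Real.cos_le_cos_of_nonneg_of_le_pi (abs_nonneg _) (by linarith) (abs_le.2 hψ)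
    nlinarith
  have hmemabs : ∀ ψ : ℝ, |ψ| = φ → ψ ∈ Icc (-φ) φ := fun ψ h => abs_le.1 h.le
  have hGc : ∀ ψ ∈ Icc (-φ) φ, ContinuousOn (fun t => G (ray ψ t)) (Ioi 0) := fun ψ hψ =>
    hG.continuousOn.comp (continuous_ray ψ).continuousOn (hmem ψ hψ)
  have hint1 : ∀ ψ : ℝ, |ψ| = φ →
      IntegrableOn (fun t => G (ray ψ t) / (ray ψ t - z)) (Ioi 0) := fun ψ h =>
    integrableOn_div_sub hcθ (hd ψ (hmemabs ψ h)) (hGc ψ (hmemabs ψ h)) (hi ψ h)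
  have h1 : |φ| = φ := abs_of_pos hφ0
  have h2 : |-φ| = φ := by rw [abs_neg, h1]
  rw [sub_eq_zero]
  -- No pole lies in the sector: `‖ray ψ t - z‖ ≥ t cos φ` follows by comparing real parts.
  refine integral_ray_eq (F := fun μ => G μ / (μ - z)) (α := -φ) (β := φ) (by linarith)
    (isOpen_rsector θ) (hG.div (by fun_prop) fun μ hμ h => ?_) hmem (M := M / Real.cos φ)
    (fun ψ hψ t ht => ?_) (hint1 _ h2) (hint1 _ h1)
  · have h3 := re_pos_of_mem_rsector hθI hμ
    rw [sub_eq_zero.1 h] at h3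
    linarith
  · rw [norm_div, mul_div_assoc', div_le_div_iff₀
      ((mul_pos hcθ ht).trans_le (hd ψ hψ t ht)) hcθ]
    have := hd ψ hψ t ht
    have h3 := hM _ (hmem ψ hψ t ht)
    calc t * ‖G (ray ψ t)‖ * Real.cos φ = ‖G (ray ψ t)‖ * (Real.cos φ * t) := by ring
      _ ≤ M * ‖ray ψ t - z‖ := by gcongr

theorem exp_pi_add (ψ : ℝ) :
    Complex.exp (((Real.pi + ψ : ℝ) : ℂ) * Complex.I) = -Complex.exp (ψ * Complex.I) := by
  rw [Complex.ofReal_add, add_mul, Complex.exp_add, Complex.exp_pi_mul_I]; ring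

/-- Cauchy's formula for the double sector. -/
theorem cauchy_csector {α φ θ M : ℝ} (hα : 0 < α) (hαφ : α < φ) (hφθ : φ < θ)
    (hθ : θ < Real.pi / 2) {G : ℂ → ℂ} (hG : DifferentiableOn ℂ G (csector θ))
    (hM : ∀ z ∈ csector θ, ‖G z‖ ≤ M)
    (hi : ∀ ψ ∈ angles θ, IntegrableOn (fun t => ‖G (ray ψ t)‖ / t) (Ioi 0))
    {z : ℂ} (hz : z ∈ csector α) :
    (∫ t in Ioi (0 : ℝ), Complex.exp (((-φ : ℝ) : ℂ) * Complex.I) *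
        (G (ray (-φ) t) / (ray (-φ) t - z))) -
      (∫ t in Ioi (0 : ℝ), Complex.exp (φ * Complex.I) * (G (ray φ t) / (ray φ t - z))) +
      ((∫ t in Ioi (0 : ℝ), Complex.exp (((Real.pi + -φ : ℝ) : ℂ) * Complex.I) *
        (G (ray (Real.pi + -φ) t) / (ray (Real.pi + -φ) t - z))) -
      (∫ t in Ioi (0 : ℝ), Complex.exp (((Real.pi + φ : ℝ) : ℂ) * Complex.I) *
        (G (ray (Real.pi + φ) t) / (ray (Real.pi + φ) t - z)))) =
      2 * Real.pi * Complex.I * G z := by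
  have hφ0 : 0 < φ := hα.trans hαφ
  have hθI : θ ∈ Ioo 0 (Real.pi / 2) := ⟨hφ0.trans hφθ, hθ⟩
  have hsub := rsector_subset θ hθI
  have hangle : ∀ ψ : ℝ, |ψ| = φ → ψ ∈ angles θ := fun ψ h =>
    Or.inl ⟨by linarith [(abs_le.1 h.le).1], by linarith [(abs_le.1 h.le).2]⟩
  have hangle' : ∀ ψ : ℝ, |ψ| = φ → Real.pi + ψ ∈ angles θ := fun ψ h =>
    Or.inr ⟨by linarith [(abs_le.1 h.le).1], by linarith [(abs_le.1 h.le).2]⟩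
  -- The reflection `w ↦ -w` carries the left half of the double sector to the right half. Exactly
  -- one of the two halves contains the pole.
  set G' : ℂ → ℂ := fun w => G (-w) with hG'
  have hsub' : ∀ w ∈ rsector θ, -w ∈ csector θ := fun w hw => neg_mem_csector (hsub hw)
  have hG'd : DifferentiableOn ℂ G' (rsector θ) :=
    hG.comp (differentiable_neg.differentiableOn) hsub'
  have hG'i : ∀ ψ : ℝ, |ψ| = φ → IntegrableOn (fun t => ‖G' (ray ψ t)‖ / t) (Ioi 0) := by
    intro ψ h
    simpa only [hG', ← ray_add_pi] using hi _ (hangle' ψ h)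
  have hA : ∀ ψ : ℝ, ∫ t in Ioi (0 : ℝ), Complex.exp (((Real.pi + ψ : ℝ) : ℂ) * Complex.I) *
        (G (ray (Real.pi + ψ) t) / (ray (Real.pi + ψ) t - z)) =
      ∫ t in Ioi (0 : ℝ), Complex.exp (ψ * Complex.I) * (G' (ray ψ t) / (ray ψ t - -z)) := by
    intro ψ
    refine setIntegral_congr_fun measurableSet_Ioi fun t _ => ?_
    simp only [exp_pi_add, ray_add_pi, hG']
    rw [neg_mul, ← mul_neg, ← div_neg]
    congr 3
    ring
  rw [hA, hA]
  have hMr := fun w (hw : w ∈ rsector θ) => hM w (hsub hw)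
  have hMr' := fun w (hw : w ∈ rsector θ) => hM (-w) (hsub' w hw)
  have hir := fun ψ h => hi ψ (hangle ψ h)
  rcases lt_or_gt_of_ne (re_ne_zero_of_mem_csector ⟨hα, by linarith⟩ hz) with h | h
  · have hz' : -z ∈ rsector α := mem_rsector_of_re_pos (neg_mem_csector hz) (by simpa using h)
    rw [cauchy_rsector_opposite hφ0 hφθ hθ (hG.mono hsub) hMr hir h,
      cauchy_rsector hα hαφ hφθ hθ hG'd hMr' hG'i hz']
    simp [hG']
  · rw [cauchy_rsector hα hαφ hφθ hθ (hG.mono hsub) hMr hir (mem_rsector_of_re_pos hz h),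
      cauchy_rsector_opposite hφ0 hφθ hθ hG'd hMr' hG'i (by simpa using h)]
    simp

/-! ## Intrinsic functions of a complex variable -/

/-- Bounded holomorphic functions on the double sector that are real on the real axis. -/
structure HBdd (θ : ℝ) (F : ℂ → ℂ) : Prop where
  diff : DifferentiableOn ℂ F (csector θ)
  map_conj : ∀ z ∈ csector θ, F (conj z) = conj (F z)
  bdd : ∃ C : ℝ, ∀ z ∈ csector θ, ‖F z‖ ≤ C

/-- Functions of `HBdd θ` that are integrable on rays with respect to `dt/t`. -/
structure HZero (θ : ℝ) (F : ℂ → ℂ) : Prop extends HBdd θ F where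
  integrable : ∀ ψ ∈ angles θ, IntegrableOn (fun t : ℝ => ‖F (ray ψ t)‖ / t) (Ioi 0)

theorem HBdd.add {θ : ℝ} {F G : ℂ → ℂ} (hF : HBdd θ F) (hG : HBdd θ G) :
    HBdd θ (fun z => F z + G z) := by
  obtain ⟨C, hC⟩ := hF.bdd
  obtain ⟨D, hD⟩ := hG.bdd
  exact ⟨hF.diff.add hG.diff, fun z hz => by rw [hF.map_conj z hz, hG.map_conj z hz, map_add],
    C + D, fun z hz => (norm_add_le _ _).trans (add_le_add (hC z hz) (hD z hz))⟩

theorem HBdd.mul {θ : ℝ} {F G : ℂ → ℂ} (hF : HBdd θ F) (hG : HBdd θ G) :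
    HBdd θ (fun z => F z * G z) := by
  obtain ⟨C, hC⟩ := hF.bdd
  obtain ⟨D, hD⟩ := hG.bdd
  refine ⟨hF.diff.mul hG.diff, fun z hz => by rw [hF.map_conj z hz, hG.map_conj z hz, map_mul],
    C * D, fun z hz => ?_⟩
  rw [norm_mul]
  exact mul_le_mul (hC z hz) (hD z hz) (norm_nonneg _) ((norm_nonneg _).trans (hC z hz))

theorem hBdd_const (θ a : ℝ) : HBdd θ (fun _ => (a : ℂ)) :=
  ⟨differentiableOn_const _, fun _ _ => (Complex.conj_ofReal a).symm, ‖(a : ℂ)‖, fun _ _ => le_rfl⟩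

theorem HBdd.continuousOn_ray {θ ψ : ℝ} {F : ℂ → ℂ} (hθ : θ ∈ Ioo 0 (Real.pi / 2))
    (hF : HBdd θ F) (hψ : ψ ∈ angles θ) : ContinuousOn (fun t => F (ray ψ t)) (Ioi 0) :=
  hF.diff.continuousOn.comp (continuous_ray ψ).continuousOn
    fun _ ht => ray_mem_csector_of_mem_angles hθ hψ ht

theorem HZero.add {θ : ℝ} {F G : ℂ → ℂ} (hθ : θ ∈ Ioo 0 (Real.pi / 2)) (hF : HZero θ F)
    (hG : HZero θ G) : HZero θ (fun z => F z + G z) := by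
  refine ⟨hF.toHBdd.add hG.toHBdd, fun ψ hψ => ?_⟩
  refine Integrable.mono' ((hF.integrable ψ hψ).add (hG.integrable ψ hψ)) ?_ ?_
  · exact ContinuousOn.aestronglyMeasurable
      (((hF.toHBdd.add hG.toHBdd).continuousOn_ray hθ hψ).norm.div continuousOn_id
        fun t ht => (ne_of_gt ht)) measurableSet_Ioi
  · refine (ae_restrict_iff' measurableSet_Ioi).2 (ae_of_all _ fun t ht => ?_)
    have ht' : 0 < t := ht
    rw [norm_div, norm_norm, Real.norm_of_nonneg ht'.le, Pi.add_apply, ← add_div]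
    gcongr
    exact norm_add_le _ _

theorem HBdd.mul_hZero {θ : ℝ} {F G : ℂ → ℂ} (hθ : θ ∈ Ioo 0 (Real.pi / 2)) (hF : HBdd θ F)
    (hG : HZero θ G) : HZero θ (fun z => F z * G z) := by
  refine ⟨hF.mul hG.toHBdd, fun ψ hψ => ?_⟩
  obtain ⟨C, hC⟩ := hF.bdd
  refine Integrable.mono' ((hG.integrable ψ hψ).const_mul C) ?_ ?_
  · exact ContinuousOn.aestronglyMeasurable
      (((hF.mul hG.toHBdd).continuousOn_ray hθ hψ).norm.div continuousOn_id
        fun t ht => (ne_of_gt ht)) measurableSet_Ioi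
  · refine (ae_restrict_iff' measurableSet_Ioi).2 (ae_of_all _ fun t ht => ?_)
    have ht' : 0 < t := ht
    rw [norm_div, norm_norm, Real.norm_of_nonneg ht'.le, norm_mul, mul_div_assoc]
    gcongr
    exact hC _ (ray_mem_csector_of_mem_angles hθ hψ ht)

theorem HZero.const_mul {θ : ℝ} {F : ℂ → ℂ} (hθ : θ ∈ Ioo 0 (Real.pi / 2)) (hF : HZero θ F)
    (a : ℝ) : HZero θ (fun z => a * F z) :=
  (hBdd_const θ a).mul_hZero hθ hF

/-! ### Quadratic factors and the functions `ρ` and `κ` -/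

/-- The quadratic polynomial with the zeros `μ` and `conj μ`. -/
def quad (μ z : ℂ) : ℂ := z ^ 2 - 2 * μ.re * z + (‖μ‖ : ℂ) ^ 2

theorem quad_eq (μ z : ℂ) : quad μ z = (z - μ) * (z - conj μ) := by
  have h1 : μ * conj μ = (‖μ‖ : ℂ) ^ 2 := Complex.mul_conj' μ
  have h2 : μ + conj μ = 2 * μ.re := by rw [Complex.add_conj]; push_cast; ring
  unfold quad
  linear_combination z * h2 - h1

theorem quad_conj (μ z : ℂ) : quad μ (conj z) = conj (quad μ z) := by
  simp [quad, Complex.conj_ofNat]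

/-- The cone that contains `μ` is symmetric under conjugation, so `exists_dist_cones` bounds both
linear factors of the quadratic. -/
theorem exists_quad_ge {α β : ℝ} (hα : 0 < α) (hαβ : α < β) (hβ : β < Real.pi / 2) :
    ∃ δ : ℝ, 0 < δ ∧ ∀ z ∈ csector α, ∀ μ : ℂ, |μ.re| * Real.sin β ≤ |μ.im| * Real.cos β →
      δ * (‖z‖ + ‖μ‖) ^ 2 ≤ ‖quad μ z‖ := by
  obtain ⟨δ, hδ, h⟩ := exists_dist_cones hα hαβ hβ
  refine ⟨δ ^ 2, by positivity, fun z hz μ hμ => ?_⟩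
  have h1 := h z μ (le_of_lt hz) hμ
  have h2 := h z (conj μ) (le_of_lt hz) (by simpa using hμ)
  rw [quad_eq, norm_mul]
  rw [RCLike.norm_conj] at h2
  calc δ ^ 2 * (‖z‖ + ‖μ‖) ^ 2 = (δ * (‖z‖ + ‖μ‖)) * (δ * (‖z‖ + ‖μ‖)) := by ring
    _ ≤ _ := by gcongr

theorem quad_I (z : ℂ) : quad Complex.I z = 1 + z ^ 2 := by simp [quad]; ring

theorem exists_one_add_sq_ge {θ : ℝ} (hθ : θ ∈ Ioo 0 (Real.pi / 2)) :
    ∃ δ : ℝ, 0 < δ ∧ ∀ z ∈ csector θ, δ * (‖z‖ + 1) ^ 2 ≤ ‖1 + z ^ 2‖ := by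
  obtain ⟨β, hβ1, hβ2⟩ := exists_between hθ.2
  obtain ⟨δ, hδ, h⟩ := exists_quad_ge hθ.1 hβ1 hβ2
  refine ⟨δ, hδ, fun z hz => ?_⟩
  have := h z hz Complex.I (by
    simpa using Real.cos_nonneg_of_mem_Icc ⟨by linarith [hθ.1, Real.pi_pos], hβ2.le⟩)
  simpa [quad_I] using this

theorem one_add_sq_ne_zero {θ : ℝ} (hθ : θ ∈ Ioo 0 (Real.pi / 2)) {z : ℂ} (hz : z ∈ csector θ) :
    1 + z ^ 2 ≠ 0 := by
  obtain ⟨δ, hδ, h⟩ := exists_one_add_sq_ge hθ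
  refine norm_pos_iff.1 (lt_of_lt_of_le ?_ (h z hz))
  positivity

/-- The function `(1 + z²)⁻¹`. -/
def rho (z : ℂ) : ℂ := (1 + z ^ 2)⁻¹

/-- The function `z (1 + z²)⁻¹`. -/
def kappa (z : ℂ) : ℂ := z * (1 + z ^ 2)⁻¹

theorem hBdd_rho {θ : ℝ} (hθ : θ ∈ Ioo 0 (Real.pi / 2)) : HBdd θ rho := by
  obtain ⟨δ, hδ, h⟩ := exists_one_add_sq_ge hθ
  refine ⟨DifferentiableOn.inv (by fun_prop) fun z hz => one_add_sq_ne_zero hθ hz,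
    fun z _ => by simp [rho], δ⁻¹, fun z hz => ?_⟩
  rw [rho, norm_inv]
  refine inv_anti₀ hδ ((le_mul_of_one_le_right hδ.le ?_).trans (h z hz))
  nlinarith [norm_nonneg z]

theorem hZero_kappa {θ : ℝ} (hθ : θ ∈ Ioo 0 (Real.pi / 2)) : HZero θ kappa := by
  obtain ⟨δ, hδ, h⟩ := exists_one_add_sq_ge hθ
  have hle : ∀ z ∈ csector θ, ‖kappa z‖ ≤ ‖z‖ * (δ * (‖z‖ + 1) ^ 2)⁻¹ := fun z hz => by
    rw [kappa, norm_mul, norm_inv]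
    gcongr
    exact h z hz
  have hb : HBdd θ kappa := by
    refine ⟨differentiableOn_id.mul
      (DifferentiableOn.inv (by fun_prop) fun z hz => one_add_sq_ne_zero hθ hz),
      fun z _ => by simp [kappa], δ⁻¹, fun z hz => (hle z hz).trans ?_⟩
    rw [mul_inv, mul_left_comm]
    refine mul_le_of_le_one_right (by positivity) ?_
    rw [← div_eq_mul_inv, div_le_one (by positivity)]
    nlinarith [norm_nonneg z]
  refine ⟨hb, fun ψ hψ => ?_⟩
  refine Integrable.mono' ((integrable_inv_one_add_sq.const_mul δ⁻¹).integrableOn) ?_ ?_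
  · exact ContinuousOn.aestronglyMeasurable ((hb.continuousOn_ray hθ hψ).norm.div continuousOn_id
        fun t ht => (ne_of_gt ht)) measurableSet_Ioi
  · refine (ae_restrict_iff' measurableSet_Ioi).2 (ae_of_all _ fun t ht => ?_)
    have ht' : 0 < t := ht
    have := hle _ (ray_mem_csector_of_mem_angles hθ hψ ht)
    rw [norm_ray, abs_of_pos ht'] at this
    rw [norm_div, norm_norm, Real.norm_of_nonneg ht'.le, div_le_iff₀ ht']
    refine this.trans ?_
    rw [mul_comm, mul_inv]
    gcongr
    nlinarith

/-- A positive limit makes the integrand at least a multiple of `1 / t` near infinity. This fact and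
its analogue at `0` determine the constants in the representation of functions with limits. -/
theorem not_integrableOn_of_tendsto {g : ℝ → ℝ} {l : ℝ} (hl : 0 < l)
    (hg : Tendsto g atTop (𝓝 l)) : ¬ IntegrableOn (fun t => g t / t) (Ioi 0) := by
  intro h
  obtain ⟨a, ha⟩ := eventually_atTop.1 (hg.eventually (lt_mem_nhds (half_lt_self hl)))
  set b := max a 1 with hb
  refine not_integrableOn_Ioi_inv (a := b) ?_
  have h1 := (h.mono_set (Ioi_subset_Ioi (zero_le_one.trans (le_max_right a 1)))).const_mul (l / 2)⁻¹
  refine Integrable.mono' h1 (by fun_prop) ?_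
  refine (ae_restrict_iff' measurableSet_Ioi).2 (ae_of_all _ fun t ht => ?_)
  have ht1 : b < t := ht
  have ht0 : 0 < t := lt_of_lt_of_le zero_lt_one ((le_max_right a 1).trans ht1.le)
  have h2 := ha t ((le_max_left a 1).trans ht1.le)
  rw [Real.norm_of_nonneg (by positivity), mul_div_assoc', ← one_div]
  gcongr
  rw [inv_mul_eq_div, le_div_iff₀ (by positivity)]
  linarith

theorem not_integrableOn_of_tendsto_zero {g : ℝ → ℝ} {l : ℝ} (hl : 0 < l)
    (hg : Tendsto g (𝓝[>] 0) (𝓝 l)) : ¬ IntegrableOn (fun t => g t / t) (Ioi 0) := by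
  intro h
  obtain ⟨u, hu, hs⟩ := (mem_nhdsGT_iff_exists_Ioo_subset (a := (0 : ℝ))).1
    (hg.eventually (lt_mem_nhds (half_lt_self hl)))
  have hu : 0 < u := hu
  have h1 : IntegrableOn (fun t : ℝ => t⁻¹) (Ioo 0 u) := by
    refine Integrable.mono' ((h.mono_set Ioo_subset_Ioi_self).const_mul (l / 2)⁻¹) (by fun_prop) ?_
    refine (ae_restrict_iff' measurableSet_Ioo).2 (ae_of_all _ fun t ht => ?_)
    have h2 : l / 2 < g t := hs ht
    have ht0 := ht.1
    rw [Real.norm_of_nonneg (by positivity), mul_div_assoc', ← one_div]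
    gcongr
    rw [inv_mul_eq_div, le_div_iff₀ (by positivity)]
    linarith
  have h3 : IntervalIntegrable (fun t : ℝ => t⁻¹) volume 0 u := by
    rw [intervalIntegrable_iff_integrableOn_Ioo_of_le hu.le]; exact h1
  simp [intervalIntegrable_inv_iff, hu.ne, hu.le] at h3

/-- The constants in the representation of functions with limits are unique. -/
theorem HZero.const_unique {θ : ℝ} (hθ : θ ∈ Ioo 0 (Real.pi / 2)) {F : ℂ → ℂ} (hF : HZero θ F)
    {a b : ℝ} (h : ∀ z ∈ csector θ, a + b * rho z + F z = 0) : a = 0 ∧ b = 0 := by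
  have h0 : (0 : ℝ) ∈ angles θ := Or.inl ⟨by linarith [hθ.1], hθ.1⟩
  have hi := hF.integrable 0 h0
  have hv : ∀ t : ℝ, 0 < t → ‖F (ray 0 t)‖ = |a + b * (1 + t ^ 2)⁻¹| := by
    intro t ht
    have h1 := h _ (ray_mem_csector_of_mem_angles hθ h0 ht)
    have h2 : ray 0 t = (t : ℂ) := by simp [ray]
    rw [eq_neg_of_add_eq_zero_right h1, norm_neg, rho, h2, ← Real.norm_eq_abs, ← Complex.norm_real]
    congr 1
    push_cast
    rfl
  have hi' : IntegrableOn (fun t : ℝ => |a + b * (1 + t ^ 2)⁻¹| / t) (Ioi 0) :=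
    hi.congr_fun (fun t ht => by simp only [hv t ht]) measurableSet_Ioi
  have ha : a = 0 := by
    by_contra hne
    refine not_integrableOn_of_tendsto (abs_pos.2 hne) ?_ hi'
    have h1 : Tendsto (fun t : ℝ => (1 + t ^ 2)⁻¹) atTop (𝓝 0) :=
      (tendsto_atTop_add_const_left _ _ (tendsto_pow_atTop two_ne_zero)).inv_tendsto_atTop
    simpa using (tendsto_const_nhds (x := a).add (h1.const_mul b)).abs
  refine ⟨ha, ?_⟩
  by_contra hne
  refine not_integrableOn_of_tendsto_zero (abs_pos.2 hne) ?_ hi'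
  have h1 : Continuous fun t : ℝ => |a + b * (1 + t ^ 2)⁻¹| := by
    refine (continuous_const.add (continuous_const.mul (Continuous.inv₀ (by fun_prop) ?_))).abs
    intro t; positivity
  have h2 := (h1.tendsto 0).mono_left (nhdsWithin_le_nhds (s := Ioi 0))
  simpa [ha] using h2

/-! ### Vanishing imaginary parts and the scalar kernel -/

/-- The integral of `H m` along the boundary of the double sector has no imaginary part, because
the boundary rays can be rotated to the real axis. -/
theorem im_integral_ray_eq_zero {φ α θ M : ℝ} (hφ : 0 < φ) (hφα : φ < α) (hαθ : α ≤ θ)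
    (hθ : θ < Real.pi / 2) {H m : ℂ → ℂ} (hH : HZero θ H) (hm : DifferentiableOn ℂ m (csector α))
    (hmc : ∀ z ∈ csector α, m (conj z) = conj (m z)) (hM : ∀ z ∈ csector α, ‖z‖ * ‖m z‖ ≤ M)
    {ψ : ℝ} (hψ : ψ = φ ∨ ψ = Real.pi - φ) :
    IntegrableOn (fun t => H (ray ψ t) * m (ray ψ t)) (Ioi 0) ∧
      (∫ t in Ioi (0 : ℝ), Complex.exp (ψ * Complex.I) * (H (ray ψ t) * m (ray ψ t))).im = 0 := by
  have hαI : α ∈ Ioo 0 (Real.pi / 2) := ⟨hφ.trans hφα, by linarith⟩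
  have hsub : csector α ⊆ csector θ := csector_mono hαI.1 hαθ hθ
  have hFd : DifferentiableOn ℂ (fun z => H z * m z) (csector α) := (hH.diff.mono hsub).mul hm
  obtain ⟨C, hC⟩ := hH.bdd
  have hang : ∀ χ ∈ angles α, χ ∈ angles θ := by
    rintro χ (h | h)
    · exact Or.inl ⟨by linarith [h.1], by linarith [h.2]⟩
    · exact Or.inr ⟨by linarith [h.1], by linarith [h.2]⟩
  have hint : ∀ χ ∈ angles α, IntegrableOn (fun t => H (ray χ t) * m (ray χ t)) (Ioi 0) := by
    intro χ hχ
    refine Integrable.mono' ((hH.integrable χ (hang χ hχ)).const_mul M) ?_ ?_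
    · refine ContinuousOn.aestronglyMeasurable ?_ measurableSet_Ioi
      exact hFd.continuousOn.comp (continuous_ray χ).continuousOn
        fun t ht => ray_mem_csector_of_mem_angles hαI hχ ht
    · refine (ae_restrict_iff' measurableSet_Ioi).2 (ae_of_all _ fun t ht => ?_)
      have ht' : 0 < t := ht
      have h1 := hM _ (ray_mem_csector_of_mem_angles hαI hχ ht)
      rw [norm_ray, abs_of_pos ht'] at h1
      rw [norm_mul, mul_div_assoc', le_div_iff₀ ht']
      calc _ = ‖H (ray χ t)‖ * (t * ‖m (ray χ t)‖) := by ring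
        _ ≤ ‖H (ray χ t)‖ * M := by gcongr
        _ = _ := by ring
  have hbd : ∀ χ ∈ angles α, ∀ t : ℝ, 0 < t → t * ‖H (ray χ t) * m (ray χ t)‖ ≤ C * M := by
    intro χ hχ t ht
    have hmem := ray_mem_csector_of_mem_angles hαI hχ ht
    have h1 := hM _ hmem
    rw [norm_ray, abs_of_pos ht] at h1
    have h2 := hC _ (hsub hmem)
    rw [norm_mul, mul_left_comm]
    exact mul_le_mul h2 h1 (by positivity) ((norm_nonneg _).trans h2)
  have hreal : ∀ x : ℝ, (x : ℂ) ∈ csector α → (H x * m x).im = 0 := by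
    intro x hx
    rw [← Complex.conj_eq_iff_im, map_mul, ← hmc _ hx, ← hH.map_conj _ (hsub hx),
      Complex.conj_ofReal]
  have him : ∀ F : ℝ → ℂ, IntegrableOn F (Ioi 0) → (∀ t ∈ Ioi (0 : ℝ), (F t).im = 0) →
      (∫ t in Ioi (0 : ℝ), F t).im = 0 := by
    intro F hF h
    have := integral_im (𝕜 := ℂ) hF
    change (∫ t in Ioi (0 : ℝ), (F t).im) = (∫ t in Ioi (0 : ℝ), F t).im at this
    rw [← this, setIntegral_congr_fun measurableSet_Ioi h, integral_zero]
  -- The ray of angle `φ` is rotated to the positive axis, the ray of angle `π - φ` to the negative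
  -- one; on both, conjugation symmetry makes the integrand real.
  rcases hψ with rfl | rfl
  · have h1 : ∀ χ ∈ Icc 0 ψ, χ ∈ angles α := fun χ h =>
      Or.inl ⟨by linarith [h.1], by linarith [h.2]⟩
    have hψm := h1 ψ ⟨hφ.le, le_rfl⟩
    have h0m := h1 0 ⟨le_rfl, hφ.le⟩
    refine ⟨hint _ hψm, ?_⟩
    rw [← integral_ray_eq hφ.le (isOpen_csector α) hFd
      (fun χ hχ t ht => ray_mem_csector_of_mem_angles hαI (h1 χ hχ) ht)
      (fun χ hχ => hbd χ (h1 χ hχ)) (hint _ h0m) (hint _ hψm)]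
    refine him _ ((hint _ h0m).const_mul _) fun t ht => ?_
    have h2 : ray 0 t = (t : ℂ) := by simp [ray]
    have h3 := ray_mem_csector_of_mem_angles hαI h0m ht
    rw [h2] at h3 ⊢
    simpa using hreal t h3
  · have h1 : ∀ χ ∈ Icc (Real.pi - φ) Real.pi, χ ∈ angles α := fun χ h =>
      Or.inr ⟨by linarith [h.1], by linarith [h.2]⟩
    have hψm := h1 (Real.pi - φ) ⟨le_rfl, by linarith⟩
    have h0m := h1 Real.pi ⟨by linarith, le_rfl⟩
    refine ⟨hint _ hψm, ?_⟩
    rw [integral_ray_eq (by linarith) (isOpen_csector α) hFd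
      (fun χ hχ t ht => ray_mem_csector_of_mem_angles hαI (h1 χ hχ) ht)
      (fun χ hχ => hbd χ (h1 χ hχ)) (hint _ hψm) (hint _ h0m)]
    refine him _ ((hint _ h0m).const_mul _) fun t ht => ?_
    have h2 : ray Real.pi t = ((-t : ℝ) : ℂ) := by simp [ray, Complex.exp_pi_mul_I]
    have h3 := ray_mem_csector_of_mem_angles hαI h0m ht
    rw [h2] at h3 ⊢
    rw [Complex.exp_pi_mul_I, neg_one_mul, Complex.neg_im, hreal _ h3, neg_zero]

/-- The scalar kernel of the functional calculus. -/
def scalarKernel (c μ z : ℂ) : ℂ := ((c * conj μ).im - c.im * z) / quad μ z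

/-- For `c dt` in the role of `G(μ) dμ`, the kernel is half the difference of a Cauchy kernel and
its mirror image, divided by `I`. Integrals of it over upper rays therefore encode the full contour
of a conjugation symmetric function. -/
theorem scalarKernel_eq {c μ z : ℂ} (h1 : μ - z ≠ 0) (h2 : conj μ - z ≠ 0) :
    scalarKernel c μ z =
      (2 * Complex.I)⁻¹ * (c * (μ - z)⁻¹ - conj c * (conj μ - z)⁻¹) := by
  have e1 : (2 * Complex.I : ℂ) ≠ 0 := by simp
  have e2 : (((c * conj μ).im : ℝ) : ℂ) = (2 * Complex.I)⁻¹ * (c * conj μ - conj c * μ) := by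
    have h := Complex.sub_conj (c * conj μ)
    rw [map_mul, Complex.conj_conj] at h
    rw [h]
    push_cast
    field_simp
  have e3 : ((c.im : ℝ) : ℂ) = (2 * Complex.I)⁻¹ * (c - conj c) := by
    rw [Complex.sub_conj]; push_cast; field_simp
  have e4 : quad μ z = (μ - z) * (conj μ - z) := by rw [quad_eq]; ring
  rw [scalarKernel, e2, e3, e4]
  field_simp
  ring

theorem ray_boundary_of {φ ψ t : ℝ} (hφ : φ ∈ Ioo 0 (Real.pi / 2))
    (hψ : |ψ| = φ ∨ |Real.pi - ψ| = φ) (ht : 0 < t) :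
    |(ray ψ t).re| * Real.sin φ ≤ |(ray ψ t).im| * Real.cos φ := by
  have hs : 0 < Real.sin φ := Real.sin_pos_of_pos_of_lt_pi hφ.1 (by linarith [hφ.2, hφ.1])
  have hc : 0 < Real.cos φ := Real.cos_pos_of_mem_Ioo ⟨by linarith [hφ.1, Real.pi_pos], hφ.2⟩
  refine ray_boundary ?_ ht
  have hgen : ∀ χ : ℝ, |χ| = φ → |Real.cos χ| = Real.cos φ ∧ |Real.sin χ| = Real.sin φ := by
    intro χ hχ
    rcases eq_or_eq_neg_of_abs_eq hχ with rfl | rfl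
    · exact ⟨abs_of_pos hc, abs_of_pos hs⟩
    · rw [Real.sin_neg, Real.cos_neg, abs_neg]
      exact ⟨abs_of_pos hc, abs_of_pos hs⟩
  rcases hψ with h | h
  · rw [(hgen _ h).1, (hgen _ h).2, mul_comm]
  · have := hgen _ h
    rw [Real.sin_pi_sub, Real.cos_pi_sub, abs_neg] at this
    rw [this.1, this.2, mul_comm]

/-- Cauchy's formula, written as an integral over the rays in the upper half plane. -/
theorem cauchy_scalarKernel {α φ θ : ℝ} (hα : 0 < α) (hαφ : α < φ) (hφθ : φ < θ)
    (hθ : θ < Real.pi / 2) {G : ℂ → ℂ} (hG : HZero θ G) {z : ℂ} (hz : z ∈ csector α) :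
    (∫ t in Ioi (0 : ℝ), scalarKernel (Complex.exp (((Real.pi - φ : ℝ) : ℂ) * Complex.I) *
        G (ray (Real.pi - φ) t)) (ray (Real.pi - φ) t) z) -
      (∫ t in Ioi (0 : ℝ), scalarKernel (Complex.exp (φ * Complex.I) *
        G (ray φ t)) (ray φ t) z) = Real.pi * G z := by
  have hφ0 : 0 < φ := hα.trans hαφ
  have hθI : θ ∈ Ioo 0 (Real.pi / 2) := ⟨hφ0.trans hφθ, hθ⟩
  have hφI : φ ∈ Ioo 0 (Real.pi / 2) := ⟨hφ0, hφθ.trans hθ⟩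
  obtain ⟨M, hM⟩ := hG.bdd
  obtain ⟨δ, hδ, hdist⟩ := exists_dist_cones hα hαφ hφI.2
  have hd : ∀ ψ : ℝ, |ψ| = φ ∨ |Real.pi - ψ| = φ → ∀ t : ℝ, 0 < t →
      δ * t ≤ ‖ray ψ t - z‖ := by
    intro ψ hψ t ht
    have h1 := hdist z (ray ψ t) (le_of_lt hz) (ray_boundary_of hφI hψ ht)
    rw [norm_sub_rev, norm_ray, abs_of_pos ht] at h1
    have := mul_nonneg hδ.le (norm_nonneg z)
    linarith
  have hne : ∀ ψ : ℝ, |ψ| = φ ∨ |Real.pi - ψ| = φ → ∀ t : ℝ, 0 < t → ray ψ t - z ≠ 0 :=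
    fun ψ hψ t ht => norm_pos_iff.1 ((mul_pos hδ ht).trans_le (hd ψ hψ t ht))
  have hang : ∀ ψ : ℝ, |ψ| = φ ∨ |Real.pi - ψ| = φ → ψ ∈ angles θ := by
    rintro ψ (h | h)
    · exact Or.inl ⟨by linarith [(abs_le.1 h.le).1], by linarith [(abs_le.1 h.le).2]⟩
    · exact Or.inr ⟨by linarith [(abs_le.1 h.le).2], by linarith [(abs_le.1 h.le).1]⟩
  have hint : ∀ ψ : ℝ, |ψ| = φ ∨ |Real.pi - ψ| = φ →
      IntegrableOn (fun t => G (ray ψ t) / (ray ψ t - z)) (Ioi 0) := fun ψ hψ =>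
    integrableOn_div_sub hδ (hd ψ hψ) (hG.continuousOn_ray hθI (hang ψ hψ))
      (hG.integrable ψ (hang ψ hψ))
  -- Here `ψ'` is the angle of the conjugate ray; the symmetry of `G` identifies the conjugated term
  -- with the Cauchy integrand on that ray.
  have hker : ∀ ψ ψ' : ℝ, (|ψ| = φ ∨ |Real.pi - ψ| = φ) → (|ψ'| = φ ∨ |Real.pi - ψ'| = φ) →
      (∀ t, ray ψ' t = conj (ray ψ t)) →
      (Complex.exp (ψ' * Complex.I) = conj (Complex.exp (ψ * Complex.I))) →
      ∫ t in Ioi (0 : ℝ), scalarKernel (Complex.exp (ψ * Complex.I) * G (ray ψ t)) (ray ψ t) z =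
      (2 * Complex.I)⁻¹ *
        ((∫ t in Ioi (0 : ℝ), Complex.exp (ψ * Complex.I) * (G (ray ψ t) / (ray ψ t - z))) -
        ∫ t in Ioi (0 : ℝ), Complex.exp (ψ' * Complex.I) * (G (ray ψ' t) / (ray ψ' t - z))) := by
    intro ψ ψ' h h' hray hexp
    rw [← integral_sub ((hint ψ h).const_mul _) ((hint ψ' h').const_mul _), ← integral_const_mul]
    refine setIntegral_congr_fun measurableSet_Ioi fun t ht => ?_
    have h1 := hne ψ h t ht
    have h2 := hne ψ' h' t ht
    rw [hray] at h2
    simp only [scalarKernel_eq h1 h2, hray, hexp, map_mul,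
      hG.map_conj _ (ray_mem_csector_of_mem_angles hθI (hang ψ h) ht), div_eq_mul_inv]
    ring
  have a1 : |φ| = φ ∨ |Real.pi - φ| = φ := Or.inl (abs_of_pos hφ0)
  have a2 : |-φ| = φ ∨ |Real.pi - -φ| = φ := Or.inl (by rw [abs_neg, abs_of_pos hφ0])
  have a3 : |Real.pi - φ| = φ ∨ |Real.pi - (Real.pi - φ)| = φ :=
    Or.inr (by rw [sub_sub_cancel, abs_of_pos hφ0])
  have a4 : |Real.pi + φ| = φ ∨ |Real.pi - (Real.pi + φ)| = φ :=
    Or.inr (by rw [sub_add_cancel_left, abs_neg, abs_of_pos hφ0])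
  have hexpn : ∀ ψ : ℝ, Complex.exp (((-ψ : ℝ) : ℂ) * Complex.I) =
      conj (Complex.exp (ψ * Complex.I)) := fun ψ => by
    rw [← Complex.exp_conj]; simp
  rw [hker _ _ a1 a2 (ray_neg φ) (hexpn φ), hker _ _ a3 a4 (fun t => by
      rw [sub_eq_add_neg, ray_add_pi, ray_add_pi, ray_neg]; simp) (by
      rw [sub_eq_add_neg, exp_pi_add, exp_pi_add, hexpn]; simp)]
  have key := cauchy_csector hα hαφ hφθ hθ hG.diff hM hG.integrable hz
  rw [← sub_eq_add_neg] at key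
  rw [← mul_sub, inv_mul_eq_iff_eq_mul₀ (by simp)]
  linear_combination key

/-! ## Pairs of operator functions of resolvent type in a real Banach algebra -/

section ResolventPair

variable {A : Type*} [NormedRing A] [NormedAlgebra ℝ A]

/-- The relations between `q z = (T² - 2 Re z T + |z|²)⁻¹` and `p z = T q z`, with the bounds that
hold for bisectorial `T`. -/
structure ResolventPair (ω : ℝ) (q p : ℂ → A) : Prop where
  q_conj : ∀ z, q (conj z) = q z
  p_conj : ∀ z, p (conj z) = p z
  q_mul_q : ∀ z ∈ cocone ω, ∀ w ∈ cocone ω, q z * q w = q w * q z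
  q_mul_p : ∀ z ∈ cocone ω, ∀ w ∈ cocone ω, q z * p w = p w * q z
  q_mul_p' : ∀ z ∈ cocone ω, ∀ w ∈ cocone ω, q z * p w = p z * q w
  p_mul_p_comm : ∀ z ∈ cocone ω, ∀ w ∈ cocone ω, p z * p w = p w * p z
  p_mul_p : ∀ z ∈ cocone ω, ∀ w ∈ cocone ω,
    p z * p w = q w + (2 * z.re) • (p z * q w) - (‖z‖ ^ 2) • (q z * q w)
  p_eq : ∀ z ∈ cocone ω, ∀ w ∈ cocone ω,
    p w + (2 * z.re) • (p z * p w) - (‖z‖ ^ 2) • (p z * q w) =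
      p z + (2 * w.re) • (p z * p w) - (‖w‖ ^ 2) • (p z * q w)
  bound : ∃ C : ℝ, ∀ z ∈ cocone ω, ‖z‖ ^ 2 * ‖q z‖ ≤ C ∧ ‖z‖ * ‖p z‖ ≤ C

/-- The imaginary part of `c` times the resolvent `conj z * q z - p z`. -/
def opKernel (q p : ℂ → A) (c z : ℂ) : A := (c * conj z).im • q z - c.im • p z

/-- `opKernel` as a real linear map in its first argument. -/
def opKernelL (q p : ℂ → A) (z : ℂ) : ℂ →L[ℝ] A :=
  (Complex.imCLM ∘L ((ContinuousLinearMap.mul ℝ ℂ).flip (conj z))).smulRight (q z) -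
    Complex.imCLM.smulRight (p z)

theorem opKernelL_apply (q p : ℂ → A) (c z : ℂ) : opKernelL q p z c = opKernel q p c z := by
  simp only [opKernelL, opKernel, sub_apply,
    ContinuousLinearMap.smulRight_apply, ContinuousLinearMap.comp_apply,
    ContinuousLinearMap.flip_apply, ContinuousLinearMap.mul_apply', Complex.imCLM_apply]

namespace ResolventPair

variable {ω : ℝ} {q p : ℂ → A} (h : ResolventPair ω q p)

include h

/-- Obtained by equating the two expansions of `p z * p w = p w * p z`. -/
theorem q_sub {z w : ℂ} (hz : z ∈ cocone ω) (hw : w ∈ cocone ω) :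
    q w - q z = (2 * w.re - 2 * z.re) • (p z * q w) + (‖z‖ ^ 2 - ‖w‖ ^ 2) • (q z * q w) := by
  have h1 := h.p_mul_p z hz w hw
  have h2 := h.p_mul_p w hw z hz
  rw [h.p_mul_p_comm w hw z hz, ← h.q_mul_p z hz w hw, h.q_mul_q w hw z hz,
    h.q_mul_p' z hz w hw] at h2
  rw [h1] at h2
  linear_combination (norm := module) h2

theorem p_sub {z w : ℂ} (hz : z ∈ cocone ω) (hw : w ∈ cocone ω) :
    p w - p z = (2 * w.re - 2 * z.re) • (p z * p w) + (‖z‖ ^ 2 - ‖w‖ ^ 2) • (p z * q w) := by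
  linear_combination (norm := module) h.p_eq z hz w hw

/-- Formally `conj z * q z - p z` is `(z - T)⁻¹` and `q μ` inverts `quad μ T`. From `quad μ z - quad
μ T = (z - T) (z + T - 2 Re μ)` one gets `quad μ z (z - T)⁻¹ q μ = (z - T)⁻¹ + (z + T - 2 Re μ) q
μ`; the statement is the imaginary part of `c` times this. -/
theorem opKernel_quad_mul_q {z μ : ℂ} (hz : z ∈ cocone ω) (hμ : μ ∈ cocone ω) (c : ℂ) :
    opKernel q p (c * quad μ z) z * q μ =
      opKernel q p c z + ((c * z).im - 2 * μ.re * c.im) • q μ + c.im • p μ := by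
  have h1 := h.p_mul_p z hz μ hμ
  have h2 := h.q_sub hz hμ
  have h3 := h.p_sub hz hμ
  have e1 : q μ = p z * p μ - (2 * z.re) • (p z * q μ) + (‖z‖ ^ 2) • (q z * q μ) := by
    rw [h1]; module
  have e2 : q z = q μ - ((2 * μ.re - 2 * z.re) • (p z * q μ) +
      (‖z‖ ^ 2 - ‖μ‖ ^ 2) • (q z * q μ)) := by rw [← h2]; module
  have e3 : p z = p μ - ((2 * μ.re - 2 * z.re) • (p z * p μ) +
      (‖z‖ ^ 2 - ‖μ‖ ^ 2) • (p z * q μ)) := by rw [← h3]; module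
  simp only [opKernel, sub_mul, smul_mul_assoc]
  generalize p z * q μ = x at *
  generalize q z * q μ = u at *
  generalize p z * p μ = y at *
  rw [e3, e2, e1]
  have hz2 : ‖z‖ ^ 2 = z.re ^ 2 + z.im ^ 2 := by
    rw [← Complex.normSq_eq_norm_sq, Complex.normSq_apply]; ring
  simp only [quad, Complex.mul_im, Complex.mul_re, Complex.conj_re, Complex.conj_im,
    Complex.add_re, Complex.add_im, Complex.sub_re, Complex.sub_im, pow_two, Complex.ofReal_re,
    Complex.ofReal_im, Complex.re_ofNat, Complex.im_ofNat]
  simp only [← pow_two ‖z‖, hz2]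
  module

/-- This is the previous identity multiplied by `T`, simplified with `T (z - T)⁻¹ = z (z - T)⁻¹ - 1`
and `T p μ = 1 + 2 Re μ p μ - |μ|² q μ`. -/
theorem opKernel_quad_mul_p {z μ : ℂ} (hz : z ∈ cocone ω) (hμ : μ ∈ cocone ω) (c : ℂ) :
    opKernel q p (c * quad μ z) z * p μ =
      opKernel q p (c * z) z + (c * z).im • p μ - (‖μ‖ ^ 2 * c.im) • q μ := by
  have h1 := h.p_mul_p z hz μ hμ
  have h2 := h.q_sub hz hμ
  have h3 := h.p_sub hz hμ
  have e1 : q μ = p z * p μ - (2 * z.re) • (p z * q μ) + (‖z‖ ^ 2) • (q z * q μ) := by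
    rw [h1]; module
  have e2 : q z = q μ - ((2 * μ.re - 2 * z.re) • (p z * q μ) +
      (‖z‖ ^ 2 - ‖μ‖ ^ 2) • (q z * q μ)) := by rw [← h2]; module
  have e3 : p z = p μ - ((2 * μ.re - 2 * z.re) • (p z * p μ) +
      (‖z‖ ^ 2 - ‖μ‖ ^ 2) • (p z * q μ)) := by rw [← h3]; module
  simp only [opKernel, sub_mul, smul_mul_assoc, h.q_mul_p' z hz μ hμ]
  generalize p z * q μ = x at *
  generalize q z * q μ = u at *
  generalize p z * p μ = y at *
  rw [e3, e2, e1]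
  have hz2 : ‖z‖ ^ 2 = z.re ^ 2 + z.im ^ 2 := by
    rw [← Complex.normSq_eq_norm_sq, Complex.normSq_apply]; ring
  simp only [quad, Complex.mul_im, Complex.mul_re, Complex.conj_re, Complex.conj_im,
    Complex.add_re, Complex.add_im, Complex.sub_re, Complex.sub_im, pow_two, Complex.ofReal_re,
    Complex.ofReal_im, Complex.re_ofNat, Complex.im_ofNat]
  simp only [← pow_two ‖z‖, hz2]
  module

/-- The resolvent equation. -/
theorem opKernel_mul_opKernel {z μ : ℂ} (hz : z ∈ cocone ω) (hμ : μ ∈ cocone ω)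
    (hne : quad μ z ≠ 0) (c' c : ℂ) :
    opKernel q p c' z * opKernel q p c μ = opKernel q p (c' * scalarKernel c μ z) z +
      (((c * conj μ).im * (((c' * (z / quad μ z)).im) - 2 * μ.re * (c' * (1 / quad μ z)).im) +
          c.im * ‖μ‖ ^ 2 * (c' * (1 / quad μ z)).im) • q μ +
        ((c * conj μ).im * (c' * (1 / quad μ z)).im - c.im * (c' * (z / quad μ z)).im) • p μ) := by
  -- Dividing by the quadratic brings both identities into play. The remainder depends on `z` only
  -- through the imaginary parts of `c' z / quad μ z` and `c' / quad μ z`, which are the quantities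
  -- that integrate to zero later.
  set d := c' * (1 / quad μ z) with hd
  have e1 : c' = d * quad μ z := by rw [hd]; field_simp
  have e2 : c' * (z / quad μ z) = d * z := by rw [hd]; ring
  have e3 : c' * scalarKernel c μ z = (c * conj μ).im * d - c.im * (d * z) := by
    rw [hd, scalarKernel]; ring
  have e4 : opKernel q p (c' * scalarKernel c μ z) z =
      (c * conj μ).im • opKernel q p d z - c.im • opKernel q p (d * z) z := by
    rw [e3, ← opKernelL_apply, ← opKernelL_apply, ← opKernelL_apply, map_sub]
    simp only [← Complex.real_smul, map_smul]
  have h1 := h.opKernel_quad_mul_q hz hμ d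
  have h2 := h.opKernel_quad_mul_p hz hμ d
  rw [← e1] at h1 h2
  rw [e2, e4]
  conv_lhs => rw [opKernel.eq_def q p c μ, mul_sub, mul_smul_comm, mul_smul_comm, h1, h2]
  module

theorem exists_norm_opKernel_le : ∃ C : ℝ, 0 ≤ C ∧ ∀ z ∈ cocone ω, ∀ c : ℂ,
    ‖z‖ * ‖opKernel q p c z‖ ≤ C * ‖c‖ := by
  obtain ⟨C, hC⟩ := h.bound
  refine ⟨2 * max C 0, by positivity, fun z hz c => ?_⟩
  obtain ⟨h1, h2⟩ := hC z hz
  have h3 : ‖opKernel q p c z‖ ≤ ‖c‖ * ‖z‖ * ‖q z‖ + ‖c‖ * ‖p z‖ := by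
    refine (norm_sub_le _ _).trans ?_
    rw [norm_smul, norm_smul]
    gcongr
    · refine (Complex.abs_im_le_norm _).trans ?_
      simp
    · exact Complex.abs_im_le_norm _
  calc ‖z‖ * ‖opKernel q p c z‖ ≤ ‖z‖ * (‖c‖ * ‖z‖ * ‖q z‖ + ‖c‖ * ‖p z‖) := by gcongr
    _ = ‖c‖ * (‖z‖ ^ 2 * ‖q z‖ + ‖z‖ * ‖p z‖) := by ring
    _ ≤ ‖c‖ * (max C 0 + max C 0) := by
      gcongr
      · exact h1.trans (le_max_left _ _)
      · exact h2.trans (le_max_left _ _)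
    _ = _ := by ring

/-- In `q_sub` the scalar coefficients vanish at `w = z`, while `q w` stays bounded near `z` by the
resolvent bound. -/
theorem continuousAt_q {z : ℂ} (hz : z ∈ cocone ω) : ContinuousAt q z := by
  obtain ⟨C, hC⟩ := h.bound
  have hz0 := ne_zero_of_mem_cocone hz
  have hn0 : ‖z‖ ≠ 0 := norm_ne_zero_iff.2 hz0
  rw [ContinuousAt, tendsto_iff_norm_sub_tendsto_zero]
  have hlim : Tendsto (fun w : ℂ => |2 * w.re - 2 * z.re| * (‖p z‖ * (C / ‖w‖ ^ 2)) +
      |‖z‖ ^ 2 - ‖w‖ ^ 2| * (‖q z‖ * (C / ‖w‖ ^ 2))) (𝓝 z) (𝓝 0) := by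
    have : ContinuousAt (fun w : ℂ => |2 * w.re - 2 * z.re| * (‖p z‖ * (C / ‖w‖ ^ 2)) +
      |‖z‖ ^ 2 - ‖w‖ ^ 2| * (‖q z‖ * (C / ‖w‖ ^ 2))) z := by
      fun_prop (disch := positivity)
    simpa [ContinuousAt] using this
  refine squeeze_zero' (Eventually.of_forall fun _ => norm_nonneg _) ?_ hlim
  filter_upwards [(isOpen_cocone ω).mem_nhds hz] with w hw
  have hw0 : 0 < ‖w‖ := norm_pos_iff.2 (ne_zero_of_mem_cocone hw)
  have hb : ‖q w‖ ≤ C / ‖w‖ ^ 2 := by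
    rw [le_div_iff₀ (by positivity), mul_comm]; exact (hC w hw).1
  rw [h.q_sub hz hw]
  refine (norm_add_le _ _).trans ?_
  rw [norm_smul, norm_smul, Real.norm_eq_abs, Real.norm_eq_abs]
  gcongr
  · exact (norm_mul_le _ _).trans (by gcongr)
  · exact (norm_mul_le _ _).trans (by gcongr)

theorem continuousAt_p {z : ℂ} (hz : z ∈ cocone ω) : ContinuousAt p z := by
  obtain ⟨C, hC⟩ := h.bound
  have hz0 := ne_zero_of_mem_cocone hz
  have hn0 : ‖z‖ ≠ 0 := norm_ne_zero_iff.2 hz0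
  rw [ContinuousAt, tendsto_iff_norm_sub_tendsto_zero]
  have hlim : Tendsto (fun w : ℂ => |2 * w.re - 2 * z.re| * (‖p z‖ * (C / ‖w‖)) +
      |‖z‖ ^ 2 - ‖w‖ ^ 2| * (‖p z‖ * (C / ‖w‖ ^ 2))) (𝓝 z) (𝓝 0) := by
    have : ContinuousAt (fun w : ℂ => |2 * w.re - 2 * z.re| * (‖p z‖ * (C / ‖w‖)) +
      |‖z‖ ^ 2 - ‖w‖ ^ 2| * (‖p z‖ * (C / ‖w‖ ^ 2))) z := by
      fun_prop (disch := positivity)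
    simpa [ContinuousAt] using this
  refine squeeze_zero' (Eventually.of_forall fun _ => norm_nonneg _) ?_ hlim
  filter_upwards [(isOpen_cocone ω).mem_nhds hz] with w hw
  have hw0 : 0 < ‖w‖ := norm_pos_iff.2 (ne_zero_of_mem_cocone hw)
  have hb : ‖q w‖ ≤ C / ‖w‖ ^ 2 := by
    rw [le_div_iff₀ (by positivity), mul_comm]; exact (hC w hw).1
  have hb' : ‖p w‖ ≤ C / ‖w‖ := by
    rw [le_div_iff₀ (by positivity), mul_comm]; exact (hC w hw).2
  rw [h.p_sub hz hw]
  refine (norm_add_le _ _).trans ?_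
  rw [norm_smul, norm_smul, Real.norm_eq_abs, Real.norm_eq_abs]
  gcongr
  · exact (norm_mul_le _ _).trans (by gcongr)
  · exact (norm_mul_le _ _).trans (by gcongr)

theorem continuousOn_opKernel {X : Type*} [TopologicalSpace X] {S : Set X} {c z : X → ℂ}
    (hc : ContinuousOn c S) (hz : ContinuousOn z S) (hm : ∀ x ∈ S, z x ∈ cocone ω) :
    ContinuousOn (fun x => opKernel q p (c x) (z x)) S := by
  have hq : ContinuousOn q (cocone ω) := fun w hw => (h.continuousAt_q hw).continuousWithinAt
  have hp : ContinuousOn p (cocone ω) := fun w hw => (h.continuousAt_p hw).continuousWithinAt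
  have h1 : ContinuousOn (fun x => (c x * conj (z x)).im) S :=
    Complex.continuous_im.comp_continuousOn (hc.mul (Complex.continuous_conj.comp_continuousOn hz))
  exact (h1.smul (hq.comp hz hm)).sub
    ((Complex.continuous_im.comp_continuousOn hc).smul (hp.comp hz hm))

/-- The resolvent, tested with a functional. -/
theorem differentiableOn_dual_resolvent (l : StrongDual ℝ A) :
    DifferentiableOn ℂ (fun z => conj z * (l (q z) : ℂ) - (l (p z) : ℂ)) (cocone ω) := by
  intro z hz
  refine DifferentiableAt.differentiableWithinAt ?_
  -- `S w` is the functional applied to minus the product of the resolvents at `z` and `w`. The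
  -- resolvent identity says that this is the difference quotient, so the derivative is its value at
  -- `w = z`.
  set S : ℂ → ℂ := fun w => -(conj z * conj w * (l (q z * q w) : ℂ) -
    (conj z + conj w) * (l (p z * q w) : ℂ) + (l (p z * p w) : ℂ)) with hS
  suffices HasDerivAt (fun z => conj z * (l (q z) : ℂ) - (l (p z) : ℂ)) (S z) z from
    this.differentiableAt
  rw [hasDerivAt_iff_tendsto_slope]
  have hq := h.continuousAt_q hz
  have hp := h.continuousAt_p hz
  have hSc : ContinuousAt S z := by
    have h1 : ∀ a : A, ∀ f : ℂ → A, ContinuousAt f z →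
        ContinuousAt (fun w => (l (a * f w) : ℂ)) z := fun a f hf =>
      Complex.continuous_ofReal.continuousAt.comp
        (l.continuous.continuousAt.comp (continuousAt_const.mul hf))
    have h2 := h1 (q z) q hq
    have h3 := h1 (p z) q hq
    have h4 := h1 (p z) p hp
    have h5 : ContinuousAt (fun w : ℂ => conj w) z := Complex.continuous_conj.continuousAt
    exact (((continuousAt_const.mul h5).mul h2).sub
      ((continuousAt_const.add h5).mul h3) |>.add h4).neg
  refine (hSc.tendsto.mono_left nhdsWithin_le_nhds).congr' ?_
  filter_upwards [self_mem_nhdsWithin,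
    mem_nhdsWithin_of_mem_nhds ((isOpen_cocone ω).mem_nhds hz)] with w hw hwc
  have hne : w - z ≠ 0 := sub_ne_zero.2 hw
  rw [slope_def_field, eq_div_iff hne]
  have e1 : (l (q w) : ℂ) = l (p z * p w) - (2 * z.re) * l (p z * q w) +
      (‖z‖ : ℂ) ^ 2 * l (q z * q w) := by
    have := congrArg l (h.p_mul_p z hz w hwc)
    simp only [map_add, map_sub, map_smul, smul_eq_mul] at this
    rw [this]; push_cast; ring
  have e2 : (l (q z) : ℂ) = l (q w) - ((2 * w.re - 2 * z.re) * l (p z * q w) +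
      ((‖z‖ : ℂ) ^ 2 - (‖w‖ : ℂ) ^ 2) * l (q z * q w)) := by
    have := congrArg l (h.q_sub hz hwc)
    simp only [map_add, map_sub, map_smul, smul_eq_mul] at this
    have h2 := congrArg (fun x : ℝ => (x : ℂ)) this
    push_cast at h2
    linear_combination -h2
  have e3 : (l (p w) : ℂ) = l (p z) + ((2 * w.re - 2 * z.re) * l (p z * p w) +
      ((‖z‖ : ℂ) ^ 2 - (‖w‖ : ℂ) ^ 2) * l (p z * q w)) := by
    have := congrArg l (h.p_sub hz hwc)
    simp only [map_add, map_sub, map_smul, smul_eq_mul] at this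
    have h2 := congrArg (fun x : ℝ => (x : ℂ)) this
    push_cast at h2
    linear_combination h2
  rw [e3, e2, e1]
  have n1 : (‖z‖ : ℂ) ^ 2 = z * conj z := (Complex.mul_conj' z).symm
  have n2 : (‖w‖ : ℂ) ^ 2 = w * conj w := (Complex.mul_conj' w).symm
  have n3 : (2 * z.re : ℂ) = z + conj z := by rw [Complex.add_conj]; push_cast; ring
  have n4 : (2 * w.re : ℂ) = w + conj w := by rw [Complex.add_conj]; push_cast; ring
  rw [n1, n2, n3, n4, hS]
  ring

end ResolventPair

/-- A real functional turns the operator kernel into the imaginary part of a holomorphic function,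
which makes scalar contour arguments available although the algebra has no complex structure. -/
theorem dual_opKernel (q p : ℂ → A) (l : StrongDual ℝ A) (c z : ℂ) :
    l (opKernel q p c z) = (c * (conj z * (l (q z) : ℂ) - (l (p z) : ℂ))).im := by
  simp only [opKernel, map_sub, map_smul, smul_eq_mul, mul_sub, ← mul_assoc, Complex.sub_im,
    Complex.im_mul_ofReal]

end ResolventPair

/-! ### The calculus for decaying intrinsic functions -/

section Calculus

variable {A : Type*} [NormedRing A] [NormedAlgebra ℝ A]

/-- The integral of the imaginary part of `F(z) dz` times the resolvent along a ray. -/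
def rayPart (q p : ℂ → A) (ψ : ℝ) (F : ℂ → ℂ) : A :=
  ∫ t in Ioi (0 : ℝ), opKernel q p (Complex.exp (ψ * Complex.I) * F (ray ψ t)) (ray ψ t)

/-- The functional calculus for intrinsic functions. -/
def holCalc (q p : ℂ → A) (φ : ℝ) (F : ℂ → ℂ) : A :=
  Real.pi⁻¹ • (rayPart q p (Real.pi - φ) F - rayPart q p φ F)

theorem rayPart_congr {θ ψ : ℝ} (hθ : θ ∈ Ioo 0 (Real.pi / 2)) (hψ : ψ ∈ angles θ)
    (q p : ℂ → A) {F G : ℂ → ℂ} (h : ∀ z ∈ csector θ, F z = G z) :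
    rayPart q p ψ F = rayPart q p ψ G :=
  setIntegral_congr_fun measurableSet_Ioi fun t ht => by
    simp only [h _ (ray_mem_csector_of_mem_angles hθ hψ ht)]

theorem im_setIntegral {F : ℝ → ℂ} (hF : IntegrableOn F (Ioi 0)) :
    ∫ t in Ioi (0 : ℝ), (F t).im = (∫ t in Ioi (0 : ℝ), F t).im :=
  integral_im (𝕜 := ℂ) hF

theorem mem_angles_of_lt {φ θ : ℝ} (hφ : 0 < φ) (hφθ : φ < θ) : φ ∈ angles θ :=
  Or.inl ⟨by linarith, hφθ⟩

theorem pi_sub_mem_angles_of_lt {φ θ : ℝ} (hφ : 0 < φ) (hφθ : φ < θ) :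
    Real.pi - φ ∈ angles θ :=
  Or.inr ⟨by linarith, by linarith⟩

theorem holCalc_congr {θ φ : ℝ} (hθ : θ < Real.pi / 2) (hφ : φ ∈ Ioo 0 θ)
    (q p : ℂ → A) {F G : ℂ → ℂ} (h : ∀ z ∈ csector θ, F z = G z) :
    holCalc q p φ F = holCalc q p φ G := by
  have hθI : θ ∈ Ioo 0 (Real.pi / 2) := ⟨hφ.1.trans hφ.2, hθ⟩
  rw [holCalc, holCalc, rayPart_congr hθI (mem_angles_of_lt hφ.1 hφ.2) q p h,
    rayPart_congr hθI (pi_sub_mem_angles_of_lt hφ.1 hφ.2) q p h]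

namespace ResolventPair

variable {ω : ℝ} {q p : ℂ → A} (h : ResolventPair ω q p)

include h

theorem integrableOn_opKernel (hω : ω ∈ Ioo 0 (Real.pi / 2)) {ψ : ℝ}
    (hψ : ψ ∈ Ioo ω (Real.pi - ω)) {F : ℂ → ℂ} (hc : ContinuousOn (fun t => F (ray ψ t)) (Ioi 0))
    (hi : IntegrableOn (fun t => ‖F (ray ψ t)‖ / t) (Ioi 0)) :
    IntegrableOn (fun t => opKernel q p (Complex.exp (ψ * Complex.I) * F (ray ψ t)) (ray ψ t))
      (Ioi 0) := by
  obtain ⟨C, hC0, hC⟩ := h.exists_norm_opKernel_le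
  refine Integrable.mono' (hi.const_mul C) ?_ ?_
  · refine ContinuousOn.aestronglyMeasurable ?_ measurableSet_Ioi
    exact h.continuousOn_opKernel (continuousOn_const.mul hc) (continuous_ray ψ).continuousOn
      fun t ht => ray_mem_cocone hω hψ ht
  · refine (ae_restrict_iff' measurableSet_Ioi).2 (ae_of_all _ fun t ht => ?_)
    have ht' : 0 < t := ht
    have := hC _ (ray_mem_cocone hω hψ ht') (Complex.exp (ψ * Complex.I) * F (ray ψ t))
    rw [norm_ray, abs_of_pos ht', norm_mul, Complex.norm_exp_ofReal_mul_I, one_mul] at this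
    rw [mul_div_assoc', le_div_iff₀ ht', mul_comm]
    exact this

theorem integrableOn_opKernel_hZero (hω : ω ∈ Ioo 0 (Real.pi / 2)) {θ ψ : ℝ}
    (hθ : θ ∈ Ioo 0 (Real.pi / 2)) (hψ : ψ ∈ Ioo ω (Real.pi - ω)) (hψ' : ψ ∈ angles θ)
    {F : ℂ → ℂ} (hF : HZero θ F) :
    IntegrableOn (fun t => opKernel q p (Complex.exp (ψ * Complex.I) * F (ray ψ t)) (ray ψ t))
      (Ioi 0) :=
  h.integrableOn_opKernel hω hψ (hF.continuousOn_ray hθ hψ') (hF.integrable ψ hψ')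

theorem holCalc_add (hω : ω ∈ Ioo 0 (Real.pi / 2)) {θ φ : ℝ} (hθ : θ < Real.pi / 2)
    (hφ : φ ∈ Ioo ω θ) {F G : ℂ → ℂ} (hF : HZero θ F) (hG : HZero θ G) :
    holCalc q p φ (fun z => F z + G z) = holCalc q p φ F + holCalc q p φ G := by
  have hφ0 : 0 < φ := hω.1.trans hφ.1
  have hθI : θ ∈ Ioo 0 (Real.pi / 2) := ⟨hφ0.trans hφ.2, hθ⟩
  have key : ∀ ψ ∈ Ioo ω (Real.pi - ω), ψ ∈ angles θ →
      rayPart q p ψ (fun z => F z + G z) = rayPart q p ψ F + rayPart q p ψ G := by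
    intro ψ h1 h2
    rw [rayPart, rayPart, rayPart, ← integral_add (h.integrableOn_opKernel_hZero hω hθI h1 h2 hF)
      (h.integrableOn_opKernel_hZero hω hθI h1 h2 hG)]
    refine integral_congr_ae (ae_of_all _ fun t => ?_)
    simp only [← opKernelL_apply, mul_add, map_add]
  rw [holCalc, key φ ⟨hφ.1, by linarith [hφ.2, hφ.1]⟩ (mem_angles_of_lt hφ0 hφ.2),
    key (Real.pi - φ) ⟨by linarith [hφ.1, hφ.2], by linarith [hφ.1]⟩
      (pi_sub_mem_angles_of_lt hφ0 hφ.2), holCalc, holCalc]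
  module

omit h in
theorem _root_.CliffordCalc.holCalc_const_mul (q p : ℂ → A) (φ a : ℝ) (F : ℂ → ℂ) :
    holCalc q p φ (fun z => a * F z) = a • holCalc q p φ F := by
  have key : ∀ ψ, rayPart q p ψ (fun z => a * F z) = a • rayPart q p ψ F := by
    intro ψ
    rw [rayPart, rayPart, ← integral_smul]
    refine integral_congr_ae (ae_of_all _ fun t => ?_)
    simp only [← opKernelL_apply, ← map_smul, Complex.real_smul, mul_left_comm]
  rw [holCalc, key, key, holCalc]
  module

/-- Rotation of the rays of integration. -/
theorem rayPart_eq_of_le [CompleteSpace A] (hω : ω ∈ Ioo 0 (Real.pi / 2)) {θ α β : ℝ}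
    (hθ : θ ∈ Ioo 0 (Real.pi / 2)) (hαβ : α ≤ β) (h1 : ∀ ψ ∈ Icc α β, ψ ∈ Ioo ω (Real.pi - ω))
    (h2 : ∀ ψ ∈ Icc α β, ψ ∈ angles θ) {F : ℂ → ℂ} (hF : HZero θ F) :
    rayPart q p α F = rayPart q p β F := by
  have mα : α ∈ Icc α β := ⟨le_rfl, hαβ⟩
  have mβ : β ∈ Icc α β := ⟨hαβ, le_rfl⟩
  -- Functionals separate points, so it suffices to rotate the scalar integrals, whose integrand is
  -- holomorphic where `F` and the resolvent both are.
  rw [SeparatingDual.eq_iff_forall_dual_eq (R := ℝ)]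
  intro l
  set r : ℂ → ℂ := fun z => conj z * (l (q z) : ℂ) - (l (p z) : ℂ) with hr
  obtain ⟨C, hC⟩ := h.bound
  obtain ⟨M, hM⟩ := hF.bdd
  have hrb : ∀ z ∈ cocone ω, ‖z‖ * ‖r z‖ ≤ ‖l‖ * (C + C) := by
    intro z hz
    obtain ⟨c1, c2⟩ := hC z hz
    have e : ‖r z‖ ≤ ‖z‖ * (‖l‖ * ‖q z‖) + ‖l‖ * ‖p z‖ := by
      refine (norm_sub_le _ _).trans ?_
      rw [norm_mul, RCLike.norm_conj, Complex.norm_real, Complex.norm_real]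
      gcongr <;> exact l.le_opNorm _
    calc ‖z‖ * ‖r z‖ ≤ ‖z‖ * (‖z‖ * (‖l‖ * ‖q z‖) + ‖l‖ * ‖p z‖) := by gcongr
      _ = ‖l‖ * (‖z‖ ^ 2 * ‖q z‖ + ‖z‖ * ‖p z‖) := by ring
      _ ≤ _ := by gcongr
  set U := csector θ ∩ cocone ω with hU
  have hmem : ∀ ψ ∈ Icc α β, ∀ t : ℝ, 0 < t → ray ψ t ∈ U := fun ψ hψ t ht =>
    ⟨ray_mem_csector_of_mem_angles hθ (h2 ψ hψ) ht, ray_mem_cocone hω (h1 ψ hψ) ht⟩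
  have hd : DifferentiableOn ℂ (fun z => F z * r z) U :=
    (hF.diff.mono inter_subset_left).mul
      ((h.differentiableOn_dual_resolvent l).mono inter_subset_right)
  have hint : ∀ ψ ∈ Icc α β, IntegrableOn (fun t => F (ray ψ t) * r (ray ψ t)) (Ioi 0) := by
    intro ψ hψ
    refine Integrable.mono' ((hF.integrable ψ (h2 ψ hψ)).const_mul (‖l‖ * (C + C))) ?_ ?_
    · exact ContinuousOn.aestronglyMeasurable (hd.continuousOn.comp (continuous_ray ψ).continuousOn
        fun t ht => hmem ψ hψ t ht) measurableSet_Ioi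
    · refine (ae_restrict_iff' measurableSet_Ioi).2 (ae_of_all _ fun t ht => ?_)
      have ht' : 0 < t := ht
      have := hrb _ (hmem ψ hψ t ht).2
      rw [norm_ray, abs_of_pos ht'] at this
      rw [norm_mul, mul_div_assoc', le_div_iff₀ ht']
      calc _ = ‖F (ray ψ t)‖ * (t * ‖r (ray ψ t)‖) := by ring
        _ ≤ ‖F (ray ψ t)‖ * (‖l‖ * (C + C)) := by gcongr
        _ = _ := by ring
  have hl : ∀ ψ ∈ Icc α β, l (rayPart q p ψ F) =
      (∫ t in Ioi (0 : ℝ), Complex.exp (ψ * Complex.I) * (F (ray ψ t) * r (ray ψ t))).im := by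
    intro ψ hψ
    rw [← im_setIntegral ((hint ψ hψ).const_mul _), rayPart, ← l.integral_comp_comm
      (h.integrableOn_opKernel_hZero hω hθ (h1 ψ hψ) (h2 ψ hψ) hF)]
    refine integral_congr_ae (ae_of_all _ fun t => ?_)
    simp only [dual_opKernel, hr, mul_assoc]
  rw [hl α mα, hl β mβ]
  congr 1
  refine integral_ray_eq hαβ ((isOpen_csector θ).inter (isOpen_cocone ω)) hd hmem
    (M := M * (‖l‖ * (C + C))) (fun ψ hψ t ht => ?_) (hint α mα) (hint β mβ)
  have e1 := hrb _ (hmem ψ hψ t ht).2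
  rw [norm_ray, abs_of_pos ht] at e1
  have e2 := hM _ (hmem ψ hψ t ht).1
  rw [norm_mul, mul_left_comm]
  exact mul_le_mul e2 e1 (by positivity) ((norm_nonneg _).trans e2)

/-- The functional calculus does not depend on the angle. -/
theorem holCalc_eq_of_le [CompleteSpace A] (hω : ω ∈ Ioo 0 (Real.pi / 2)) {θ φ φ' : ℝ}
    (hθ : θ < Real.pi / 2) (hφ : ω < φ) (hφφ' : φ ≤ φ') (hφ' : φ' < θ) {F : ℂ → ℂ}
    (hF : HZero θ F) : holCalc q p φ F = holCalc q p φ' F := by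
  have hω0 := hω.1
  have hθI : θ ∈ Ioo 0 (Real.pi / 2) := ⟨by linarith, hθ⟩
  rw [holCalc, holCalc, h.rayPart_eq_of_le hω hθI hφφ'
      (fun ψ hψ => ⟨by linarith [hψ.1], by linarith [hψ.2]⟩)
      (fun ψ hψ => Or.inl ⟨by linarith [hψ.1], by linarith [hψ.2]⟩) hF,
    ← h.rayPart_eq_of_le hω hθI (α := Real.pi - φ') (β := Real.pi - φ) (by linarith)
      (fun ψ hψ => ⟨by linarith [hψ.1], by linarith [hψ.2]⟩)
      (fun ψ hψ => Or.inr ⟨by linarith [hψ.1], by linarith [hψ.2]⟩) hF]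

/-- The resolvent equation is applied under the integral. The remainder consists of fixed elements
of the algebra times the imaginary parts of the integrals of `H z * z / quad μ z` and `H z / quad μ
z`. The zeros `μ` and `conj μ` lie outside `csector α`, so these integrals can be rotated to the
real axis and are real. -/
theorem rayPart_mul_opKernel [CompleteSpace A] (hω : ω ∈ Ioo 0 (Real.pi / 2)) {φ α β θ : ℝ}
    (hφ : ω < φ) (hφα : φ < α) (hαβ : α < β) (hβ : β < Real.pi / 2) (hαθ : α ≤ θ)
    (hθ : θ < Real.pi / 2) {H : ℂ → ℂ} (hH : HZero θ H) {ψ : ℝ} (hψ : ψ = φ ∨ ψ = Real.pi - φ)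
    {μ : ℂ} (hμ : μ ∈ cocone ω) (hμβ : |μ.re| * Real.sin β ≤ |μ.im| * Real.cos β) (c : ℂ) :
    rayPart q p ψ H * opKernel q p c μ = rayPart q p ψ (fun z => H z * scalarKernel c μ z) := by
  have hω0 := hω.1
  have hθI : θ ∈ Ioo 0 (Real.pi / 2) := ⟨by linarith, hθ⟩
  have hαI : α ∈ Ioo 0 (Real.pi / 2) := ⟨by linarith, by linarith⟩
  have hψ1 : ψ ∈ Ioo ω (Real.pi - ω) := by
    rcases hψ with rfl | rfl <;> constructor <;> linarith
  have hψ2 : ψ ∈ angles α := by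
    rcases hψ with rfl | rfl
    · exact mem_angles_of_lt (by linarith) hφα
    · exact pi_sub_mem_angles_of_lt (by linarith) hφα
  have hψ3 : ψ ∈ angles θ := by
    rcases hψ with rfl | rfl
    · exact mem_angles_of_lt (by linarith) (by linarith)
    · exact pi_sub_mem_angles_of_lt (by linarith) (by linarith)
  have hμ0 : 0 < ‖μ‖ := norm_pos_iff.2 (ne_zero_of_mem_cocone hμ)
  obtain ⟨δ, hδ, hquad⟩ := exists_quad_ge hαI.1 hαβ hβ
  have hQpos : ∀ z ∈ csector α, 0 < ‖quad μ z‖ := fun z hz =>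
    lt_of_lt_of_le (by positivity) (hquad z hz μ hμβ)
  have hQ0 : ∀ z ∈ csector α, quad μ z ≠ 0 := fun z hz => norm_pos_iff.1 (hQpos z hz)
  have hQd : Differentiable ℂ (quad μ) := by unfold quad; fun_prop
  have m1d : DifferentiableOn ℂ (fun z => z / quad μ z) (csector α) :=
    differentiableOn_id.div hQd.differentiableOn hQ0
  have m2d : DifferentiableOn ℂ (fun z => 1 / quad μ z) (csector α) :=
    (differentiableOn_const 1).div hQd.differentiableOn hQ0
  have m1b : ∀ z ∈ csector α, ‖z‖ * ‖z / quad μ z‖ ≤ δ⁻¹ := by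
    intro z hz
    rw [norm_div, mul_div_assoc', div_le_iff₀ (hQpos z hz), inv_mul_eq_div, le_div_iff₀ hδ]
    refine le_trans ?_ (hquad z hz μ hμβ)
    rw [mul_comm]
    gcongr
    nlinarith [norm_nonneg z]
  have m2b : ∀ z ∈ csector α, ‖z‖ * ‖1 / quad μ z‖ ≤ (δ * ‖μ‖)⁻¹ := by
    intro z hz
    rw [norm_div, mul_div_assoc', div_le_iff₀ (hQpos z hz), inv_mul_eq_div,
      le_div_iff₀ (by positivity), norm_one, mul_one]
    refine le_trans ?_ (hquad z hz μ hμβ)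
    rw [mul_left_comm]
    gcongr
    nlinarith [norm_nonneg z]
  obtain ⟨i1, v1⟩ := im_integral_ray_eq_zero (hω0.trans hφ) hφα hαθ hθ hH m1d
    (fun z _ => by rw [quad_conj, map_div₀]) m1b hψ
  obtain ⟨i2, v2⟩ := im_integral_ray_eq_zero (hω0.trans hφ) hφα hαθ hθ hH m2d
    (fun z _ => by rw [quad_conj, map_div₀, map_one]) m2b hψ
  have i1' := i1.const_mul (Complex.exp (ψ * Complex.I))
  have i2' := i2.const_mul (Complex.exp (ψ * Complex.I))
  rw [← im_setIntegral i1'] at v1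
  rw [← im_setIntegral i2'] at v2
  have j1 : IntegrableOn (fun t : ℝ => (Complex.exp (ψ * Complex.I) *
      (H (ray ψ t) * (ray ψ t / quad μ (ray ψ t)))).im) (Ioi 0) := i1'.im
  have j2 : IntegrableOn (fun t : ℝ => (Complex.exp (ψ * Complex.I) *
      (H (ray ψ t) * (1 / quad μ (ray ψ t)))).im) (Ioi 0) := i2'.im
  have hKint := h.integrableOn_opKernel_hZero hω hθI hψ1 hψ3 hH
  -- The remainder of the resolvent equation, regrouped: `X` collects the terms with `z / quad μ z`,
  -- `Y` those with `1 / quad μ z`.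
  set X := (c * conj μ).im • q μ - c.im • p μ with hX
  set Y := (-(2 * μ.re) * (c * conj μ).im + c.im * ‖μ‖ ^ 2) • q μ + (c * conj μ).im • p μ with hY
  have hpt : ∀ t ∈ Ioi (0 : ℝ),
      opKernel q p (Complex.exp (ψ * Complex.I) * (H (ray ψ t) * scalarKernel c μ (ray ψ t)))
        (ray ψ t) =
      opKernel q p (Complex.exp (ψ * Complex.I) * H (ray ψ t)) (ray ψ t) * opKernel q p c μ -
      ((Complex.exp (ψ * Complex.I) * (H (ray ψ t) * (ray ψ t / quad μ (ray ψ t)))).im • X +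
      (Complex.exp (ψ * Complex.I) * (H (ray ψ t) * (1 / quad μ (ray ψ t)))).im • Y) := by
    intro t ht
    rw [h.opKernel_mul_opKernel (ray_mem_cocone hω hψ1 ht) hμ
      (hQ0 _ (ray_mem_csector_of_mem_angles hαI hψ2 ht)), hX, hY]
    simp only [mul_assoc]
    module
  have hXY : IntegrableOn (fun t : ℝ =>
      (Complex.exp (ψ * Complex.I) * (H (ray ψ t) * (ray ψ t / quad μ (ray ψ t)))).im • X +
      (Complex.exp (ψ * Complex.I) * (H (ray ψ t) * (1 / quad μ (ray ψ t)))).im • Y) (Ioi 0) :=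
    (j1.smul_const X).add (j2.smul_const Y)
  rw [rayPart, rayPart, setIntegral_congr_fun measurableSet_Ioi hpt,
    integral_sub (hKint.mul_const _) hXY,
    integral_add (j1.smul_const X) (j2.smul_const Y), integral_smul_const, integral_smul_const,
    v1, v2, integral_mul_const_of_integrable hKint]
  simp

end ResolventPair

end Calculus

section Calculus

variable {A : Type*} [NormedRing A] [NormedAlgebra ℝ A] [CompleteSpace A]

namespace ResolventPair

variable {ω : ℝ} {q p : ℂ → A} (h : ResolventPair ω q p)

include h

/-- The two ray integrals can be interchanged. -/
theorem rayPart_mul_rayPart (hω : ω ∈ Ioo 0 (Real.pi / 2)) {φ φ' θ : ℝ}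
    (hφ : ω < φ) (hφφ' : φ < φ') (hφ' : φ' < θ) (hθ : θ < Real.pi / 2)
    {H G : ℂ → ℂ} (hH : HZero θ H) (hG : HZero θ G)
    {ψ ψ' : ℝ} (hψ : ψ = φ ∨ ψ = Real.pi - φ) (hψ' : ψ' = φ' ∨ ψ' = Real.pi - φ') :
    IntegrableOn (fun t => opKernel q p (Complex.exp (ψ * Complex.I) * (H (ray ψ t) *
        ∫ τ in Ioi (0 : ℝ), scalarKernel (Complex.exp (ψ' * Complex.I) * G (ray ψ' τ)) (ray ψ' τ)
          (ray ψ t))) (ray ψ t)) (Ioi 0) ∧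
    rayPart q p ψ H * rayPart q p ψ' G =
      rayPart q p ψ (fun z => H z *
        ∫ τ in Ioi (0 : ℝ), scalarKernel (Complex.exp (ψ' * Complex.I) * G (ray ψ' τ)) (ray ψ' τ)
          z) := by
  have hω0 := hω.1
  -- An intermediate angle keeps the inner contour uniformly away from the poles, which lie on the
  -- outer contour and its mirror image.
  obtain ⟨α, hα1, hα2⟩ := exists_between hφφ'
  have hθI : θ ∈ Ioo 0 (Real.pi / 2) := ⟨by linarith, hθ⟩
  have hαI : α ∈ Ioo 0 (Real.pi / 2) := ⟨by linarith, by linarith⟩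
  have hφ'I : φ' ∈ Ioo 0 (Real.pi / 2) := ⟨by linarith, by linarith⟩
  have hψ1 : ψ ∈ Ioo ω (Real.pi - ω) := by
    rcases hψ with rfl | rfl <;> constructor <;> linarith
  have hψ1' : ψ' ∈ Ioo ω (Real.pi - ω) := by
    rcases hψ' with rfl | rfl <;> constructor <;> linarith
  have hψ2 : ψ ∈ angles α := by
    rcases hψ with rfl | rfl
    · exact mem_angles_of_lt (by linarith) hα1
    · exact pi_sub_mem_angles_of_lt (by linarith) hα1
  have hψ3 : ψ ∈ angles θ := by
    rcases hψ with rfl | rfl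
    · exact mem_angles_of_lt (by linarith) (by linarith)
    · exact pi_sub_mem_angles_of_lt (by linarith) (by linarith)
  have hψ3' : ψ' ∈ angles θ := by
    rcases hψ' with rfl | rfl
    · exact mem_angles_of_lt (by linarith) (by linarith)
    · exact pi_sub_mem_angles_of_lt (by linarith) (by linarith)
  obtain ⟨δ, hδ, hquad⟩ := exists_quad_ge hαI.1 hα2 hφ'I.2
  have hbdry : ∀ τ : ℝ, 0 < τ →
      |(ray ψ' τ).re| * Real.sin φ' ≤ |(ray ψ' τ).im| * Real.cos φ' := fun τ hτ => by
    refine ray_boundary_of hφ'I ?_ hτ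
    rcases hψ' with rfl | rfl
    · exact Or.inl (abs_of_pos hφ'I.1)
    · right; rw [sub_sub_cancel]; exact abs_of_pos hφ'I.1
  have hzm : ∀ t : ℝ, 0 < t → ray ψ t ∈ csector α := fun t ht =>
    ray_mem_csector_of_mem_angles hαI hψ2 ht
  set c' : ℝ → ℂ := fun τ => Complex.exp (ψ' * Complex.I) * G (ray ψ' τ) with hc'
  have hc'n : ∀ τ, ‖c' τ‖ = ‖G (ray ψ' τ)‖ := fun τ => by
    simp [hc', Complex.norm_exp_ofReal_mul_I]
  have hQ : ∀ t τ : ℝ, 0 < t → 0 < τ → δ * (t + τ) ^ 2 ≤ ‖quad (ray ψ' τ) (ray ψ t)‖ := by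
    intro t τ ht hτ
    simpa [norm_ray, abs_of_pos ht, abs_of_pos hτ] using hquad _ (hzm t ht) _ (hbdry τ hτ)
  have hQ0 : ∀ t τ : ℝ, 0 < t → 0 < τ → quad (ray ψ' τ) (ray ψ t) ≠ 0 := fun t τ ht hτ =>
    norm_pos_iff.1 (lt_of_lt_of_le (by positivity) (hQ t τ ht hτ))
  -- The numerator is at most `‖G‖ (t + τ)` and the quadratic at least `δ (t + τ)²`. Hence the
  -- double integrand is dominated by a constant times the product of the integrable functions `‖H‖
  -- / t` and `‖G‖ / τ`, and Fubini applies.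
  have hk : ∀ t τ : ℝ, 0 < t → 0 < τ →
      ‖scalarKernel (c' τ) (ray ψ' τ) (ray ψ t)‖ ≤ δ⁻¹ * (‖G (ray ψ' τ)‖ / τ) := by
    intro t τ ht hτ
    have h1 : ‖(((c' τ * conj (ray ψ' τ)).im : ℝ) : ℂ) - (c' τ).im * ray ψ t‖ ≤
        ‖G (ray ψ' τ)‖ * (t + τ) := by
      refine (norm_sub_le _ _).trans ?_
      rw [norm_mul, Complex.norm_real, Complex.norm_real, norm_ray, abs_of_pos ht]
      have e1 := Complex.abs_im_le_norm (c' τ * conj (ray ψ' τ))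
      have e2 := Complex.abs_im_le_norm (c' τ)
      rw [norm_mul, RCLike.norm_conj, norm_ray, abs_of_pos hτ, hc'n] at e1
      rw [hc'n] at e2
      rw [Real.norm_eq_abs, Real.norm_eq_abs]
      have := mul_le_mul_of_nonneg_right e2 ht.le
      linarith
    rw [scalarKernel, norm_div]
    calc _ ≤ ‖G (ray ψ' τ)‖ * (t + τ) / (δ * (t + τ) ^ 2) := by
          gcongr
          exact hQ t τ ht hτ
      _ = δ⁻¹ * (‖G (ray ψ' τ)‖ / (t + τ)) := by field_simp
      _ ≤ _ := by gcongr; linarith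
  have hGc := hG.continuousOn_ray hθI hψ3'
  have hHc := hH.continuousOn_ray hθI hψ3
  have hkc : ContinuousOn (fun x : ℝ × ℝ => scalarKernel (c' x.2) (ray ψ' x.2) (ray ψ x.1))
      (Ioi 0 ×ˢ Ioi 0) := by
    have hc2 : ContinuousOn (fun x : ℝ × ℝ => c' x.2) (Ioi 0 ×ˢ Ioi 0) :=
      (continuousOn_const.mul hGc).comp continuousOn_snd fun x hx => hx.2
    have hr : Continuous (fun x : ℝ × ℝ => ray ψ x.1) := (continuous_ray ψ).comp continuous_fst
    have hr' : Continuous (fun x : ℝ × ℝ => ray ψ' x.2) := (continuous_ray ψ').comp continuous_snd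
    unfold scalarKernel
    refine ContinuousOn.div ?_ ?_ fun x hx => hQ0 _ _ hx.1 hx.2
    · exact (Complex.continuous_ofReal.comp_continuousOn (Complex.continuous_im.comp_continuousOn
        (hc2.mul (Complex.continuous_conj.comp hr').continuousOn))).sub
        ((Complex.continuous_ofReal.comp_continuousOn
          (Complex.continuous_im.comp_continuousOn hc2)).mul hr.continuousOn)
    · unfold quad
      refine Continuous.continuousOn ?_
      fun_prop
  set f : ℝ → ℝ → A := fun t τ => opKernel q p (Complex.exp (ψ * Complex.I) *
    (H (ray ψ t) * scalarKernel (c' τ) (ray ψ' τ) (ray ψ t))) (ray ψ t) with hf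
  have hfint : Integrable (Function.uncurry f)
      ((volume.restrict (Ioi (0 : ℝ))).prod (volume.restrict (Ioi (0 : ℝ)))) := by
    obtain ⟨C, hC0, hC⟩ := h.exists_norm_opKernel_le
    have hb := ((hH.integrable ψ hψ3).mul_prod (hG.integrable ψ' hψ3')).const_mul (C * δ⁻¹)
    refine Integrable.mono' hb ?_ ?_
    · rw [Measure.prod_restrict]
      refine ContinuousOn.aestronglyMeasurable ?_ (measurableSet_Ioi.prod measurableSet_Ioi)
      refine h.continuousOn_opKernel (continuousOn_const.mul (ContinuousOn.mul ?_ hkc))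
        ((continuous_ray ψ).comp continuous_fst).continuousOn
        fun x hx => ray_mem_cocone hω hψ1 hx.1
      exact hHc.comp continuousOn_fst fun x hx => hx.1
    · rw [Measure.prod_restrict, ae_restrict_iff' (measurableSet_Ioi.prod measurableSet_Ioi)]
      refine ae_of_all _ fun x hx => ?_
      obtain ⟨t, τ⟩ := x
      have ht : 0 < t := hx.1
      have hτ : 0 < τ := hx.2
      simp only [Function.uncurry, hf]
      have h1 := hC _ (ray_mem_cocone hω hψ1 ht) (Complex.exp (ψ * Complex.I) *
        (H (ray ψ t) * scalarKernel (c' τ) (ray ψ' τ) (ray ψ t)))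
      rw [norm_ray, abs_of_pos ht, norm_mul, Complex.norm_exp_ofReal_mul_I, one_mul, norm_mul] at h1
      have h2 := hk t τ ht hτ
      rw [mul_comm, ← le_div_iff₀ ht] at h1
      refine h1.trans ?_
      calc C * (‖H (ray ψ t)‖ * ‖scalarKernel (c' τ) (ray ψ' τ) (ray ψ t)‖) / t
          ≤ C * (‖H (ray ψ t)‖ * (δ⁻¹ * (‖G (ray ψ' τ)‖ / τ))) / t := by gcongr
        _ = _ := by ring
  have hinner : ∀ t ∈ Ioi (0 : ℝ), ∫ τ in Ioi (0 : ℝ), f t τ =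
      opKernel q p (Complex.exp (ψ * Complex.I) * (H (ray ψ t) *
        ∫ τ in Ioi (0 : ℝ), scalarKernel (c' τ) (ray ψ' τ) (ray ψ t))) (ray ψ t) := by
    intro t ht
    have hi : IntegrableOn (fun τ => scalarKernel (c' τ) (ray ψ' τ) (ray ψ t)) (Ioi 0) := by
      refine Integrable.mono' ((hG.integrable ψ' hψ3').const_mul δ⁻¹) ?_ ?_
      · refine ContinuousOn.aestronglyMeasurable ?_ measurableSet_Ioi
        exact hkc.comp (f := fun τ => (t, τ)) (Continuous.prodMk_right t).continuousOn
          fun τ hτ => ⟨ht, hτ⟩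
      · exact (ae_restrict_iff' measurableSet_Ioi).2 (ae_of_all _ fun τ hτ => hk t τ ht hτ)
    rw [← opKernelL_apply, ← mul_assoc, ← integral_const_mul,
      ← (opKernelL q p (ray ψ t)).integral_comp_comm (hi.const_mul _)]
    simp only [opKernelL_apply, hf, mul_assoc]
  refine ⟨IntegrableOn.congr_fun (f := fun t => ∫ τ in Ioi (0 : ℝ), f t τ)
    hfint.integral_prod_left hinner measurableSet_Ioi, ?_⟩
  have hGint := h.integrableOn_opKernel_hZero hω hθI hψ1' hψ3' hG
  conv_lhs => rw [rayPart.eq_def q p ψ' G, ← integral_const_mul_of_integrable hGint]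
  have houter : ∀ τ ∈ Ioi (0 : ℝ), rayPart q p ψ H * opKernel q p (c' τ) (ray ψ' τ) =
      ∫ t in Ioi (0 : ℝ), f t τ := by
    intro τ hτ
    exact h.rayPart_mul_opKernel hω hφ hα1 hα2 hφ'I.2 (by linarith) hθ hH hψ
      (ray_mem_cocone hω hψ1' hτ) (hbdry τ hτ) _
  rw [setIntegral_congr_fun measurableSet_Ioi houter, ← integral_integral_swap hfint,
    setIntegral_congr_fun measurableSet_Ioi hinner, rayPart]

/-- The functional calculus is multiplicative. -/
theorem holCalc_mul (hω : ω ∈ Ioo 0 (Real.pi / 2)) {φ θ : ℝ}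
    (hφ : φ ∈ Ioo ω θ) (hθ : θ < Real.pi / 2) {H G : ℂ → ℂ} (hH : HZero θ H) (hG : HZero θ G) :
    holCalc q p φ H * holCalc q p φ G = holCalc q p φ (fun z => H z * G z) := by
  have hω0 := hω.1
  -- The contour of `G` is moved outwards, so that Cauchy's formula can be evaluated at the points
  -- of the contour of `H`.
  obtain ⟨φ', h1, h2⟩ := exists_between hφ.2
  obtain ⟨α, hα1, hα2⟩ := exists_between h1
  have hφ1 := hφ.1
  have hθI : θ ∈ Ioo 0 (Real.pi / 2) := ⟨by linarith, hθ⟩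
  have hαI : α ∈ Ioo 0 (Real.pi / 2) := ⟨by linarith, by linarith⟩
  rw [h.holCalc_eq_of_le hω hθ hφ1 h1.le h2 hG]
  have key : ∀ ψ : ℝ, ψ = φ ∨ ψ = Real.pi - φ →
      rayPart q p ψ H * (rayPart q p (Real.pi - φ') G - rayPart q p φ' G) =
        Real.pi • rayPart q p ψ (fun z => H z * G z) := by
    intro ψ hψ
    obtain ⟨i1, e1⟩ := h.rayPart_mul_rayPart hω hφ1 h1 h2 hθ hH hG hψ (Or.inl rfl)
    obtain ⟨i2, e2⟩ := h.rayPart_mul_rayPart hω hφ1 h1 h2 hθ hH hG hψ (Or.inr rfl)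
    rw [mul_sub, e1, e2, rayPart, rayPart, rayPart, ← integral_sub i2 i1, ← integral_smul]
    refine setIntegral_congr_fun measurableSet_Ioi fun t ht => ?_
    have hz : ray ψ t ∈ csector α := by
      refine ray_mem_csector_of_mem_angles hαI ?_ ht
      rcases hψ with rfl | rfl
      · exact mem_angles_of_lt (by linarith) hα1
      · exact pi_sub_mem_angles_of_lt (by linarith) hα1
    -- Cauchy's formula collapses the inner integral to `π G z`.
    have := cauchy_scalarKernel hαI.1 hα2 h2 hθ hG hz
    simp only [← opKernelL_apply]
    rw [← map_sub, ← mul_sub, ← mul_sub, this, ← map_smul, Complex.real_smul]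
    congr 1
    ring
  rw [holCalc, holCalc, smul_mul_smul_comm, sub_mul, key _ (Or.inl rfl), key _ (Or.inr rfl),
    ← smul_sub, smul_smul, mul_assoc, inv_mul_cancel₀ Real.pi_ne_zero, mul_one, holCalc]

end ResolventPair

end Calculus

/-! ## The function `z (1 + z²)⁻¹` -/

/-- The difference of `z (z² - 1)⁻¹` and `kappa z`. -/
def kappaDiff (z : ℂ) : ℂ := kappa z * (2 / (z ^ 2 - 1))

/-- The zeros `±1` are real, hence separated from the cone around the imaginary axis. -/
theorem exists_sq_sub_one_ge {ω : ℝ} (hω : ω ∈ Ioo 0 (Real.pi / 2)) :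
    ∃ δ : ℝ, 0 < δ ∧ ∀ z ∈ cocone ω, δ * (‖z‖ + 1) ^ 2 ≤ ‖z ^ 2 - 1‖ := by
  obtain ⟨α, h1, h2⟩ := exists_between hω.1
  obtain ⟨δ, hδ, h⟩ := exists_dist_cones h1 h2 hω.2
  have hs : 0 ≤ Real.sin α := Real.sin_nonneg_of_nonneg_of_le_pi h1.le (by linarith [hω.2])
  refine ⟨δ ^ 2, by positivity, fun z hz => ?_⟩
  have e1 := h 1 z (by simpa using hs) (le_of_lt hz)
  have e2 := h (-1) z (by simpa using hs) (le_of_lt hz)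
  rw [norm_neg, norm_one] at e2
  rw [norm_one] at e1
  have e3 : z ^ 2 - 1 = (1 - z) * (-1 - z) := by ring
  rw [e3, norm_mul]
  calc δ ^ 2 * (‖z‖ + 1) ^ 2 = δ * (1 + ‖z‖) * (δ * (1 + ‖z‖)) := by ring
    _ ≤ _ := by gcongr

theorem sq_sub_one_ne_zero {ω : ℝ} (hω : ω ∈ Ioo 0 (Real.pi / 2)) {z : ℂ} (hz : z ∈ cocone ω) :
    z ^ 2 - 1 ≠ 0 := by
  obtain ⟨δ, hδ, h⟩ := exists_sq_sub_one_ge hω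
  exact norm_pos_iff.1 (lt_of_lt_of_le (by positivity) (h z hz))

theorem integrableOn_kappaDiff {ω θ ψ : ℝ} (hω : ω ∈ Ioo 0 (Real.pi / 2))
    (hθ : θ ∈ Ioo 0 (Real.pi / 2)) (hψ : ψ ∈ Ioo ω (Real.pi - ω)) (hψ' : ψ ∈ angles θ) :
    IntegrableOn (fun t => kappaDiff (ray ψ t)) (Ioi 0) := by
  obtain ⟨δ, hδ, h⟩ := exists_sq_sub_one_ge hω
  have hκ := hZero_kappa hθ
  refine Integrable.mono' ((hκ.integrable ψ hψ').const_mul (2 * δ⁻¹)) ?_ ?_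
  · refine ContinuousOn.aestronglyMeasurable ?_ measurableSet_Ioi
    refine (hκ.continuousOn_ray hθ hψ').mul (continuousOn_const.div ?_ fun t ht =>
      sq_sub_one_ne_zero hω (ray_mem_cocone hω hψ ht))
    exact (((continuous_ray ψ).pow 2).sub continuous_const).continuousOn
  · refine (ae_restrict_iff' measurableSet_Ioi).2 (ae_of_all _ fun t ht => ?_)
    have ht' : 0 < t := ht
    have h1 := h _ (ray_mem_cocone hω hψ ht)
    rw [norm_ray, abs_of_pos ht'] at h1
    rw [kappaDiff, norm_mul, norm_div, Complex.norm_ofNat]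
    calc ‖kappa (ray ψ t)‖ * (2 / ‖ray ψ t ^ 2 - 1‖) ≤ ‖kappa (ray ψ t)‖ * (2 / (δ * t)) := by
          gcongr
          refine le_trans ?_ h1
          gcongr
          nlinarith
      _ = _ := by field_simp

/-- As `kappaDiff z = 2 z / (z⁴ - 1)`, the substitution `y = t ^ 2` doubles the angle of the ray and
leaves an integral of the type already evaluated by logarithms. -/
theorem integral_kappaDiff {ω θ ψ : ℝ} (hω : ω ∈ Ioo 0 (Real.pi / 2))
    (hθ : θ ∈ Ioo 0 (Real.pi / 2)) (hψ : ψ ∈ Ioo ω (Real.pi - ω)) (hψ' : ψ ∈ angles θ) :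
    ∫ t in Ioi (0 : ℝ), Complex.exp (ψ * Complex.I) * kappaDiff (ray ψ t) =
      2⁻¹ * ∫ y in Ioi (0 : ℝ), Complex.exp ((2 * ψ : ℝ) * Complex.I) *
        (2 * 1 / ((y * Complex.exp ((2 * ψ : ℝ) * Complex.I)) ^ 2 - 1 ^ 2)) := by
  set v := Complex.exp ((2 * ψ : ℝ) * Complex.I) with hv
  have hv2 : v = Complex.exp (ψ * Complex.I) ^ 2 := by
    rw [hv, ← Complex.exp_nat_mul]; congr 1; push_cast; ring
  rw [← integral_const_mul]
  refine Eq.symm ((integral_comp_rpow_Ioi_of_pos (p := 2) two_pos).symm.trans ?_)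
  refine setIntegral_congr_fun measurableSet_Ioi fun t ht => ?_
  have e1 := sq_sub_one_ne_zero hω (ray_mem_cocone hω hψ ht)
  have e2 := one_add_sq_ne_zero hθ (ray_mem_csector_of_mem_angles hθ hψ' ht)
  have e3 : ((t ^ (2 : ℝ) : ℝ) : ℂ) * v = ray ψ t ^ 2 := by
    rw [hv2, ray, mul_pow]; norm_num
  have e4 : (ray ψ t ^ 2) ^ 2 - 1 ^ 2 = (ray ψ t ^ 2 - 1) * (1 + ray ψ t ^ 2) := by ring
  simp only [e3, e4, kappaDiff, kappa]
  rw [show (2 : ℝ) - 1 = 1 by norm_num, Real.rpow_one, Complex.real_smul, hv2]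
  field_simp
  rw [ray]
  push_cast
  ring

section Calculus

variable {A : Type*} [NormedRing A] [NormedAlgebra ℝ A] [CompleteSpace A]

theorem I_mem_cocone {ω : ℝ} (hω : ω ∈ Ioo 0 (Real.pi / 2)) : Complex.I ∈ cocone ω := by
  simpa [cocone] using Real.cos_pos_of_mem_Ioo ⟨by linarith [hω.1, Real.pi_pos], hω.2⟩

namespace ResolventPair

variable {ω : ℝ} {q p : ℂ → A} (h : ResolventPair ω q p)

include h

omit [CompleteSpace A] in
-- This is `opKernel_quad_mul_p` at `μ = I`, divided by `1 + z²`. The term with `z / (z² - 1)` makes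
-- the left side integrable along the contour rays: it cancels the `1 / z` behaviour at infinity
-- without creating a singularity at `0`.
theorem opKernel_kappa (hω : ω ∈ Ioo 0 (Real.pi / 2)) {z : ℂ} (hz : z ∈ cocone ω)
    (hz' : 1 + z ^ 2 ≠ 0) (c : ℂ) :
    opKernel q p c z * p Complex.I - (c * (z / (z ^ 2 - 1))).im • p Complex.I =
      opKernel q p (c * kappa z) z - (c * kappaDiff z).im • p Complex.I
        - (c * rho z).im • q Complex.I := by
  have e0 := sq_sub_one_ne_zero hω hz
  have := h.opKernel_quad_mul_p hz (I_mem_cocone hω) (c * rho z)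
  rw [quad_I] at this
  have e1 : c * rho z * (1 + z ^ 2) = c := by rw [rho]; field_simp
  have e2 : c * rho z * z = c * kappa z := by rw [rho, kappa]; ring
  have e3 : c * kappaDiff z = c * (z / (z ^ 2 - 1)) - c * kappa z := by
    rw [kappaDiff, kappa]; field_simp; ring
  rw [e1, e2, Complex.norm_I] at this
  rw [this, e3, Complex.sub_im]
  module

/-- By `opKernel_kappa` the integrand for `κ` splits into three parts. The remainder `B` is
holomorphic in the whole cone around the imaginary axis, so its integrals over the rays of angles
`φ` and `π - φ` agree and cancel. The integral of `ρ` has no imaginary part. Only `kappaDiff` is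
left, and its two explicit integrals give the coefficient `1` of `p I`. -/
theorem holCalc_kappa (hω : ω ∈ Ioo 0 (Real.pi / 2)) {φ θ : ℝ}
    (hφ : φ ∈ Ioo ω θ) (hθ : θ < Real.pi / 2) : holCalc q p φ kappa = p Complex.I := by
  have hω0 := hω.1
  have hφ1 := hφ.1
  have hφ2 := hφ.2
  have hθI : θ ∈ Ioo 0 (Real.pi / 2) := ⟨by linarith, hθ⟩
  have hκ := hZero_kappa hθI
  have hψ1 : ∀ ψ, (ψ = φ ∨ ψ = Real.pi - φ) → ψ ∈ Ioo ω (Real.pi - ω) := by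
    rintro ψ (rfl | rfl) <;> constructor <;> linarith
  have hψ2 : ∀ ψ, (ψ = φ ∨ ψ = Real.pi - φ) → ψ ∈ angles θ := by
    rintro ψ (rfl | rfl)
    · exact mem_angles_of_lt (by linarith) hφ2
    · exact pi_sub_mem_angles_of_lt (by linarith) hφ2
  -- the function `rho`
  have hrho : ∀ ψ, (ψ = φ ∨ ψ = Real.pi - φ) → IntegrableOn (fun t => rho (ray ψ t)) (Ioi 0) ∧
      (∫ t in Ioi (0 : ℝ), Complex.exp (ψ * Complex.I) * rho (ray ψ t)).im = 0 := by
    intro ψ hψ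
    obtain ⟨i, e⟩ := im_integral_ray_eq_zero (hω0.trans hφ1) hφ2 le_rfl hθ hκ (m := fun z => 1 / z)
      (M := 1) ((differentiableOn_const 1).div differentiableOn_id
        fun z hz => ne_zero_of_mem_csector hz) (fun z _ => by simp)
      (fun z hz => by
        have := norm_ne_zero_iff.2 (ne_zero_of_mem_csector hz)
        rw [norm_div, norm_one, mul_one_div_cancel this]) hψ
    have heq : ∀ t ∈ Ioi (0 : ℝ), kappa (ray ψ t) * (1 / ray ψ t) = rho (ray ψ t) := by
      intro t ht
      have := ne_zero_of_mem_csector (ray_mem_csector_of_mem_angles hθI (hψ2 ψ hψ) ht)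
      rw [kappa, rho]; field_simp
    refine ⟨i.congr_fun heq measurableSet_Ioi, ?_⟩
    refine (congrArg Complex.im (setIntegral_congr_fun measurableSet_Ioi fun t ht => ?_)).trans e
    simp only [heq t ht]
  have hD := fun ψ hψ => integrableOn_kappaDiff hω hθI (hψ1 ψ hψ) (hψ2 ψ hψ)
  -- the remainder
  set B : ℂ → ℂ → A := fun c z => opKernel q p c z * p Complex.I -
    (c * (z / (z ^ 2 - 1))).im • p Complex.I with hB
  have hBeq : ∀ ψ, (ψ = φ ∨ ψ = Real.pi - φ) → ∀ c : ℂ, ∀ t ∈ Ioi (0 : ℝ), B c (ray ψ t) =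
      opKernel q p (c * kappa (ray ψ t)) (ray ψ t) - (c * kappaDiff (ray ψ t)).im • p Complex.I
        - (c * rho (ray ψ t)).im • q Complex.I := fun ψ hψ c t ht =>
    h.opKernel_kappa hω (ray_mem_cocone hω (hψ1 ψ hψ) ht)
      (one_add_sq_ne_zero hθI (ray_mem_csector_of_mem_angles hθI (hψ2 ψ hψ) ht)) c
  have hκint : ∀ ψ, (ψ = φ ∨ ψ = Real.pi - φ) → ∀ c : ℂ,
      IntegrableOn (fun t => opKernel q p (c * kappa (ray ψ t)) (ray ψ t)) (Ioi 0) := by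
    intro ψ hψ c
    have h1 := h.integrableOn_opKernel hω (hψ1 ψ hψ)
      (F := fun z => Complex.exp (-(ψ * Complex.I)) * c * kappa z)
      (continuousOn_const.mul (hκ.continuousOn_ray hθI (hψ2 ψ hψ))) (by
        have := (hκ.integrable ψ (hψ2 ψ hψ)).const_mul ‖Complex.exp (-(ψ * Complex.I)) * c‖
        refine this.congr (ae_of_all _ fun t => ?_)
        simp only [norm_mul]
        ring)
    refine h1.congr (ae_of_all _ fun t => ?_)
    simp only [← mul_assoc, ← Complex.exp_add]
    simp
  have j1 : ∀ ψ, (ψ = φ ∨ ψ = Real.pi - φ) → ∀ c : ℂ,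
      IntegrableOn (fun t => (c * kappaDiff (ray ψ t)).im • p Complex.I) (Ioi 0) := fun ψ hψ c =>
    Integrable.smul_const (((hD ψ hψ).const_mul c).im) _
  have j2 : ∀ ψ, (ψ = φ ∨ ψ = Real.pi - φ) → ∀ c : ℂ,
      IntegrableOn (fun t => (c * rho (ray ψ t)).im • q Complex.I) (Ioi 0) := fun ψ hψ c =>
    Integrable.smul_const (((hrho ψ hψ).1.const_mul c).im) _
  have hBint : ∀ ψ, (ψ = φ ∨ ψ = Real.pi - φ) → ∀ c : ℂ,
      IntegrableOn (fun t => B c (ray ψ t)) (Ioi 0) := fun ψ hψ c =>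
    (((hκint ψ hψ c).sub (j1 ψ hψ c)).sub (j2 ψ hψ c)).congr_fun
      (fun t ht => (hBeq ψ hψ c t ht).symm) measurableSet_Ioi
  have m1 : φ = φ ∨ φ = Real.pi - φ := Or.inl rfl
  have m2 : Real.pi - φ = φ ∨ Real.pi - φ = Real.pi - φ := Or.inr rfl
  -- No factor defined only on the sector occurs in `B`, so the ray may be rotated across the
  -- imaginary axis.
  have hrot : ∫ t in Ioi (0 : ℝ), B (Complex.exp (φ * Complex.I)) (ray φ t) =
      ∫ t in Ioi (0 : ℝ), B (Complex.exp ((Real.pi - φ : ℝ) * Complex.I)) (ray (Real.pi - φ) t) := by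
    rw [SeparatingDual.eq_iff_forall_dual_eq (R := ℝ)]
    intro l
    set l' : StrongDual ℝ A := l ∘L (ContinuousLinearMap.mul ℝ A).flip (p Complex.I) with hl'
    set r : ℂ → ℂ := fun z => (conj z * (l' (q z) : ℂ) - (l' (p z) : ℂ)) -
      z / (z ^ 2 - 1) * (l (p Complex.I) : ℂ) with hr
    have hlB : ∀ c z : ℂ, l (B c z) = (c * r z).im := by
      intro c z
      have e1 : l (opKernel q p c z * p Complex.I) = l' (opKernel q p c z) := by simp [hl']
      have e2 : l (B c z) = l (opKernel q p c z * p Complex.I) -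
          (c * (z / (z ^ 2 - 1))).im * l (p Complex.I) := by simp [hB]
      rw [e2, e1, dual_opKernel]
      simp only [hr]
      rw [mul_sub c (conj z * _ - _), Complex.sub_im, ← mul_assoc c (z / (z ^ 2 - 1)),
        Complex.im_mul_ofReal]
    have hrd : DifferentiableOn ℂ r (cocone ω) := by
      refine (h.differentiableOn_dual_resolvent l').sub
        ((DifferentiableOn.div differentiableOn_id (by fun_prop)
          fun z hz => sq_sub_one_ne_zero hω hz).mul_const _)
    -- The choices `c = I` and `c = 1` recover the real and the imaginary part of `r` from the
    -- tested kernel.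
    have hri : ∀ ψ, (ψ = φ ∨ ψ = Real.pi - φ) → IntegrableOn (fun t => r (ray ψ t)) (Ioi 0) := by
      intro ψ hψ
      have i1 := (l.integrable_comp (hBint ψ hψ Complex.I)).ofReal (𝕜 := ℂ)
      have i2 := ((l.integrable_comp (hBint ψ hψ 1)).ofReal (𝕜 := ℂ)).const_mul Complex.I
      refine (i1.add i2).congr (ae_of_all _ fun t => ?_)
      simp only [Pi.add_apply, hlB]
      apply Complex.ext <;> simp
    obtain ⟨C, hC⟩ := h.bound
    obtain ⟨δ, hδ, hδb⟩ := exists_sq_sub_one_ge hω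
    have hrb : ∀ z ∈ cocone ω, ‖z‖ * ‖r z‖ ≤ ‖l'‖ * (C + C) + δ⁻¹ * ‖l (p Complex.I)‖ := by
      intro z hz
      obtain ⟨c1, c2⟩ := hC z hz
      have e0 : ‖z / (z ^ 2 - 1)‖ * ‖z‖ ≤ δ⁻¹ := by
        have hb := hδb z hz
        have hpos : 0 < ‖z ^ 2 - 1‖ := norm_pos_iff.2 (sq_sub_one_ne_zero hω hz)
        rw [norm_div, div_mul_eq_mul_div, div_le_iff₀ hpos, inv_mul_eq_div, le_div_iff₀ hδ]
        refine le_trans ?_ hb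
        rw [mul_comm]
        gcongr
        nlinarith [norm_nonneg z]
      have e : ‖r z‖ ≤ (‖z‖ * (‖l'‖ * ‖q z‖) + ‖l'‖ * ‖p z‖) +
          ‖z / (z ^ 2 - 1)‖ * ‖l (p Complex.I)‖ := by
        refine (norm_sub_le _ _).trans (add_le_add ((norm_sub_le _ _).trans ?_) ?_)
        · rw [norm_mul, RCLike.norm_conj, Complex.norm_real, Complex.norm_real]
          gcongr <;> exact l'.le_opNorm _
        · rw [norm_mul, Complex.norm_real]
      calc ‖z‖ * ‖r z‖ ≤ ‖z‖ * ((‖z‖ * (‖l'‖ * ‖q z‖) + ‖l'‖ * ‖p z‖) +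
            ‖z / (z ^ 2 - 1)‖ * ‖l (p Complex.I)‖) := by gcongr
        _ = ‖l'‖ * (‖z‖ ^ 2 * ‖q z‖ + ‖z‖ * ‖p z‖) +
            ‖z / (z ^ 2 - 1)‖ * ‖z‖ * ‖l (p Complex.I)‖ := by ring
        _ ≤ _ := by gcongr
    have hv : ∀ ψ, (ψ = φ ∨ ψ = Real.pi - φ) →
        l (∫ t in Ioi (0 : ℝ), B (Complex.exp (ψ * Complex.I)) (ray ψ t)) =
        (∫ t in Ioi (0 : ℝ), Complex.exp (ψ * Complex.I) * r (ray ψ t)).im := by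
      intro ψ hψ
      rw [← im_setIntegral ((hri ψ hψ).const_mul _), ← l.integral_comp_comm (hBint ψ hψ _)]
      simp only [hlB]
    rw [hv φ m1, hv _ m2]
    congr 1
    refine integral_ray_eq (by linarith) (isOpen_cocone ω) hrd (fun ψ hψ t ht =>
      ray_mem_cocone hω ⟨by linarith [hψ.1], by linarith [hψ.2]⟩ ht)
      (M := ‖l'‖ * (C + C) + δ⁻¹ * ‖l (p Complex.I)‖) (fun ψ hψ t ht => ?_) (hri φ m1) (hri _ m2)
    have := hrb _ (ray_mem_cocone hω (ψ := ψ) ⟨by linarith [hψ.1], by linarith [hψ.2]⟩ ht)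
    rwa [norm_ray, abs_of_pos ht] at this
  have hpart : ∀ ψ, (ψ = φ ∨ ψ = Real.pi - φ) → rayPart q p ψ kappa =
      (∫ t in Ioi (0 : ℝ), B (Complex.exp (ψ * Complex.I)) (ray ψ t)) +
      (∫ t in Ioi (0 : ℝ), Complex.exp (ψ * Complex.I) * kappaDiff (ray ψ t)).im • p Complex.I := by
    intro ψ hψ
    have e : ∫ t in Ioi (0 : ℝ), B (Complex.exp (ψ * Complex.I)) (ray ψ t) =
        rayPart q p ψ kappa -
        (∫ t in Ioi (0 : ℝ), Complex.exp (ψ * Complex.I) * kappaDiff (ray ψ t)).im • p Complex.I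
        - (∫ t in Ioi (0 : ℝ), Complex.exp (ψ * Complex.I) * rho (ray ψ t)).im • q Complex.I := by
      have j12 : IntegrableOn (fun t => opKernel q p (Complex.exp (ψ * Complex.I) *
          kappa (ray ψ t)) (ray ψ t) -
          (Complex.exp (ψ * Complex.I) * kappaDiff (ray ψ t)).im • p Complex.I) (Ioi 0) :=
        (hκint ψ hψ _).sub (j1 ψ hψ _)
      rw [setIntegral_congr_fun measurableSet_Ioi (hBeq ψ hψ _),
        integral_sub j12 (j2 ψ hψ _), integral_sub (hκint ψ hψ _) (j1 ψ hψ _),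
        integral_smul_const, integral_smul_const, im_setIntegral ((hD ψ hψ).const_mul _),
        im_setIntegral ((hrho ψ hψ).1.const_mul _), rayPart]
    rw [e, (hrho ψ hψ).2]
    module
  rw [holCalc, hpart φ m1, hpart _ m2, hrot, add_sub_add_left_eq_sub, ← sub_smul,
    integral_kappaDiff hω hθI (hψ1 _ m1) (hψ2 _ m1),
    integral_kappaDiff hω hθI (hψ1 _ m2) (hψ2 _ m2)]
  have s1 : 0 < Real.sin (2 * φ) := Real.sin_pos_of_pos_of_lt_pi (by linarith) (by linarith)
  have s2 : Real.sin (2 * (Real.pi - φ)) < 0 := by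
    rw [show 2 * (Real.pi - φ) = 2 * Real.pi - 2 * φ by ring, Real.sin_two_pi_sub]
    linarith
  rw [integral_two_mul_div_of_pos (Complex.norm_exp_ofReal_mul_I (2 * φ))
      (by rw [map_one, mul_one, Complex.exp_ofReal_mul_I_im]; exact s1),
    integral_two_mul_div_of_neg (Complex.norm_exp_ofReal_mul_I (2 * (Real.pi - φ)))
      (by rw [map_one, mul_one, Complex.exp_ofReal_mul_I_im]; exact s2), smul_smul]
  have : Real.pi⁻¹ * ((2⁻¹ * (Real.pi * Complex.I) : ℂ).im -
      (2⁻¹ * -(Real.pi * Complex.I) : ℂ).im) = 1 := by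
    have := Real.pi_ne_zero
    simp
    field_simp
    norm_num
  rw [this, one_smul]

end ResolventPair

/-! ## The extended calculus for intrinsic functions -/

/-- The bounded operator `X` is `F(T)`, for a function `F` with real limits at `0` and `∞`. -/
def IsExt (q p : ℂ → A) (θ φ : ℝ) (F : ℂ → ℂ) (X : A) : Prop :=
  ∃ (a₀ a : ℝ) (F' : ℂ → ℂ), HZero θ F' ∧
    (∀ z ∈ csector θ, F z = a + (a₀ - a) * rho z + F' z) ∧
    X = a • (1 : A) + (a₀ - a) • q Complex.I + holCalc q p φ F'

omit [CompleteSpace A] in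
-- Two representations of one function have the same constants by `HZero.const_unique`, hence the
-- same decaying part. This makes identities between functions into identities between operators.
theorem IsExt.unique {q p : ℂ → A} {θ φ : ℝ} (hφ : φ ∈ Ioo 0 θ) (hθ : θ < Real.pi / 2) {F G : ℂ → ℂ}
    {X Y : A} (hX : IsExt q p θ φ F X) (hY : IsExt q p θ φ G Y)
    (hFG : ∀ z ∈ csector θ, F z = G z) : X = Y := by
  have hθI : θ ∈ Ioo 0 (Real.pi / 2) := ⟨hφ.1.trans hφ.2, hθ⟩
  obtain ⟨a₀, a, F', hF', hF, rfl⟩ := hX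
  obtain ⟨b₀, b, G', hG', hG, rfl⟩ := hY
  have hd : HZero θ fun z => F' z + ((-1 : ℝ) : ℂ) * G' z := hF'.add hθI (hG'.const_mul hθI (-1))
  obtain ⟨e1, e2⟩ := hd.const_unique hθI (a := a - b) (b := (a₀ - a) - (b₀ - b)) (by
    intro z hz
    have := hFG z hz
    rw [hF z hz, hG z hz] at this
    push_cast
    linear_combination this)
  have ea : a = b := by linarith
  have ea0 : a₀ = b₀ := by linarith
  subst ea ea0
  congr 1
  refine holCalc_congr hθ hφ q p fun z hz => ?_
  have := hFG z hz
  rw [hF z hz, hG z hz] at this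
  linear_combination this

namespace ResolventPair

variable {ω : ℝ} {q p : ℂ → A} (h : ResolventPair ω q p)

include h

/-- `q I` is the operator kernel with `c = -1` at `μ = I`, and the corresponding scalar kernel is
`ρ`. -/
theorem holCalc_mul_q (hω : ω ∈ Ioo 0 (Real.pi / 2)) {φ θ : ℝ}
    (hφ : φ ∈ Ioo ω θ) (hθ : θ < Real.pi / 2) {H : ℂ → ℂ} (hH : HZero θ H) :
    holCalc q p φ H * q Complex.I = holCalc q p φ (fun z => rho z * H z) := by
  have hω0 := hω.1
  have hφ1 := hφ.1
  have hφ2 := hφ.2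
  obtain ⟨β, hβ1, hβ2⟩ := exists_between hθ
  have hc : 0 ≤ Real.cos β := Real.cos_nonneg_of_mem_Icc ⟨by linarith, hβ2.le⟩
  have e1 : q Complex.I = opKernel q p (-1) Complex.I := by simp [opKernel]
  have e2 : ∀ z, scalarKernel (-1) Complex.I z = rho z := by
    intro z; rw [scalarKernel, quad_I, rho]; simp
  have key : ∀ ψ, (ψ = φ ∨ ψ = Real.pi - φ) → rayPart q p ψ H * q Complex.I =
      rayPart q p ψ (fun z => rho z * H z) := by
    intro ψ hψ
    rw [e1, h.rayPart_mul_opKernel hω hφ1 hφ2 hβ1 hβ2 le_rfl hθ hH hψ (I_mem_cocone hω)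
      (by simpa using hc)]
    simp only [e2, mul_comm]
  rw [holCalc, smul_mul_assoc, sub_mul, key _ (Or.inl rfl), key _ (Or.inr rfl), holCalc]

theorem q_mul_holCalc (hω : ω ∈ Ioo 0 (Real.pi / 2)) {φ θ : ℝ}
    (hφ : φ ∈ Ioo ω θ) (hθ : θ < Real.pi / 2) {H : ℂ → ℂ} (hH : HZero θ H) :
    q Complex.I * holCalc q p φ H = holCalc q p φ (fun z => rho z * H z) := by
  rw [← h.holCalc_mul_q hω hφ hθ hH]
  have hω0 := hω.1
  have hφ1 := hφ.1
  have hφ2 := hφ.2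
  have hθI : θ ∈ Ioo 0 (Real.pi / 2) := ⟨by linarith, hθ⟩
  have key : ∀ ψ ∈ Ioo ω (Real.pi - ω), ψ ∈ angles θ →
      q Complex.I * rayPart q p ψ H = rayPart q p ψ H * q Complex.I := by
    intro ψ h1 h2
    have hi := h.integrableOn_opKernel_hZero hω hθI h1 h2 hH
    rw [rayPart, ← integral_const_mul_of_integrable hi, ← integral_mul_const_of_integrable hi]
    refine setIntegral_congr_fun measurableSet_Ioi fun t ht => ?_
    have hz := ray_mem_cocone hω h1 ht
    simp only [opKernel, mul_sub, sub_mul, mul_smul_comm, smul_mul_assoc,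
      h.q_mul_q _ (I_mem_cocone hω) _ hz, h.q_mul_p _ (I_mem_cocone hω) _ hz]
  rw [holCalc, smul_mul_assoc, mul_smul_comm, sub_mul, mul_sub,
    key φ ⟨hφ1, by linarith⟩ (mem_angles_of_lt (by linarith) hφ2),
    key (Real.pi - φ) ⟨by linarith, by linarith⟩ (pi_sub_mem_angles_of_lt (by linarith) hφ2)]

/-- The only product that leaves the given form is `ρ²`. It is rewritten as `ρ - κ²`, where `κ²`
decays; on the operator side this matches `p I * p I = q I - q I * q I`, because `κ` is sent to `p
I`. -/
theorem isExt_mul (hω : ω ∈ Ioo 0 (Real.pi / 2)) {φ θ : ℝ}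
    (hφ : φ ∈ Ioo ω θ) (hθ : θ < Real.pi / 2) {F G : ℂ → ℂ} {X Y : A}
    (hX : IsExt q p θ φ F X) (hY : IsExt q p θ φ G Y) :
    IsExt q p θ φ (fun z => F z * G z) (X * Y) := by
  have hω0 := hω.1
  have hφ1 := hφ.1
  have hφ2 := hφ.2
  have hθI : θ ∈ Ioo 0 (Real.pi / 2) := ⟨by linarith, hθ⟩
  obtain ⟨a₀, a, f, hf, hF, rfl⟩ := hX
  obtain ⟨b₀, b, g, hg, hG, rfl⟩ := hY
  set c := a₀ - a with hc
  set d := b₀ - b with hd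
  have hκ := hZero_kappa hθI
  have k1 := (hκ.mul_hZero hθI hκ).const_mul hθI (-(c * d))
  have k2 := hg.const_mul hθI a
  have k3 := hf.const_mul hθI b
  have k4' := (hBdd_rho hθI).mul_hZero hθI hg
  have k4 := k4'.const_mul hθI c
  have k5' := (hBdd_rho hθI).mul_hZero hθI hf
  have k5 := k5'.const_mul hθI d
  have k6 := hf.mul_hZero hθI hg
  have s2 := k1.add hθI k2
  have s3 := s2.add hθI k3
  have s4 := s3.add hθI k4
  have s5 := s4.add hθI k5
  have s6 := s5.add hθI k6
  refine ⟨a₀ * b₀, a * b, _, s6, fun z hz => ?_, ?_⟩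
  · have hρ : kappa z * kappa z = rho z - rho z * rho z := by
      have := one_add_sq_ne_zero hθI hz
      rw [kappa, rho]; field_simp; ring
    change F z * G z = _
    rw [hF z hz, hG z hz, hρ, hc, hd]
    push_cast
    ring
  · rw [h.holCalc_add hω hθ hφ s5 k6, h.holCalc_add hω hθ hφ s4 k5, h.holCalc_add hω hθ hφ s3 k4,
      h.holCalc_add hω hθ hφ s2 k3, h.holCalc_add hω hθ hφ k1 k2]
    simp only [holCalc_const_mul]
    rw [← h.holCalc_mul hω hφ hθ hκ hκ, h.holCalc_kappa hω hφ hθ,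
      ← h.holCalc_mul_q hω hφ hθ hf, ← h.q_mul_holCalc hω hφ hθ hg, ← h.holCalc_mul hω hφ hθ hf hg,
      h.p_mul_p _ (I_mem_cocone hω) _ (I_mem_cocone hω)]
    rw [show a₀ * b₀ - a * b = a * d + b * c + c * d by rw [hc, hd]; ring]
    simp only [add_mul, mul_add, smul_mul_assoc, mul_smul_comm, one_mul, mul_one, Complex.I_re,
      Complex.norm_I]
    module

end ResolventPair

end Calculus

/-! ## Clifford algebra -/

/-- Common indices contribute `f i * f i = 1`. This makes `cliffordSign` multiplicative in each
argument with respect to symmetric difference, which is what associativity needs. -/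
theorem prod_symmDiff_of_mul_self {ι : Type*} [DecidableEq ι] {M : Type*} [CommMonoid M]
    {f : ι → M} (hf : ∀ i, f i * f i = 1) (A B : Finset ι) :
    ∏ i ∈ symmDiff A B, f i = (∏ i ∈ A, f i) * ∏ i ∈ B, f i := by
  have h1 : ∏ i ∈ A, f i = (∏ i ∈ A \ B, f i) * ∏ i ∈ A ∩ B, f i := by
    rw [← Finset.prod_sdiff (Finset.inter_subset_left : A ∩ B ⊆ A), Finset.sdiff_inter_self_left]
  have h2 : ∏ i ∈ B, f i = (∏ i ∈ B \ A, f i) * ∏ i ∈ A ∩ B, f i := by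
    rw [← Finset.prod_sdiff (Finset.inter_subset_right : A ∩ B ⊆ B), Finset.sdiff_inter_self_right]
  have h3 : (∏ i ∈ A ∩ B, f i) * ∏ i ∈ A ∩ B, f i = 1 := by
    rw [← Finset.prod_mul_distrib]; simp [hf]
  have h4 : ∏ i ∈ symmDiff A B, f i = (∏ i ∈ A \ B, f i) * ∏ i ∈ B \ A, f i := by
    rw [symmDiff_def]
    exact Finset.prod_union (Finset.disjoint_left.2 fun x hx hx' => by
      simp only [Finset.mem_sdiff] at hx hx'; exact hx.2 hx'.1)
  rw [h4, h1, h2, mul_mul_mul_comm, h3, mul_one]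

section Sign

variable {n : ℕ}

theorem cliffordSign_eq_prod (A B : Finset (Fin n)) :
    cliffordSign A B = ∏ i ∈ A, ∏ j ∈ B, if j ≤ i then (-1 : ℝ) else 1 := by
  rw [cliffordSign, ← Finset.prod_product', Finset.prod_ite]
  simp

theorem ite_mul_self (P : Prop) [Decidable P] :
    (if P then (-1 : ℝ) else 1) * (if P then (-1 : ℝ) else 1) = 1 := by
  split_ifs <;> norm_num

theorem cliffordSign_symmDiff_left (A B C : Finset (Fin n)) :
    cliffordSign (symmDiff A B) C = cliffordSign A C * cliffordSign B C := by
  simp only [cliffordSign_eq_prod]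
  exact prod_symmDiff_of_mul_self (fun i => by
    rw [← Finset.prod_mul_distrib]; simp only [ite_mul_self, Finset.prod_const_one]) A B

theorem cliffordSign_symmDiff_right (A B C : Finset (Fin n)) :
    cliffordSign A (symmDiff B C) = cliffordSign A B * cliffordSign A C := by
  simp only [cliffordSign_eq_prod]
  rw [← Finset.prod_mul_distrib]
  exact Finset.prod_congr rfl fun i _ => prod_symmDiff_of_mul_self (fun j => ite_mul_self _) B C

theorem cliffordSign_empty_left (A : Finset (Fin n)) : cliffordSign ∅ A = 1 := by
  simp [cliffordSign]

theorem cliffordSign_empty_right (A : Finset (Fin n)) : cliffordSign A ∅ = 1 := by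
  simp [cliffordSign]

end Sign

section Module

variable {n : ℕ} {W : Type*} [NormedAddCommGroup W] [NormedSpace ℝ W]

/-- After the substitution of `A ∆ B` for the summation index, the coefficients agree by
multiplicativity of the sign in both arguments. The case `W = ℝ` is associativity of the Clifford
product. -/
theorem leftMul_mul_apply (a b : Cl n) (v : CliffordModule n W) :
    leftMul (a * b) v = leftMul a (leftMul b v) := by
  ext C
  rw [leftMul_apply, leftMul_apply]
  have h1 : ∀ D : Finset (Fin n), (a * b) D =
      ∑ A : Finset (Fin n), cliffordSign A (symmDiff A D) * a A * b (symmDiff A D) := by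
    intro D
    change leftMul a b D = _
    rw [leftMul_apply]
    simp only [smul_eq_mul]
  simp only [h1, leftMul_apply, Finset.mul_sum, Finset.sum_smul, Finset.smul_sum]
  rw [Finset.sum_comm]
  refine Finset.sum_congr rfl fun A _ => ?_
  let e : Finset (Fin n) ≃ Finset (Fin n) :=
    ⟨fun B => symmDiff A B, fun B => symmDiff A B, fun B => symmDiff_symmDiff_cancel_left A B,
      fun B => symmDiff_symmDiff_cancel_left A B⟩
  rw [← Equiv.sum_comp e]
  refine Finset.sum_congr rfl fun B _ => ?_
  change (cliffordSign (symmDiff A B) (symmDiff (symmDiff A B) C) *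
    (cliffordSign A (symmDiff A (symmDiff A B)) * a A * b (symmDiff A (symmDiff A B)))) •
      v (symmDiff (symmDiff A B) C) = _
  have e1 : symmDiff (symmDiff A B) C = symmDiff B (symmDiff A C) := by
    rw [symmDiff_comm A B, symmDiff_assoc]
  rw [symmDiff_symmDiff_cancel_left, e1, smul_smul]
  congr 1
  have e2 : symmDiff A C = symmDiff B (symmDiff B (symmDiff A C)) :=
    (symmDiff_symmDiff_cancel_left B _).symm
  have e3 : cliffordSign A (symmDiff A C) =
      cliffordSign A B * cliffordSign A (symmDiff B (symmDiff A C)) := by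
    rw [← cliffordSign_symmDiff_right, ← e2]
  rw [e3, cliffordSign_symmDiff_left]
  ring

theorem leftMul_mul (a b : Cl n) :
    (leftMul (a * b) : CliffordModule n W →L[ℝ] CliffordModule n W) = leftMul a ∘L leftMul b :=
  ContinuousLinearMap.ext fun v => leftMul_mul_apply a b v

theorem cl_mul_assoc (a b c : Cl n) : a * b * c = a * (b * c) :=
  leftMul_mul_apply a b c

theorem leftMul_add (a b : Cl n) :
    (leftMul (a + b) : CliffordModule n W →L[ℝ] CliffordModule n W) = leftMul a + leftMul b := by
  ext v C
  simp only [add_apply, PiLp.add_apply, leftMul_apply, mul_add, add_smul, Finset.sum_add_distrib]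

theorem leftMul_smul (r : ℝ) (a : Cl n) :
    (leftMul (r • a) : CliffordModule n W →L[ℝ] CliffordModule n W) = r • leftMul a := by
  ext v C
  simp only [smul_apply, PiLp.smul_apply, leftMul_apply, Finset.smul_sum, smul_smul,
    smul_eq_mul, mul_left_comm]

theorem leftMul_one : (leftMul (1 : Cl n) : CliffordModule n W →L[ℝ] CliffordModule n W) =
    ContinuousLinearMap.id ℝ _ := by
  ext v C
  change leftMul (basisElt ∅) v C = v C
  rw [leftMul_apply, Finset.sum_eq_single ∅]
  · rw [← Finset.bot_eq_empty, bot_symmDiff, Finset.bot_eq_empty]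
    simp [basisElt, cliffordSign_empty_left]
  · intro A _ hA
    simp [basisElt, hA]
  · simp

/-- Left multiplication as a bounded linear map in the Clifford number. -/
def leftMulL (n : ℕ) (W : Type*) [NormedAddCommGroup W] [NormedSpace ℝ W] :
    Cl n →L[ℝ] CliffordModule n W →L[ℝ] CliffordModule n W :=
  LinearMap.toContinuousLinearMap
    { toFun := fun a => leftMul a
      map_add' := leftMul_add
      map_smul' := leftMul_smul }

theorem leftMulL_apply (a : Cl n) : leftMulL n W a = leftMul a := rfl

theorem leftMul_sub (a b : Cl n) :
    (leftMul (a - b) : CliffordModule n W →L[ℝ] CliffordModule n W) = leftMul a - leftMul b :=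
  (leftMulL n W).map_sub a b

theorem leftMul_sum {ι : Type*} (s : Finset ι) (a : ι → Cl n) :
    (leftMul (∑ i ∈ s, a i) : CliffordModule n W →L[ℝ] CliffordModule n W) =
      ∑ i ∈ s, leftMul (a i) :=
  map_sum (leftMulL n W) a s

end Module

section Algebra

variable {n : ℕ}

theorem cl_mul_def (a b : Cl n) : a * b = leftMul a b := rfl

theorem cl_mul_add (a b c : Cl n) : a * (b + c) = a * b + a * c := (leftMul a).map_add b c

theorem cl_mul_sum {ι : Type*} (s : Finset ι) (a : Cl n) (b : ι → Cl n) :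
    a * ∑ i ∈ s, b i = ∑ i ∈ s, a * b i := map_sum (leftMul a) b s

theorem cl_mul_smul (r : ℝ) (a b : Cl n) : a * (r • b) = r • (a * b) := (leftMul a).map_smul r b

theorem cl_add_mul (a b c : Cl n) : (a + b) * c = a * c + b * c := by
  simp only [cl_mul_def, leftMul_add, add_apply]

theorem cl_smul_mul (r : ℝ) (a b : Cl n) : (r • a) * b = r • (a * b) := by
  simp only [cl_mul_def, leftMul_smul, smul_apply]

theorem cl_one_mul (a : Cl n) : 1 * a = a := by
  rw [cl_mul_def, leftMul_one]; rfl

theorem cl_mul_one (a : Cl n) : a * 1 = a := by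
  ext C
  change leftMul a (basisElt ∅) C = a C
  rw [leftMul_apply, Finset.sum_eq_single C]
  · simp [basisElt, cliffordSign_empty_right]
  · intro A _ hA
    have : symmDiff A C ≠ ∅ := by
      rw [← Finset.bot_eq_empty]; exact fun h => hA (symmDiff_eq_bot.1 h)
    simp [basisElt, this]
  · simp

theorem cl_one_apply (A : Finset (Fin n)) : (1 : Cl n) A = if A = ∅ then 1 else 0 := by
  change basisElt ∅ A = _
  simp [basisElt]

theorem basisElt_empty : basisElt (∅ : Finset (Fin n)) = 1 := rfl

theorem cl_eq_sum (a : Cl n) : a = ∑ A, a A • basisElt A := by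
  ext C
  simp [basisElt, Finset.sum_apply, Pi.single_apply]

theorem leftMul_eq_sum {W : Type*} [NormedAddCommGroup W] [NormedSpace ℝ W] (a : Cl n) :
    (leftMul a : CliffordModule n W →L[ℝ] CliffordModule n W) =
      ∑ A, a A • leftMul (basisElt A) := by
  conv_lhs => rw [cl_eq_sum a]
  rw [leftMul_sum]
  simp only [leftMul_smul]

theorem apply_eq_zero_of_mem_unitSphere {J : Cl n} (hJ : J ∈ unitSphere n) {A : Finset (Fin n)}
    (hA : A.card ≠ 1) : J A = 0 := by
  rcases Nat.lt_or_gt_of_ne hA with h | h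
  · have : A = ∅ := by rw [← Finset.card_eq_zero]; omega
    rw [this]; exact hJ.2.1
  · exact hJ.1 A h

theorem unitSphere_mul_self {J : Cl n} (hJ : J ∈ unitSphere n) : J * J = -1 := by
  ext C
  change leftMul J J C = -((1 : Cl n) C)
  rw [leftMul_apply, cl_one_apply]
  simp only [smul_eq_mul]
  split_ifs with hC
  · subst hC
    have hn : ∑ A, J A ^ 2 = 1 := by
      have := EuclideanSpace.norm_sq_eq J
      rw [hJ.2.2] at this
      simpa using this.symm
    rw [← hn, ← Finset.sum_neg_distrib]
    refine Finset.sum_congr rfl fun A _ => ?_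
    rw [← Finset.bot_eq_empty, symmDiff_bot]
    by_cases hA : A.card = 1
    · obtain ⟨i, rfl⟩ := Finset.card_eq_one.1 hA
      have : cliffordSign {i} {i} = -1 := by simp [cliffordSign_eq_prod]
      rw [this]; ring
    · rw [apply_eq_zero_of_mem_unitSphere hJ hA]; ring
  · set S := ∑ A, cliffordSign A (symmDiff A C) * J A * J (symmDiff A C) with hS
    let e : Finset (Fin n) ≃ Finset (Fin n) :=
      ⟨fun B => symmDiff B C, fun B => symmDiff B C, fun B => symmDiff_symmDiff_cancel_right C B,
        fun B => symmDiff_symmDiff_cancel_right C B⟩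
    -- The summands for `A` and `A ∆ C` cancel, since only singletons contribute and distinct units
    -- anticommute.
    have h1 : S = -S := by
      conv_lhs => rw [hS, ← Equiv.sum_comp e]
      rw [hS, ← Finset.sum_neg_distrib]
      refine Finset.sum_congr rfl fun A _ => ?_
      change cliffordSign (symmDiff A C) (symmDiff (symmDiff A C) C) * J (symmDiff A C) *
        J (symmDiff (symmDiff A C) C) = _
      rw [symmDiff_symmDiff_cancel_right]
      by_cases hA : A.card = 1
      · by_cases hB : (symmDiff A C).card = 1
        · obtain ⟨i, rfl⟩ := Finset.card_eq_one.1 hA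
          obtain ⟨j, hj⟩ := Finset.card_eq_one.1 hB
          have hij : i ≠ j := by
            rintro rfl
            exact hC (symmDiff_eq_left.1 hj)
          rw [hj]
          have : cliffordSign {j} {i} = -cliffordSign {i} {j} := by
            simp only [cliffordSign_eq_prod, Finset.prod_singleton]
            rcases lt_or_gt_of_ne hij with h | h
            · simp [h.le, not_le.2 h]
            · simp [h.le, not_le.2 h]
          rw [this]; ring
        · rw [apply_eq_zero_of_mem_unitSphere hJ hB]; ring
      · rw [apply_eq_zero_of_mem_unitSphere hJ hA]; ring
    have : S = 0 := by linarith
    rw [this, neg_zero]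

theorem neg_mem_unitSphere {J : Cl n} (hJ : J ∈ unitSphere n) : -J ∈ unitSphere n := by
  refine ⟨fun A hA => ?_, ?_, by rw [norm_neg]; exact hJ.2.2⟩
  · rw [PiLp.neg_apply, hJ.1 A hA, neg_zero]
  · have : re J = 0 := hJ.2.1
    simp only [re] at this ⊢
    rw [PiLp.neg_apply, this, neg_zero]

/-- The point of `ℂ_J` that corresponds to a complex number. -/
def pp (J : Cl n) (z : ℂ) : Cl n := planePoint J z.re z.im

theorem pp_eq (J : Cl n) (z : ℂ) : pp J z = z.re • (1 : Cl n) + z.im • J := rfl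

theorem pp_add (J : Cl n) (z w : ℂ) : pp J (z + w) = pp J z + pp J w := by
  simp only [pp_eq, Complex.add_re, Complex.add_im]; module

theorem pp_ofReal (J : Cl n) (r : ℝ) : pp J r = r • (1 : Cl n) := by
  simp [pp_eq]

theorem pp_I (J : Cl n) : pp J Complex.I = J := by simp [pp_eq]

theorem pp_mul {J : Cl n} (hJ : J ∈ unitSphere n) (z w : ℂ) : pp J (z * w) = pp J z * pp J w := by
  simp only [pp_eq, cl_mul_add, cl_add_mul, cl_mul_smul, cl_smul_mul, cl_one_mul, cl_mul_one,
    unitSphere_mul_self hJ, Complex.mul_re, Complex.mul_im]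
  module

theorem leftMul_pp {W : Type*} [NormedAddCommGroup W] [NormedSpace ℝ W] (J : Cl n) (z : ℂ) :
    (leftMul (pp J z) : CliffordModule n W →L[ℝ] CliffordModule n W) =
      z.re • ContinuousLinearMap.id ℝ _ + z.im • leftMul J := by
  rw [pp_eq, leftMul_add, leftMul_smul, leftMul_smul, leftMul_one]

theorem re_pp {J : Cl n} (hJ : J ∈ unitSphere n) (z : ℂ) : re (pp J z) = z.re := by
  have : J ∅ = 0 := hJ.2.1
  simp [re, pp_eq, cl_one_apply, this]

theorem norm_cl_one : ‖(1 : Cl n)‖ = 1 := by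
  change ‖basisElt ∅‖ = 1
  simp [basisElt]

theorem norm_pp {J : Cl n} (hJ : J ∈ unitSphere n) (z : ℂ) : ‖pp J z‖ = ‖z‖ := by
  have h0 : J ∅ = 0 := hJ.2.1
  have h1 : inner ℝ (z.re • (1 : Cl n)) (z.im • J) = 0 := by
    rw [inner_smul_left, inner_smul_right]
    have : inner ℝ (1 : Cl n) J = 0 := by
      change inner ℝ (EuclideanSpace.single ∅ (1 : ℝ)) J = 0
      rw [EuclideanSpace.inner_single_left, h0]; simp
    rw [this]; simp
  rw [← sq_eq_sq₀ (norm_nonneg _) (norm_nonneg _), pp_eq, pow_two,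
    norm_add_sq_eq_norm_sq_add_norm_sq_real h1, norm_smul, norm_smul, norm_cl_one, hJ.2.2,
    ← Complex.normSq_eq_norm_sq, Complex.normSq_apply]
  simp

theorem pp_mem_paravectors {J : Cl n} (hJ : J ∈ unitSphere n) (z : ℂ) :
    pp J z ∈ paravectors n := by
  intro A hA
  have h1 : A ≠ ∅ := by rintro rfl; simp at hA
  simp [pp_eq, cl_one_apply, hJ.1 A hA, h1]

theorem conj_pp {J : Cl n} (hJ : J ∈ unitSphere n) (z : ℂ) :
    CliffordCalc.conj (pp J z) = pp J (conj z) := by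
  ext A
  have h0 : J ∅ = 0 := hJ.2.1
  change (-1 : ℝ) ^ (A.card * (A.card + 1) / 2) * (pp J z) A = _
  simp only [pp_eq, PiLp.add_apply, PiLp.smul_apply, cl_one_apply, smul_eq_mul, Complex.conj_re,
    Complex.conj_im]
  by_cases h : A = ∅
  · subst h; simp [h0]
  · by_cases hA : A.card = 1
    · simp [hA, h]
    · simp [apply_eq_zero_of_mem_unitSphere hJ hA, h]

theorem paraInv_pp {J : Cl n} (hJ : J ∈ unitSphere n) (z : ℂ) : paraInv (pp J z) = pp J z⁻¹ := by
  rw [paraInv, norm_pp hJ, conj_pp hJ, pp_eq, pp_eq, smul_add, smul_smul, smul_smul,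
    Complex.inv_re, Complex.inv_im, Complex.normSq_eq_norm_sq, Complex.conj_re, Complex.conj_im]
  congr 2 <;> ring

theorem paraInv_one_add_mul_self {J : Cl n} (hJ : J ∈ unitSphere n) (z : ℂ) :
    paraInv (1 + pp J z * pp J z) = pp J (rho z) := by
  have : (1 : Cl n) = pp J 1 := by simp [pp_eq]
  rw [← pp_mul hJ]
  conv_lhs => rw [this]
  rw [← pp_add, paraInv_pp hJ, rho, pow_two]

theorem polar_eq_pp (J : Cl n) (t ψ : ℝ) : polar J t ψ = pp J (ray ψ t) := by
  rw [polar, pp, ray_re, ray_im]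

/-! ## Double sectors -/

theorem exists_pp_of_mem_doubleSector {θ : ℝ} (hθ : θ ∈ Ioo 0 (Real.pi / 2)) {s : Cl n}
    (hs : s ∈ doubleSector n θ) : ∃ J ∈ unitSphere n, ∃ z ∈ csector θ, s = pp J z := by
  obtain ⟨J, hJ, t, ht, φ, hφ, rfl⟩ := hs
  exact ⟨J, hJ, ray φ t, ray_mem_csector_of_mem_angles hθ hφ ht, polar_eq_pp J t φ⟩

theorem abs_im_of_pp {J : Cl n} (hJ : J ∈ unitSphere n) (z : ℂ) :
    ‖pp J z - re (pp J z) • (1 : Cl n)‖ = |z.im| := by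
  rw [re_pp hJ, pp_eq, add_sub_cancel_left, norm_smul, hJ.2.2, mul_one, Real.norm_eq_abs]

/-- The real part of a paravector and the modulus of its imaginary part do not depend on the plane
`ℂ_J` chosen to represent it, and they decide membership in the sector. -/
theorem mem_csector_of_pp_mem {θ : ℝ} (hθ : θ ∈ Ioo 0 (Real.pi / 2)) {J : Cl n}
    (hJ : J ∈ unitSphere n) {z : ℂ} (hz : pp J z ∈ doubleSector n θ) : z ∈ csector θ := by
  obtain ⟨J', hJ', w, hw, h⟩ := exists_pp_of_mem_doubleSector hθ hz
  have h1 : z.re = w.re := by rw [← re_pp hJ, h, re_pp hJ']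
  have h2 : |z.im| = |w.im| := by rw [← abs_im_of_pp hJ, h, abs_im_of_pp hJ']
  have hw' : |w.im| * Real.cos θ < |w.re| * Real.sin θ := hw
  rw [← h1, ← h2] at hw'
  exact hw'

theorem arg_mem_of_mem_rsector {θ : ℝ} (hθ : θ ∈ Ioo 0 (Real.pi / 2)) {z : ℂ}
    (hz : z ∈ rsector θ) : z.arg ∈ Ioo (-θ) θ := by
  have hre := re_pos_of_mem_rsector hθ hz
  have hz' : |z.im| * Real.cos θ < z.re * Real.sin θ := hz
  have hn : 0 < ‖z‖ := norm_pos_iff.2 (by rintro rfl; simp at hre)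
  have harg : |z.arg| < Real.pi / 2 := Complex.abs_arg_lt_pi_div_two_iff.2 (Or.inl hre)
  have e1 : z.re = ‖z‖ * Real.cos |z.arg| := by rw [Real.cos_abs, Complex.norm_mul_cos_arg]
  have e2 : |z.im| = ‖z‖ * Real.sin |z.arg| := by
    rw [← Complex.norm_mul_sin_arg z, abs_mul, abs_of_pos hn, Real.abs_sin_eq_sin_abs_of_abs_le_pi
      (by linarith [Real.pi_pos])]
  rw [e2, e1, mul_assoc, mul_assoc] at hz'
  have h3 := lt_of_mul_lt_mul_left hz' hn.le
  refine abs_lt.1 ?_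
  by_contra hcon
  rw [not_lt] at hcon
  have h4 : 0 ≤ Real.sin (|z.arg| - θ) :=
    Real.sin_nonneg_of_nonneg_of_le_pi (by linarith) (by linarith [hθ.1])
  rw [Real.sin_sub] at h4
  linarith

theorem pp_mem_doubleSector {θ : ℝ} (hθ : θ ∈ Ioo 0 (Real.pi / 2)) {J : Cl n}
    (hJ : J ∈ unitSphere n) {z : ℂ} (hz : z ∈ csector θ) : pp J z ∈ doubleSector n θ := by
  have hray : ∀ w : ℂ, ray w.arg ‖w‖ = w := fun w => Complex.norm_mul_exp_arg_mul_I w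
  have hn : 0 < ‖z‖ := norm_pos_iff.2 (ne_zero_of_mem_csector hz)
  rcases lt_or_gt_of_ne (re_ne_zero_of_mem_csector hθ hz) with h | h
  · have h1 := arg_mem_of_mem_rsector hθ
      (mem_rsector_of_re_pos (neg_mem_csector hz) (by simpa using h))
    refine ⟨J, hJ, ‖z‖, hn, Real.pi + (-z).arg,
      Or.inr ⟨by linarith [h1.1], by linarith [h1.2]⟩, ?_⟩
    rw [polar_eq_pp, ray_add_pi, ← norm_neg z, hray, neg_neg]
  · refine ⟨J, hJ, ‖z‖, hn, z.arg, Or.inl (arg_mem_of_mem_rsector hθ (mem_rsector_of_re_pos hz h)),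
      ?_⟩
    rw [polar_eq_pp, hray]

theorem mem_sliceDomain_iff {θ : ℝ} (hθ : θ ∈ Ioo 0 (Real.pi / 2)) {J : Cl n}
    (hJ : J ∈ unitSphere n) (x : ℝ × ℝ) :
    x ∈ sliceDomain (doubleSector n θ) ↔ (⟨x.1, x.2⟩ : ℂ) ∈ csector θ :=
  ⟨fun h => mem_csector_of_pp_mem hθ hJ (h J hJ),
    fun h _ hJ' => pp_mem_doubleSector hθ hJ' (z := ⟨x.1, x.2⟩) h⟩

/-- The sector lies in the closed set given by the non-strict inequality between real and imaginary
parts, stated without reference to a plane; points of the complementary cone violate it. -/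
theorem pp_notMem_closure {ω : ℝ} (hω : ω ∈ Ioo 0 (Real.pi / 2)) {J : Cl n}
    (hJ : J ∈ unitSphere n) {z : ℂ} (hz : z ∈ cocone ω) :
    pp J z ∉ closure (doubleSector n ω) := by
  have hre : Continuous fun s : Cl n => re s := (PiLp.proj (𝕜 := ℝ) 2 (fun _ => ℝ) ∅).continuous
  have hcl : IsClosed {s : Cl n | ‖s - re s • (1 : Cl n)‖ * Real.cos ω ≤ |re s| * Real.sin ω} :=
    isClosed_le (by fun_prop) (by fun_prop)
  intro h
  have h1 := closure_minimal (fun s hs => ?_) hcl h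
  · have h2 : |z.im| * Real.cos ω ≤ |z.re| * Real.sin ω := by
      have h3 : ‖pp J z - re (pp J z) • (1 : Cl n)‖ * Real.cos ω ≤
        |re (pp J z)| * Real.sin ω := h1
      rwa [abs_im_of_pp hJ, re_pp hJ] at h3
    have h4 : |z.re| * Real.sin ω < |z.im| * Real.cos ω := hz
    linarith
  · obtain ⟨J', hJ', w, hw, rfl⟩ := exists_pp_of_mem_doubleSector hω hs
    change ‖pp J' w - re (pp J' w) • (1 : Cl n)‖ * Real.cos ω ≤ |re (pp J' w)| * Real.sin ω
    rw [abs_im_of_pp hJ', re_pp hJ']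
    exact le_of_lt hw

end Algebra

/-! ## The resolvent operators of a bisectorial operator -/

section Graph

variable {V : Type*} [NormedAddCommGroup V] [NormedSpace ℝ V]

theorem mem_graph_pcomp {A B : V →ₗ.[ℝ] V} {u w : V} :
    (u, w) ∈ (pcomp A B).graph ↔ ∃ x, (u, x) ∈ B.graph ∧ (x, w) ∈ A.graph := by
  simp only [LinearPMap.mem_graph_iff]
  constructor
  · rintro ⟨⟨y, ⟨y', hy', hyy'⟩, hy⟩, rfl, rfl⟩
    exact ⟨B ⟨y, hy⟩, ⟨⟨y, hy⟩, rfl, rfl⟩, ⟨B ⟨y, hy⟩, by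
      have : y' = ⟨y, hy⟩ := Subtype.ext hyy'
      subst this; exact hy'⟩, rfl, rfl⟩
  · rintro ⟨x, ⟨y, rfl, rfl⟩, ⟨x', hx', rfl⟩⟩
    have hm : B y ∈ A.domain := hx' ▸ x'.2
    refine ⟨⟨y, ⟨y, hm, rfl⟩, y.2⟩, rfl, ?_⟩
    have : x' = ⟨B y, hm⟩ := Subtype.ext hx'
    subst this; rfl

theorem mem_graph_ofBounded {B : V →L[ℝ] V} {u w : V} : (u, w) ∈ (ofBounded B).graph ↔ B u = w := by
  rw [LinearPMap.mem_graph_iff]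
  constructor
  · rintro ⟨y, rfl, rfl⟩; rfl
  · rintro rfl; exact ⟨⟨u, trivial⟩, rfl, rfl⟩

/-- For `Γ` the graph of `T`, the point is that `q` commutes with `T` on its domain. For `u` in `dom
T` the vector `p u` lies in `dom T²`, and `T² - 2 a T + b` maps it to `T u`; the left inverse
property then returns `q (T u) = p u`. -/
theorem resolvent_apply_of_mem_graph {Γ : Submodule ℝ (V × V)}
    (hΓ : ∀ u w w', (u, w) ∈ Γ → (u, w') ∈ Γ → w = w') {a b : ℝ} {q p : V → V}
    (h1 : ∀ v, (q v, p v) ∈ Γ) (h2 : ∀ v, (p v, v + (2 * a) • p v - b • q v) ∈ Γ)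
    (h3 : ∀ u w₁ w₂, (u, w₁) ∈ Γ → (w₁, w₂) ∈ Γ → q (w₂ - (2 * a) • w₁ + b • u) = u)
    {u w : V} (h : (u, w) ∈ Γ) : q w = p u ∧ p w = u + (2 * a) • p u - b • q u := by
  have h4 := Γ.sub_mem (Γ.add_mem h (Γ.smul_mem (2 * a) (h2 u))) (Γ.smul_mem b (h1 u))
  have h5 := h3 (p u) _ _ (h2 u) h4
  have e : w + (2 * a) • (u + (2 * a) • p u - b • q u) - b • p u -
      (2 * a) • (u + (2 * a) • p u - b • q u) + b • p u = w := by module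
  have h6 : q w = p u := by rw [← e]; exact h5
  refine ⟨h6, hΓ _ _ _ (h6 ▸ h1 w) (h2 u)⟩

theorem sin_mul_norm_le_abs_im {ω : ℝ} (hω : ω ∈ Ioo 0 (Real.pi / 2)) {z : ℂ}
    (hz : z ∈ cocone ω) : Real.sin ω * ‖z‖ ≤ |z.im| := by
  have hs : 0 < Real.sin ω := Real.sin_pos_of_pos_of_lt_pi hω.1 (by linarith [hω.2, Real.pi_pos])
  have hc : 0 < Real.cos ω := Real.cos_pos_of_mem_Ioo ⟨by linarith [hω.1, Real.pi_pos], hω.2⟩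
  have hz' : |z.re| * Real.sin ω < |z.im| * Real.cos ω := hz
  refine abs_le_of_sq_le_sq' ?_ (abs_nonneg _) |>.2
  have h1 : (|z.re| * Real.sin ω) ^ 2 ≤ (|z.im| * Real.cos ω) ^ 2 :=
    pow_le_pow_left₀ (by positivity) hz'.le 2
  rw [mul_pow, mul_pow, sq_abs, sq_abs] at h1
  rw [mul_pow, sq_abs, ← Complex.normSq_eq_norm_sq, Complex.normSq_apply]
  nlinarith [Real.sin_sq_add_cos_sq ω]

/-- Conjugating `z` changes only the sign of the term with `q z * L`. Adding and subtracting the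
bounds at `z` and `conj z` therefore isolates `p z` and `z.im • (q z * L)`. On the cone `|Im z|`
dominates `‖z‖`, and `L * L = -1` recovers `q z`. -/
theorem norm_le_of_resolvent_bound {ω : ℝ} (hω : ω ∈ Ioo 0 (Real.pi / 2)) {A : Type*} [NormedRing A]
    [NormedAlgebra ℝ A] {q p : ℂ → A} (q_conj : ∀ z, q (conj z) = q z)
    (p_conj : ∀ z, p (conj z) = p z) {L : A} (hL : L * L = -1) {C : ℝ}
    (hC : ∀ z ∈ cocone ω, ‖z.re • q z - z.im • (q z * L) - p z‖ ≤ C / ‖z‖) {z : ℂ}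
    (hz : z ∈ cocone ω) :
    ‖z‖ ^ 2 * ‖q z‖ ≤ C * (‖L‖ / Real.sin ω) ∧ ‖z‖ * ‖p z‖ ≤ C * (‖L‖ / Real.sin ω + 1) := by
  have hs : 0 < Real.sin ω := Real.sin_pos_of_pos_of_lt_pi hω.1 (by linarith [hω.2, Real.pi_pos])
  have hn : 0 < ‖z‖ := norm_pos_iff.2 (ne_zero_of_mem_cocone hz)
  have b1 := hC z hz
  have b2 := hC (conj z) (conj_mem_cocone hz)
  rw [q_conj, p_conj, Complex.conj_re, Complex.conj_im, RCLike.norm_conj] at b2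
  have e1 : (2 * z.im) • (q z * L) = (z.re • q z - (-z.im) • (q z * L) - p z) -
      (z.re • q z - z.im • (q z * L) - p z) := by module
  have e2 : (2 : ℝ) • p z = (2 : ℝ) • (z.re • q z) - ((z.re • q z - (-z.im) • (q z * L) - p z) +
      (z.re • q z - z.im • (q z * L) - p z)) := by module
  have n1 : ‖z‖ * (|z.im| * ‖q z * L‖) ≤ C := by
    have h1 : ‖(2 * z.im) • (q z * L)‖ ≤ C / ‖z‖ + C / ‖z‖ := by
      rw [e1]; exact (norm_sub_le _ _).trans (add_le_add b2 b1)
    rw [norm_smul, norm_mul, Real.norm_eq_abs, Real.norm_eq_abs, abs_two] at h1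
    rw [← le_div_iff₀' hn]
    linarith
  have e3 : q z = -(q z * L * L) := by rw [mul_assoc, hL, mul_neg, mul_one, neg_neg]
  have n2 : ‖q z‖ ≤ ‖q z * L‖ * ‖L‖ := by
    conv_lhs => rw [e3]
    rw [norm_neg]; exact norm_mul_le _ _
  have n3 := sin_mul_norm_le_abs_im hω hz
  have n4 : ‖z‖ ^ 2 * ‖q z‖ ≤ C * (‖L‖ / Real.sin ω) := by
    rw [← mul_div_assoc, le_div_iff₀ hs]
    calc ‖z‖ ^ 2 * ‖q z‖ * Real.sin ω = ‖z‖ * ((Real.sin ω * ‖z‖) * ‖q z‖) := by ring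
      _ ≤ ‖z‖ * (|z.im| * (‖q z * L‖ * ‖L‖)) := by gcongr
      _ = ‖z‖ * (|z.im| * ‖q z * L‖) * ‖L‖ := by ring
      _ ≤ C * ‖L‖ := by gcongr
  refine ⟨n4, ?_⟩
  have h1 : 2 * ‖p z‖ ≤ 2 * (‖z‖ * ‖q z‖) + (C / ‖z‖ + C / ‖z‖) := by
    calc 2 * ‖p z‖ = ‖(2 : ℝ) • p z‖ := by rw [norm_smul, Real.norm_eq_abs, abs_two]
      _ ≤ ‖(2 : ℝ) • (z.re • q z)‖ + (C / ‖z‖ + C / ‖z‖) := by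
          rw [e2]
          exact (norm_sub_le _ _).trans (add_le_add le_rfl
            ((norm_add_le _ _).trans (add_le_add b2 b1)))
      _ ≤ 2 * (‖z‖ * ‖q z‖) + (C / ‖z‖ + C / ‖z‖) := by
          rw [norm_smul, norm_smul, Real.norm_eq_abs, abs_two, Real.norm_eq_abs]
          gcongr
          exact Complex.abs_re_le_norm z
  calc ‖z‖ * ‖p z‖ ≤ ‖z‖ * (‖z‖ * ‖q z‖ + C / ‖z‖) := by gcongr; linarith
    _ = ‖z‖ ^ 2 * ‖q z‖ + C := by field_simp
    _ ≤ C * (‖L‖ / Real.sin ω + 1) := by linarith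

/-- All relations are consequences of the commutation of each `q z` with the operator whose graph is
`Γ`, applied to vectors in the ranges of the other resolvents. -/
theorem resolventPair_of_graph {ω : ℝ} {Γ : Submodule ℝ (V × V)}
    (hΓ : ∀ u w w', (u, w) ∈ Γ → (u, w') ∈ Γ → w = w') {q p : ℂ → V →L[ℝ] V}
    (q_conj : ∀ z, q (conj z) = q z) (p_conj : ∀ z, p (conj z) = p z)
    (h1 : ∀ z v, (q z v, p z v) ∈ Γ)
    (h2 : ∀ z ∈ cocone ω, ∀ v, (p z v, v + (2 * z.re) • p z v - (‖z‖ ^ 2) • q z v) ∈ Γ)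
    (h3 : ∀ z ∈ cocone ω, ∀ u w₁ w₂, (u, w₁) ∈ Γ → (w₁, w₂) ∈ Γ →
      q z (w₂ - (2 * z.re) • w₁ + (‖z‖ ^ 2) • u) = u)
    (bound : ∃ C : ℝ, ∀ z ∈ cocone ω, ‖z‖ ^ 2 * ‖q z‖ ≤ C ∧ ‖z‖ * ‖p z‖ ≤ C) :
    ResolventPair ω q p := by
  have key : ∀ z ∈ cocone ω, ∀ u w, (u, w) ∈ Γ →
      q z w = p z u ∧ p z w = u + (2 * z.re) • p z u - (‖z‖ ^ 2) • q z u := fun z hz u w h =>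
    resolvent_apply_of_mem_graph hΓ (h1 z) (h2 z hz) (h3 z hz) h
  have qp : ∀ z ∈ cocone ω, ∀ w v, q z (p w v) = p z (q w v) := fun z hz w v =>
    (key z hz _ _ (h1 w v)).1
  have qq : ∀ z ∈ cocone ω, ∀ w ∈ cocone ω, ∀ v, q z (q w v) = q w (q z v) := by
    intro z hz w hw v
    have e1 := (key z hz _ _ (h2 w hw v)).1
    rw [map_sub, map_add, map_smul, map_smul] at e1
    -- `q z (q w v)` lies in the domain of the square, so it is `q w` applied to its image under the
    -- quadratic expression for `w`; that image is `q z v` by `e1`.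
    have e2 := h3 w hw (q z (q w v)) (p z (q w v)) (p z (p w v)) (h1 z _)
      (by rw [← qp z hz]; exact h1 z _)
    rw [← e2, ← e1, qp z hz]
    congr 1
    module
  have qp' : ∀ z ∈ cocone ω, ∀ w ∈ cocone ω, ∀ v, p z (q w v) = p w (q z v) := fun z hz w hw v =>
    hΓ _ _ _ (h1 z (q w v)) (by rw [qq z hz w hw]; exact h1 w _)
  have pp' : ∀ z ∈ cocone ω, ∀ w v,
      p z (p w v) = q w v + (2 * z.re) • p z (q w v) - (‖z‖ ^ 2) • q z (q w v) :=
    fun z hz w v => (key z hz _ _ (h1 w v)).2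
  refine ⟨q_conj, p_conj, fun z hz w hw => ?_, fun z hz w hw => ?_, fun z hz w _ => ?_,
    fun z hz w hw => ?_, fun z hz w _ => ?_, fun z hz w hw => ?_, bound⟩
  · exact ContinuousLinearMap.ext fun v => qq z hz w hw v
  · exact ContinuousLinearMap.ext fun v => (qp z hz w v).trans (qp' z hz w hw v)
  · exact ContinuousLinearMap.ext fun v => qp z hz w v
  · refine ContinuousLinearMap.ext fun v => ?_
    change p z (p w v) = p w (p z v)
    refine hΓ (p z (q w v)) _ _ ?_ ?_
    · rw [pp' z hz]; exact h2 z hz _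
    · rw [qp' z hz w hw, pp' w hw]; exact h2 w hw _
  · exact ContinuousLinearMap.ext fun v => pp' z hz w v
  · refine ContinuousLinearMap.ext fun v => ?_
    have e := (key z hz _ _ (h2 w hw v)).2
    rw [map_sub, map_add, map_smul, map_smul, qp z hz] at e
    exact e.symm

end Graph

/-! ### The resolvent relations for a bisectorial operator -/

section Operators

variable {n : ℕ} {W : Type*} [NormedAddCommGroup W] [NormedSpace ℝ W]

theorem mem_graph_Qop {T : ClosedOp n W} {s : Cl n} {u w : CliffordModule n W} :
    (u, w) ∈ (Qop T s).graph ↔ ∃ w₁ w₂, (u, w₁) ∈ T.toPMap.graph ∧ (w₁, w₂) ∈ T.toPMap.graph ∧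
      w = w₂ - (2 * re s) • w₁ + (‖s‖ ^ 2) • u := by
  constructor
  · intro h
    obtain ⟨⟨y, ⟨hy1, hy2⟩, hy3⟩, rfl, rfl⟩ := LinearPMap.mem_graph_iff _ |>.1 h
    obtain ⟨x, hx1, hx2⟩ := mem_graph_pcomp.1 (LinearPMap.mem_graph _ ⟨y, hy1⟩)
    refine ⟨x, _, hx1, hx2, ?_⟩
    have hy2' : y ∈ T.toPMap.domain := hy2
    have : T.toPMap ⟨y, hy2'⟩ = x :=
      LinearPMap.mem_graph_snd_inj _ (LinearPMap.mem_graph _ ⟨y, hy2'⟩) hx1 rfl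
    rw [← this]
    rfl
  · rintro ⟨w₁, w₂, h1, h2, rfl⟩
    obtain ⟨⟨y, hy1⟩, rfl, rfl⟩ := LinearPMap.mem_graph_iff _ |>.1
      (mem_graph_pcomp.2 ⟨w₁, h1, h2⟩ : (u, w₂) ∈ (pcomp T.toPMap T.toPMap).graph)
    obtain ⟨⟨y', hy2⟩, h3, rfl⟩ := LinearPMap.mem_graph_iff _ |>.1 h1
    change y' = y at h3
    subst h3
    exact LinearPMap.mem_graph_iff _ |>.2 ⟨⟨y', ⟨hy1, hy2⟩, trivial⟩, rfl, rfl⟩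

/-- `Q_s[T]` sees `s` only through `Re s` and `|s|`; hence the resolvents are invariant under
conjugation of `s`. -/
theorem qInv_congr (T : ClosedOp n W) {s s' : Cl n} (h1 : re s = re s') (h2 : ‖s‖ = ‖s'‖) :
    qInv T s = qInv T s' := by
  have : Qop T s = Qop T s' := by unfold Qop; rw [h1, h2]
  unfold qInv
  rw [this]

theorem qInv_isBoundedInverse {T : ClosedOp n W} {s : Cl n} (hs : s ∈ resolventSet T) :
    IsBoundedInverse (Qop T s) (qInv T s) := by
  unfold qInv
  rw [dif_pos hs.2]
  exact hs.2.choose_spec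

theorem qInv_apply_of_mem_graph {T : ClosedOp n W} {s : Cl n} (hs : s ∈ resolventSet T)
    {u w₁ w₂ : CliffordModule n W} (h1 : (u, w₁) ∈ T.toPMap.graph)
    (h2 : (w₁, w₂) ∈ T.toPMap.graph) :
    qInv T s (w₂ - (2 * re s) • w₁ + (‖s‖ ^ 2) • u) = u := by
  obtain ⟨y, rfl, hy⟩ := LinearPMap.mem_graph_iff _ |>.1
    (mem_graph_Qop.2 ⟨w₁, w₂, h1, h2, rfl⟩ : (u, _) ∈ (Qop T s).graph)
  exact (congrArg _ hy.symm).trans ((qInv_isBoundedInverse hs).2 y)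

variable [CompleteSpace W]

theorem qInv_tqInv_mem_graph (T : ClosedOp n W) (s : Cl n) (v : CliffordModule n W) :
    (qInv T s v, tqInv T s v) ∈ T.toPMap.graph :=
  LinearPMap.mem_graph_iff _ |>.2 ⟨⟨_, qInv_mem T s v⟩, rfl, rfl⟩

theorem tqInv_congr (T : ClosedOp n W) {s s' : Cl n} (h1 : re s = re s') (h2 : ‖s‖ = ‖s'‖) :
    tqInv T s = tqInv T s' := by
  refine ContinuousLinearMap.ext fun v => ?_
  have h3 := qInv_tqInv_mem_graph T s v
  rw [qInv_congr T h1 h2] at h3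
  exact LinearPMap.mem_graph_snd_inj _ h3 (qInv_tqInv_mem_graph T s' v) rfl

theorem tqInv_mem_graph {T : ClosedOp n W} {s : Cl n} (hs : s ∈ resolventSet T)
    (v : CliffordModule n W) :
    (tqInv T s v, v + (2 * re s) • tqInv T s v - (‖s‖ ^ 2) • qInv T s v) ∈ T.toPMap.graph := by
  obtain ⟨hm, he⟩ := (qInv_isBoundedInverse hs).1 v
  obtain ⟨w₁, w₂, h1, h2, h3⟩ := mem_graph_Qop.1
    (LinearPMap.mem_graph_iff _ |>.2 ⟨⟨_, hm⟩, rfl, he⟩ : (qInv T s v, v) ∈ (Qop T s).graph)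
  have : w₁ = tqInv T s v := LinearPMap.mem_graph_snd_inj _ h1 (qInv_tqInv_mem_graph T s v) rfl
  subst this
  have h4 : v + (2 * re s) • tqInv T s v - (‖s‖ ^ 2) • qInv T s v = w₂ := by
    linear_combination (norm := module) h3
  rw [h4]
  exact h2

theorem cocone_subset {ω ω' : ℝ} (hω : ω ∈ Ioo 0 (Real.pi / 2)) (hω' : ω' ∈ Ioo ω (Real.pi / 2)) :
    cocone ω' ⊆ cocone ω := by
  intro z hz
  have hz' : |z.re| * Real.sin ω' < |z.im| * Real.cos ω' := hz
  have hc : 0 < Real.cos ω := Real.cos_pos_of_mem_Ioo ⟨by linarith [hω.1, Real.pi_pos], hω.2⟩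
  have hc' : 0 < Real.cos ω' := Real.cos_pos_of_mem_Ioo ⟨by linarith [hω.1, hω'.1, Real.pi_pos], hω'.2⟩
  have h1 : 0 ≤ Real.sin (ω' - ω) := Real.sin_nonneg_of_nonneg_of_le_pi (by linarith [hω'.1])
    (by linarith [hω.1, hω'.2, Real.pi_pos])
  rw [Real.sin_sub] at h1
  change |z.re| * Real.sin ω < |z.im| * Real.cos ω
  have h2 := mul_lt_mul_of_pos_right hz' hc
  have h3 := mul_le_mul_of_nonneg_left h1 (abs_nonneg z.re)
  nlinarith

theorem sResolvent_pp {J : Cl n} (hJ : J ∈ unitSphere n) (T : ClosedOp n W) (z : ℂ) :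
    sResolvent T (pp J z) = z.re • qInv T (pp J z) - z.im • (qInv T (pp J z) * leftMul J) -
      tqInv T (pp J z) := by
  refine ContinuousLinearMap.ext fun v => ?_
  simp only [sResolvent, conj_pp hJ, leftMul_pp, Complex.conj_re, Complex.conj_im,
    sub_apply, add_apply, smul_apply, ContinuousLinearMap.comp_apply,
    mul_apply_eq_comp, ContinuousLinearMap.id_apply, map_add, map_smul]
  module

/-- The angle `ω'` must exceed `ω`: the resolvent estimate is uniform only outside a strictly larger
sector, while the spectrum is controlled by `ω`. -/
theorem resolventPair_of_isBisectorial {T : ClosedOp n W} {ω ω' : ℝ}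
    (hω : ω ∈ Ioo 0 (Real.pi / 2)) (hω' : ω' ∈ Ioo ω (Real.pi / 2)) (hT : IsBisectorial T ω)
    {J : Cl n} (hJ : J ∈ unitSphere n) :
    ResolventPair ω' (fun z => qInv T (pp J z)) (fun z => tqInv T (pp J z)) := by
  have hω'' : ω' ∈ Ioo 0 (Real.pi / 2) := ⟨hω.1.trans hω'.1, hω'.2⟩
  have hres : ∀ z ∈ cocone ω', pp J z ∈ resolventSet T := by
    intro z hz
    by_contra hcon
    exact pp_notMem_closure hω hJ (cocone_subset hω hω' hz)
      (hT.spectrum_subset ⟨pp_mem_paravectors hJ z, hcon⟩)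
  have hconj : ∀ z, re (pp J (conj z)) = re (pp J z) ∧ ‖pp J (conj z)‖ = ‖pp J z‖ := fun z => by
    rw [re_pp hJ, re_pp hJ, norm_pp hJ, norm_pp hJ, Complex.conj_re, RCLike.norm_conj]
    exact ⟨rfl, rfl⟩
  have qc := fun z => qInv_congr T (hconj z).1 (hconj z).2
  have pc := fun z => tqInv_congr T (hconj z).1 (hconj z).2
  obtain ⟨C, hC0, hC⟩ := hT.resolvent_bound ω' hω'
  have hLL : (leftMul J : CliffordModule n W →L[ℝ] CliffordModule n W) * leftMul J = -1 := by
    change leftMul J ∘L leftMul J = _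
    rw [← leftMul_mul, unitSphere_mul_self hJ, ← zero_sub, leftMul_sub, leftMul_one, ← zero_sub]
    congr 1
    exact (leftMulL n W).map_zero
  have hb := fun z hz => norm_le_of_resolvent_bound hω'' (q := fun z => qInv T (pp J z))
    (p := fun z => tqInv T (pp J z)) qc pc hLL (C := C) (fun z hz => ?_) hz
    (z := z)
  · refine resolventPair_of_graph (Γ := T.toPMap.graph)
      (fun u w w' h h' => LinearPMap.mem_graph_snd_inj _ h h' rfl) qc pc
      (fun z v => qInv_tqInv_mem_graph T _ v) (fun z hz v => ?_) (fun z hz u w₁ w₂ h1 h2 => ?_)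
      ⟨max _ _, fun z hz => ⟨(hb z hz).1.trans (le_max_left _ _),
        (hb z hz).2.trans (le_max_right _ _)⟩⟩
    · have := tqInv_mem_graph (hres z hz) v
      rwa [re_pp hJ, norm_pp hJ] at this
    · have := qInv_apply_of_mem_graph (hres z hz) h1 h2
      rwa [re_pp hJ, norm_pp hJ] at this
  · have h1 := hC (pp J z) (pp_mem_paravectors hJ z) (fun h => by
      have h2 : |z.im| * Real.cos ω' < |z.re| * Real.sin ω' := mem_csector_of_pp_mem hω'' hJ h
      have h3 : |z.re| * Real.sin ω' < |z.im| * Real.cos ω' := hz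
      linarith) (fun h => by
        have h2 := norm_pp hJ z
        rw [h, norm_zero] at h2
        exact ne_zero_of_mem_cocone hz (norm_eq_zero.1 h2.symm))
    rw [norm_pp hJ] at h1
    rw [sResolvent_pp hJ] at h1
    exact h1

end Operators

/-! ## Slice hyperholomorphic functions and holomorphic components -/

section CauchyRiemann

theorem hasFDerivAt_re_im {F : ℂ → ℂ} {d : ℂ} {x : ℝ × ℝ} (h : HasDerivAt F d ⟨x.1, x.2⟩) :
    ∃ u' v' : ℝ × ℝ →L[ℝ] ℝ, HasFDerivAt (fun y : ℝ × ℝ => (F ⟨y.1, y.2⟩).re) u' x ∧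
      HasFDerivAt (fun y : ℝ × ℝ => (F ⟨y.1, y.2⟩).im) v' x ∧
      u' (1, 0) = v' (0, 1) ∧ u' (0, 1) = -v' (1, 0) := by
  have h1 : HasFDerivAt (fun y : ℝ × ℝ => F ⟨y.1, y.2⟩) _ x :=
    (h.hasFDerivAt.restrictScalars ℝ).comp (f := Complex.equivRealProdCLM.symm) x
      Complex.equivRealProdCLM.symm.hasFDerivAt
  refine ⟨_, _, Complex.reCLM.hasFDerivAt.comp x h1, Complex.imCLM.hasFDerivAt.comp x h1, ?_, ?_⟩
  · simp
  · simp

theorem differentiableAt_of_cauchyRiemann {u v : ℝ × ℝ → ℝ} {z : ℂ}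
    {u' v' : ℝ × ℝ →L[ℝ] ℝ} (hu : HasFDerivAt u u' (z.re, z.im))
    (hv : HasFDerivAt v v' (z.re, z.im)) (h1 : u' (1, 0) = v' (0, 1))
    (h2 : u' (0, 1) = -v' (1, 0)) :
    DifferentiableAt ℂ (fun w : ℂ => (⟨u (w.re, w.im), v (w.re, w.im)⟩ : ℂ)) z := by
  have e1 : HasFDerivAt (fun w : ℂ => (u (w.re, w.im), v (w.re, w.im))) _ z :=
    (hu.prodMk hv).comp (f := Complex.equivRealProdCLM) z Complex.equivRealProdCLM.hasFDerivAt
  have e2 : HasFDerivAt (fun w : ℂ => (⟨u (w.re, w.im), v (w.re, w.im)⟩ : ℂ)) _ z :=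
    Complex.equivRealProdCLM.symm.hasFDerivAt.comp z e1
  rw [differentiableAt_complex_iff_differentiableAt_real]
  refine ⟨e2.differentiableAt, ?_⟩
  rw [e2.fderiv]
  apply Complex.ext
  · simp [h2]
  · simp [h1]

end CauchyRiemann

variable {n : ℕ}

/-- The Clifford number formed by the real parts of a family of complex coefficients. -/
def reCl (c : Finset (Fin n) → ℂ) : Cl n := WithLp.toLp 2 fun A => (c A).re

/-- The Clifford number formed by the imaginary parts of a family of complex coefficients. -/
def imCl (c : Finset (Fin n) → ℂ) : Cl n := WithLp.toLp 2 fun A => (c A).im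

theorem sum_pp_mul_basisElt (J : Cl n) (c : Finset (Fin n) → ℂ) :
    ∑ A, pp J (c A) * basisElt A = reCl c + J * imCl c := by
  rw [cl_eq_sum (reCl c), cl_eq_sum (imCl c), cl_mul_sum, ← Finset.sum_add_distrib]
  refine Finset.sum_congr rfl fun A _ => ?_
  rw [pp_eq, cl_add_mul, cl_smul_mul, cl_smul_mul, cl_one_mul, cl_mul_smul]
  rfl

/-- `f` is given on the double sector by the components `F A`. -/
def HasComponents (θ : ℝ) (f : Cl n → Cl n) (F : Finset (Fin n) → ℂ → ℂ) : Prop :=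
  ∀ z ∈ csector θ, ∀ J ∈ unitSphere n, f (pp J z) = ∑ A, pp J (F A z) * basisElt A

/-- `g` acts in every plane `ℂ_J` as the function `G` of a complex variable. -/
def HasComponent (θ : ℝ) (g : Cl n → Cl n) (G : ℂ → ℂ) : Prop :=
  ∀ z ∈ csector θ, ∀ J ∈ unitSphere n, g (pp J z) = pp J (G z)

theorem pp_zero (J : Cl n) : pp J 0 = 0 := by simp [pp_eq]

theorem cl_zero_mul (a : Cl n) : 0 * a = 0 := by
  have := cl_smul_mul (0 : ℝ) 0 a
  simpa using this

theorem sum_ite_empty (J : Cl n) (w : ℂ) :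
    ∑ A : Finset (Fin n), pp J (if A = ∅ then w else 0) * basisElt A = pp J w := by
  rw [Finset.sum_eq_single ∅]
  · rw [if_pos rfl, basisElt_empty, cl_mul_one]
  · intro A _ hA
    rw [if_neg hA, pp_zero, cl_zero_mul]
  · simp

theorem HasComponent.hasComponents {θ : ℝ} {g : Cl n → Cl n} {G : ℂ → ℂ}
    (h : HasComponent θ g G) : HasComponents θ g fun A z => if A = ∅ then G z else 0 :=
  fun z hz J hJ => by rw [h z hz J hJ, sum_ite_empty]

theorem HasComponent.mul {θ : ℝ} {g g' : Cl n → Cl n} {G G' : ℂ → ℂ} (h : HasComponent θ g G)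
    (h' : HasComponent θ g' G') : HasComponent θ (fun s => g s * g' s) fun z => G z * G' z :=
  fun z hz J hJ => by
    change g (pp J z) * g' (pp J z) = _
    rw [pp_mul hJ, h z hz J hJ, h' z hz J hJ]

theorem HasComponent.mul_hasComponents {θ : ℝ} {g f : Cl n → Cl n} {G : ℂ → ℂ}
    {F : Finset (Fin n) → ℂ → ℂ} (h : HasComponent θ g G) (h' : HasComponents θ f F) :
    HasComponents θ (fun s => g s * f s) fun A z => G z * F A z := fun z hz J hJ => by
  change g (pp J z) * f (pp J z) = _
  rw [h z hz J hJ, h' z hz J hJ, cl_mul_sum]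
  simp only [pp_mul hJ, cl_mul_assoc]

theorem cl_neg_mul (a b : Cl n) : -a * b = -(a * b) := by
  have := cl_smul_mul (-1 : ℝ) a b
  simpa using this

/-- The components are determined by the values in a plane `ℂ_J`. -/
theorem reCl_imCl_eq {θ : ℝ} {f : Cl n → Cl n} {F : Finset (Fin n) → ℂ → ℂ}
    (h : HasComponents θ f F) {z : ℂ} (hz : z ∈ csector θ) {J : Cl n} (hJ : J ∈ unitSphere n) :
    reCl (fun A => F A z) = (2⁻¹ : ℝ) • (f (pp J z) + f (pp (-J) z)) ∧
      imCl (fun A => F A z) = (2⁻¹ : ℝ) • (J * (f (pp (-J) z) - f (pp J z))) := by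
  have h1 := h z hz J hJ
  have h2 := h z hz (-J) (neg_mem_unitSphere hJ)
  rw [sum_pp_mul_basisElt] at h1 h2
  rw [cl_neg_mul] at h2
  have h3 : J * (J * imCl fun A => F A z) = -imCl fun A => F A z := by
    rw [← cl_mul_assoc, unitSphere_mul_self hJ, cl_neg_mul, cl_one_mul]
  have h4 : f (pp (-J) z) - f (pp J z) = (-2 : ℝ) • (J * imCl fun A => F A z) := by
    rw [h1, h2]; module
  rw [h4, cl_mul_smul, h3, h1, h2]
  constructor <;> module

theorem HasComponents.unique {θ : ℝ} {f : Cl n → Cl n} {F G : Finset (Fin n) → ℂ → ℂ}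
    (hF : HasComponents θ f F) (hG : HasComponents θ f G) {J : Cl n} (hJ : J ∈ unitSphere n)
    (A : Finset (Fin n)) {z : ℂ} (hz : z ∈ csector θ) : F A z = G A z := by
  obtain ⟨h1, h2⟩ := reCl_imCl_eq hF hz hJ
  obtain ⟨h3, h4⟩ := reCl_imCl_eq hG hz hJ
  exact Complex.ext (congrArg (fun a : Cl n => a A) (h1.trans h3.symm))
    (congrArg (fun a : Cl n => a A) (h2.trans h4.symm))

/-- Each component is a fixed combination of the values of `f` at the two conjugate points `pp J z`
and `pp (-J) z`, so bounds and integrability pass from `f` to its components. -/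
theorem norm_component_le {θ : ℝ} {f : Cl n → Cl n} {F : Finset (Fin n) → ℂ → ℂ}
    (h : HasComponents θ f F) {z : ℂ} (hz : z ∈ csector θ) {J : Cl n} (hJ : J ∈ unitSphere n)
    (A : Finset (Fin n)) :
    ‖F A z‖ ≤ (1 + ‖leftMulL n ℝ J‖) * (‖f (pp J z)‖ + ‖f (pp (-J) z)‖) := by
  obtain ⟨h1, h2⟩ := reCl_imCl_eq h hz hJ
  have n1 : |(F A z).re| ≤ ‖reCl fun A => F A z‖ := PiLp.norm_apply_le (reCl fun A => F A z) A
  have n2 : |(F A z).im| ≤ ‖imCl fun A => F A z‖ := PiLp.norm_apply_le (imCl fun A => F A z) A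
  have n3 : ‖reCl fun A => F A z‖ ≤ ‖f (pp J z)‖ + ‖f (pp (-J) z)‖ := by
    rw [h1, norm_smul, Real.norm_eq_abs, abs_of_pos (by norm_num)]
    have := norm_add_le (f (pp J z)) (f (pp (-J) z))
    have := norm_nonneg (f (pp J z) + f (pp (-J) z))
    linarith
  have n4 : ‖imCl fun A => F A z‖ ≤ ‖leftMulL n ℝ J‖ * (‖f (pp J z)‖ + ‖f (pp (-J) z)‖) := by
    rw [h2, norm_smul, Real.norm_eq_abs, abs_of_pos (by norm_num)]
    have a1 : ‖J * (f (pp (-J) z) - f (pp J z))‖ ≤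
        ‖leftMulL n ℝ J‖ * ‖f (pp (-J) z) - f (pp J z)‖ := (leftMulL n ℝ J).le_opNorm _
    have a2 : ‖leftMulL n ℝ J‖ * ‖f (pp (-J) z) - f (pp J z)‖ ≤
        ‖leftMulL n ℝ J‖ * (‖f (pp (-J) z)‖ + ‖f (pp J z)‖) := by
      gcongr; exact norm_sub_le _ _
    have := norm_nonneg (J * (f (pp (-J) z) - f (pp J z)))
    rw [add_comm ‖f (pp J z)‖]
    linarith
  have := Complex.norm_le_abs_re_add_abs_im (F A z)
  linarith

theorem norm_sum_pp_mul_basisElt_le (n : ℕ) : ∃ K : ℝ, 0 ≤ K ∧ ∀ J ∈ unitSphere n,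
    ∀ c : Finset (Fin n) → ℂ, ‖∑ A, pp J (c A) * basisElt A‖ ≤ K * ∑ A, ‖c A‖ := by
  refine ⟨‖leftMulL n ℝ‖, norm_nonneg (leftMulL n ℝ), fun J hJ c => ?_⟩
  rw [Finset.mul_sum]
  refine (norm_sum_le _ _).trans (Finset.sum_le_sum fun A _ => ?_)
  have h1 : ‖pp J (c A) * basisElt A‖ ≤ ‖leftMulL n ℝ‖ * ‖pp J (c A)‖ * ‖basisElt A‖ :=
    (leftMulL n ℝ).le_opNorm₂ _ _
  have h2 : ‖(basisElt A : Cl n)‖ = 1 := by simp [basisElt]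
  rwa [norm_pp hJ, h2, mul_one] at h1

/-- Holomorphic functions on the double sector that are real on the real axis. -/
structure Holo (θ : ℝ) (F : ℂ → ℂ) : Prop where
  diff : DifferentiableOn ℂ F (csector θ)
  map_conj : ∀ z ∈ csector θ, F (conj z) = conj (F z)

theorem HBdd.holo {θ : ℝ} {F : ℂ → ℂ} (h : HBdd θ F) : Holo θ F := ⟨h.diff, h.map_conj⟩

theorem Holo.mul {θ : ℝ} {F G : ℂ → ℂ} (hF : Holo θ F) (hG : Holo θ G) :
    Holo θ fun z => F z * G z :=
  ⟨hF.diff.mul hG.diff, fun z hz => by rw [hF.map_conj z hz, hG.map_conj z hz, map_mul]⟩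

theorem holo_zero (θ : ℝ) : Holo θ fun _ => 0 :=
  ⟨differentiableOn_const _, fun _ _ => (map_zero _).symm⟩

theorem fderiv_cl_apply {E : Type*} [NormedAddCommGroup E] [NormedSpace ℝ E] {f : E → Cl n} {x : E}
    (hf : DifferentiableAt ℝ f x) (h : E) (A : Finset (Fin n)) :
    fderiv ℝ f x h A = fderiv ℝ (fun y => f y A) x h := by
  have h1 : HasFDerivAt (fun y => f y A) _ x :=
    (PiLp.proj (𝕜 := ℝ) 2 (fun _ : Finset (Fin n) => ℝ) A).hasFDerivAt.comp x hf.hasFDerivAt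
  rw [h1.fderiv]
  rfl

theorem sliceDomain_eq {θ : ℝ} (hθ : θ ∈ Ioo 0 (Real.pi / 2)) {J : Cl n} (hJ : J ∈ unitSphere n) :
    sliceDomain (doubleSector n θ) = Complex.equivRealProdCLM.symm ⁻¹' csector θ :=
  Set.ext fun x => mem_sliceDomain_iff hθ hJ x

theorem isOpen_sliceDomain {θ : ℝ} (hθ : θ ∈ Ioo 0 (Real.pi / 2)) {J : Cl n}
    (hJ : J ∈ unitSphere n) : IsOpen (sliceDomain (doubleSector n θ)) := by
  rw [sliceDomain_eq hθ hJ]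
  exact (isOpen_csector θ).preimage Complex.equivRealProdCLM.symm.continuous

/-- The holomorphic components of a slice hyperholomorphic function. -/
theorem IsSliceWith.holo {θ : ℝ} (hθ : θ ∈ Ioo 0 (Real.pi / 2)) {J : Cl n} (hJ : J ∈ unitSphere n)
    {f : Cl n → Cl n} {f₀ f₁ : ℝ × ℝ → Cl n} (h : IsSliceWith (doubleSector n θ) f f₀ f₁)
    (A : Finset (Fin n)) :
    Holo θ fun z => (⟨f₀ (z.re, z.im) A, f₁ (z.re, z.im) A⟩ : ℂ) := by
  have hmem : ∀ z ∈ csector θ, (z.re, z.im) ∈ sliceDomain (doubleSector n θ) := fun z hz =>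
    (mem_sliceDomain_iff hθ hJ _).2 hz
  refine ⟨fun z hz => ?_, fun z hz => ?_⟩
  · have hn := (isOpen_sliceDomain hθ hJ).mem_nhds (hmem z hz)
    have d0 := (h.contDiffOn_fst.contDiffAt hn).differentiableAt one_ne_zero
    have d1 := (h.contDiffOn_snd.contDiffAt hn).differentiableAt one_ne_zero
    have p : ∀ g : ℝ × ℝ → Cl n, DifferentiableAt ℝ g (z.re, z.im) →
        DifferentiableAt ℝ (fun y => g y A) (z.re, z.im) := fun g hg =>
      (PiLp.proj (𝕜 := ℝ) 2 (fun _ : Finset (Fin n) => ℝ) A).differentiableAt.comp _ hg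
    refine (differentiableAt_of_cauchyRiemann (p _ d0).hasFDerivAt (p _ d1).hasFDerivAt
      ?_ ?_).differentiableWithinAt
    · rw [← fderiv_cl_apply d0, ← fderiv_cl_apply d1, h.cauchyRiemann₁ _ (hmem z hz)]
    · rw [← fderiv_cl_apply d0, ← fderiv_cl_apply d1, h.cauchyRiemann₂ _ (hmem z hz)]
      rfl
  · apply Complex.ext
    · simp [h.even _ (hmem z hz)]
    · simp [h.odd _ (hmem z hz)]

theorem IsSliceWith.hasComponents {θ : ℝ} (hθ : θ ∈ Ioo 0 (Real.pi / 2))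
    {f : Cl n → Cl n} {f₀ f₁ : ℝ × ℝ → Cl n} (h : IsSliceWith (doubleSector n θ) f f₀ f₁) :
    HasComponents θ f fun A z => (⟨f₀ (z.re, z.im) A, f₁ (z.re, z.im) A⟩ : ℂ) := by
  intro z hz J hJ
  rw [sum_pp_mul_basisElt]
  exact h.repr (z.re, z.im) ((mem_sliceDomain_iff hθ hJ _).2 hz) J hJ

theorem HasComponents.isSliceWith {θ : ℝ} (hθ : θ ∈ Ioo 0 (Real.pi / 2)) {J : Cl n}
    (hJ : J ∈ unitSphere n) {f : Cl n → Cl n} {F : Finset (Fin n) → ℂ → ℂ}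
    (h : HasComponents θ f F) (hF : ∀ A, Holo θ (F A)) :
    IsSliceWith (doubleSector n θ) f (fun x => reCl fun A => F A ⟨x.1, x.2⟩)
      (fun x => imCl fun A => F A ⟨x.1, x.2⟩) := by
  have hmem : ∀ x ∈ sliceDomain (doubleSector n θ), (⟨x.1, x.2⟩ : ℂ) ∈ csector θ := fun x hx =>
    (mem_sliceDomain_iff hθ hJ x).1 hx
  have hC : ∀ A, ContDiffOn ℝ 1 (fun x : ℝ × ℝ => F A ⟨x.1, x.2⟩)
      (sliceDomain (doubleSector n θ)) := fun A => by
    have h1 : ContDiffOn ℝ 1 (F A) (csector θ) :=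
      ((hF A).diff.contDiffOn (isOpen_csector θ)).restrict_scalars ℝ
    rw [sliceDomain_eq hθ hJ]
    exact h1.comp (f := Complex.equivRealProdCLM.symm)
      Complex.equivRealProdCLM.symm.contDiff.contDiffOn fun x hx => hx
  have c0 : ContDiffOn ℝ 1 (fun x : ℝ × ℝ => reCl fun A => F A ⟨x.1, x.2⟩)
      (sliceDomain (doubleSector n θ)) :=
    contDiffOn_euclidean.2 fun A => Complex.reCLM.contDiff.comp_contDiffOn (hC A)
  have c1 : ContDiffOn ℝ 1 (fun x : ℝ × ℝ => imCl fun A => F A ⟨x.1, x.2⟩)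
      (sliceDomain (doubleSector n θ)) :=
    contDiffOn_euclidean.2 fun A => Complex.imCLM.contDiff.comp_contDiffOn (hC A)
  have hd : ∀ g : ℝ × ℝ → Cl n, ContDiffOn ℝ 1 g (sliceDomain (doubleSector n θ)) →
      ∀ x ∈ sliceDomain (doubleSector n θ), DifferentiableAt ℝ g x := fun g hg x hx =>
    (hg.contDiffAt ((isOpen_sliceDomain hθ hJ).mem_nhds hx)).differentiableAt one_ne_zero
  have hCR : ∀ x ∈ sliceDomain (doubleSector n θ), ∀ A, HasDerivAt (F A)
      (deriv (F A) ⟨x.1, x.2⟩) ⟨x.1, x.2⟩ := fun x hx A =>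
    ((hF A).diff.differentiableAt ((isOpen_csector θ).mem_nhds (hmem x hx))).hasDerivAt
  have hrc : ∀ x ∈ sliceDomain (doubleSector n θ), ∀ A,
      F A ⟨x.1, -x.2⟩ = conj (F A ⟨x.1, x.2⟩) := fun x hx A => (hF A).map_conj _ (hmem x hx)
  refine ⟨c0, c1, fun x hx J' hJ' => ?_, fun x hx => ?_, fun x hx => ?_, fun x hx => ?_,
    fun x hx => ?_⟩
  · rw [← sum_pp_mul_basisElt]
    exact h ⟨x.1, x.2⟩ (hmem x hx) J' hJ'
  · ext A
    change (F A ⟨x.1, -x.2⟩).re = (F A ⟨x.1, x.2⟩).re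
    rw [hrc x hx, Complex.conj_re]
  · ext A
    change (F A ⟨x.1, -x.2⟩).im = -(F A ⟨x.1, x.2⟩).im
    rw [hrc x hx, Complex.conj_im]
  · ext A
    rw [fderiv_cl_apply (hd _ c0 x hx), fderiv_cl_apply (hd _ c1 x hx)]
    obtain ⟨u', v', hu, hv, h1, -⟩ := hasFDerivAt_re_im (hCR x hx A)
    change fderiv ℝ (fun y : ℝ × ℝ => (F A ⟨y.1, y.2⟩).re) x _ =
      fderiv ℝ (fun y : ℝ × ℝ => (F A ⟨y.1, y.2⟩).im) x _
    rw [hu.fderiv, hv.fderiv, h1]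
  · ext A
    rw [PiLp.neg_apply, fderiv_cl_apply (hd _ c0 x hx), fderiv_cl_apply (hd _ c1 x hx)]
    obtain ⟨u', v', hu, hv, -, h1⟩ := hasFDerivAt_re_im (hCR x hx A)
    change fderiv ℝ (fun y : ℝ × ℝ => (F A ⟨y.1, y.2⟩).re) x _ =
      -fderiv ℝ (fun y : ℝ × ℝ => (F A ⟨y.1, y.2⟩).im) x _
    rw [hu.fderiv, hv.fderiv, h1]

/-- The Cauchy-Riemann system for `f₀`, `f₁` decouples into one complex equation for each basis
element, and the parity conditions become symmetry under conjugation. -/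
theorem sh_iff {θ : ℝ} (hθ : θ ∈ Ioo 0 (Real.pi / 2)) {J : Cl n} (hJ : J ∈ unitSphere n)
    {f : Cl n → Cl n} :
    SH (doubleSector n θ) f ↔ ∃ F, HasComponents θ f F ∧ ∀ A, Holo θ (F A) :=
  ⟨fun ⟨_, _, h⟩ => ⟨_, h.hasComponents hθ, h.holo hθ hJ⟩,
    fun ⟨_, h, hF⟩ => ⟨_, _, h.isSliceWith hθ hJ hF⟩⟩

theorem intrinsic_iff {θ : ℝ} (hθ : θ ∈ Ioo 0 (Real.pi / 2)) {J : Cl n} (hJ : J ∈ unitSphere n)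
    {g : Cl n → Cl n} :
    Intrinsic (doubleSector n θ) g ↔ ∃ G, HasComponent θ g G ∧ Holo θ G := by
  constructor
  · rintro ⟨u, v, h⟩
    refine ⟨fun z => ⟨u (z.re, z.im), v (z.re, z.im)⟩, fun z hz J' hJ' => ?_, ?_⟩
    · have := h.repr (z.re, z.im) ((mem_sliceDomain_iff hθ hJ _).2 hz) J' hJ'
      rw [cl_mul_smul, cl_mul_one] at this
      exact this
    · have := h.holo hθ hJ ∅
      simpa [cl_one_apply] using this
  · rintro ⟨G, h, hG⟩
    refine ⟨fun x => (G ⟨x.1, x.2⟩).re, fun x => (G ⟨x.1, x.2⟩).im, ?_⟩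
    have := h.hasComponents.isSliceWith hθ hJ fun A => by
      by_cases hA : A = ∅
      · simpa [hA] using hG
      · simpa [hA] using holo_zero θ
    convert this using 1
    · funext x; ext A
      simp only [reCl, PiLp.smul_apply, cl_one_apply]
      split_ifs <;> simp
    · funext x; ext A
      simp only [imCl, PiLp.smul_apply, cl_one_apply]
      split_ifs <;> simp

theorem Decays.hZero {θ : ℝ} (hθ : θ ∈ Ioo 0 (Real.pi / 2)) {J : Cl n} (hJ : J ∈ unitSphere n)
    {f : Cl n → Cl n} {F : Finset (Fin n) → ℂ → ℂ} (hf : Decays θ f) (h : HasComponents θ f F)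
    (A : Finset (Fin n)) (hF : Holo θ (F A)) : HZero θ (F A) := by
  obtain ⟨⟨C, hC⟩, hi⟩ := hf
  have hb : HBdd θ (F A) := by
    refine ⟨hF.diff, hF.map_conj, (1 + ‖leftMulL n ℝ J‖) * (C + C), fun z hz => ?_⟩
    refine (norm_component_le h hz hJ A).trans ?_
    gcongr
    · exact hC _ (pp_mem_doubleSector hθ hJ hz)
    · exact hC _ (pp_mem_doubleSector hθ (neg_mem_unitSphere hJ) hz)
  refine ⟨hb, fun ψ hψ => ?_⟩
  refine Integrable.mono' (((hi J hJ ψ hψ).add (hi (-J) (neg_mem_unitSphere hJ) ψ hψ)).const_mul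
    (1 + ‖leftMulL n ℝ J‖)) ?_ ?_
  · exact ContinuousOn.aestronglyMeasurable
      ((hb.continuousOn_ray hθ hψ).norm.div continuousOn_id fun t ht => ne_of_gt ht)
      measurableSet_Ioi
  · refine (ae_restrict_iff' measurableSet_Ioi).2 (ae_of_all _ fun t ht => ?_)
    have ht' : (0 : ℝ) < t := ht
    rw [Real.norm_eq_abs, abs_of_nonneg (by positivity), Pi.add_apply, polar_eq_pp, polar_eq_pp,
      ← add_div, ← mul_div_assoc]
    gcongr
    exact norm_component_le h (ray_mem_csector_of_mem_angles hθ hψ ht) hJ A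

theorem HasComponents.decays {θ : ℝ} (hθ : θ ∈ Ioo 0 (Real.pi / 2))
    {f : Cl n → Cl n} {F : Finset (Fin n) → ℂ → ℂ} (h : HasComponents θ f F)
    (hF : ∀ A, HZero θ (F A)) : Decays θ f := by
  obtain ⟨K, hK0, hK⟩ := norm_sum_pp_mul_basisElt_le n
  choose C hC using fun A => (hF A).bdd
  refine ⟨⟨K * ∑ A, C A, fun s hs => ?_⟩, fun J hJ ψ hψ => ?_⟩
  · obtain ⟨J, hJ, z, hz, rfl⟩ := exists_pp_of_mem_doubleSector hθ hs
    rw [h z hz J hJ]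
    refine (hK J hJ _).trans ?_
    gcongr with A
    exact hC A z hz
  · have hmem : ∀ t ∈ Ioi (0 : ℝ), ray ψ t ∈ csector θ := fun t ht =>
      ray_mem_csector_of_mem_angles hθ hψ ht
    have hpp : Continuous (pp J) := by
      have : pp J = fun z => z.re • (1 : Cl n) + z.im • J := rfl
      rw [this]; fun_prop
    have hc : ContinuousOn (fun t => f (polar J t ψ)) (Ioi 0) := by
      have : ContinuousOn (fun t => ∑ A, leftMulL n ℝ (pp J (F A (ray ψ t))) (basisElt A))
          (Ioi 0) := by
        refine continuousOn_finsetSum _ fun A _ => ?_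
        exact ((leftMulL n ℝ).continuous.comp_continuousOn (hpp.comp_continuousOn
          ((hF A).continuousOn_ray hθ hψ))).clm_apply continuousOn_const
      refine this.congr fun t ht => ?_
      rw [polar_eq_pp, h _ (hmem t ht) J hJ]
      rfl
    have hsum : IntegrableOn (fun t => ∑ A, ‖F A (ray ψ t)‖ / t) (Ioi 0) :=
      integrable_finsetSum _ fun A _ => (hF A).integrable ψ hψ
    refine Integrable.mono' (hsum.const_mul K) ?_ ?_
    · exact ContinuousOn.aestronglyMeasurable
        (hc.norm.div continuousOn_id fun t ht => ne_of_gt ht) measurableSet_Ioi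
    · refine (ae_restrict_iff' measurableSet_Ioi).2 (ae_of_all _ fun t ht => ?_)
      have ht' : (0 : ℝ) < t := ht
      rw [Real.norm_eq_abs, abs_of_nonneg (by positivity), polar_eq_pp, h _ (hmem t ht) J hJ,
        ← Finset.sum_div, ← mul_div_assoc]
      gcongr
      exact hK J hJ _

theorem shZero_iff {θ : ℝ} (hθ : θ ∈ Ioo 0 (Real.pi / 2)) {J : Cl n} (hJ : J ∈ unitSphere n)
    {f : Cl n → Cl n} : SHZero θ f ↔ ∃ F, HasComponents θ f F ∧ ∀ A, HZero θ (F A) := by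
  constructor
  · rintro ⟨h1, h2⟩
    obtain ⟨F, hF, hF'⟩ := (sh_iff hθ hJ).1 h1
    exact ⟨F, hF, fun A => h2.hZero hθ hJ hF A (hF' A)⟩
  · rintro ⟨F, hF, hF'⟩
    exact ⟨(sh_iff hθ hJ).2 ⟨F, hF, fun A => (hF' A).holo⟩, hF.decays hθ hF'⟩

theorem hZero_zero (θ : ℝ) : HZero θ fun _ => 0 :=
  ⟨by simpa using hBdd_const θ 0, fun _ _ => by simp⟩

theorem nZero_iff {θ : ℝ} (hθ : θ ∈ Ioo 0 (Real.pi / 2)) {J : Cl n} (hJ : J ∈ unitSphere n)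
    {g : Cl n → Cl n} : NZero θ g ↔ ∃ G, HasComponent θ g G ∧ HZero θ G := by
  constructor
  · rintro ⟨h1, h2⟩
    obtain ⟨G, hG, hG'⟩ := (intrinsic_iff hθ hJ).1 h1
    refine ⟨G, hG, ?_⟩
    simpa using h2.hZero hθ hJ hG.hasComponents ∅ (by simpa using hG')
  · rintro ⟨G, hG, hG'⟩
    refine ⟨(intrinsic_iff hθ hJ).2 ⟨G, hG, hG'.holo⟩, hG.hasComponents.decays hθ fun A => ?_⟩
    by_cases hA : A = ∅
    · simpa [hA] using hG'
    · simpa [hA] using hZero_zero θ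

/-! ## The functional calculi in terms of components -/

theorem opKernel_conj {A : Type*} [NormedRing A] [NormedAlgebra ℝ A] {q p : ℂ → A}
    (hq : ∀ z, q (conj z) = q z) (hp : ∀ z, p (conj z) = p z) (c z : ℂ) :
    opKernel q p (conj c) (conj z) = -opKernel q p c z := by
  simp only [opKernel, hq, hp, ← map_mul, Complex.conj_im]
  module

/-- Passing to the conjugate point reverses the sign of the part without `L` and preserves the part
with `L`. In the difference of two mirrored rays the `L` part cancels. -/
theorem opKernel_conj_add_mul {A : Type*} [NormedRing A] [NormedAlgebra ℝ A] {q p : ℂ → A}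
    (hq : ∀ z, q (conj z) = q z) (hp : ∀ z, p (conj z) = p z) (a b z : ℂ) (L E : A) :
    (opKernel q p (conj a) (conj z) + opKernel q p (conj (-b)) (conj z) * L) * E =
      (opKernel q p a z + opKernel q p b z * L) * E - (2 : ℝ) • (opKernel q p a z * E) := by
  have e3 : opKernel q p (-b) z = -opKernel q p b z := by
    rw [← opKernelL_apply, map_neg, opKernelL_apply]
  rw [opKernel_conj hq hp, opKernel_conj hq hp, e3, neg_neg, ← smul_mul_assoc, ← sub_mul]
  congr 1
  module

theorem ResolventPair.integral_sub_sum_rayPart {A : Type*} [NormedRing A] [NormedAlgebra ℝ A]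
    {ι : Type*} [Fintype ι] {q p : ℂ → A} {ω θ ψ : ℝ} (h : ResolventPair ω q p)
    (hω : ω ∈ Ioo 0 (Real.pi / 2)) (hθ : θ ∈ Ioo 0 (Real.pi / 2))
    (hψ : ψ ∈ Ioo ω (Real.pi - ω)) (hψ' : ψ ∈ angles θ) {F : ι → ℂ → ℂ} (hF : ∀ i, HZero θ (F i))
    (L : A) (E : ι → A) :
    ∫ t in Ioi (0 : ℝ), ((∑ i, (opKernel q p (Complex.exp (ψ * Complex.I) * F i (ray ψ t)) (ray ψ t)
        + opKernel q p (Complex.exp (ψ * Complex.I) * (-Complex.I * F i (ray ψ t))) (ray ψ t) * L) *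
            E i) - (2 : ℝ) • ∑ i, opKernel q p
        (Complex.exp (ψ * Complex.I) * F i (ray ψ t)) (ray ψ t) * E i) =
      (∫ t in Ioi (0 : ℝ), ∑ i,
        (opKernel q p (Complex.exp (ψ * Complex.I) * F i (ray ψ t)) (ray ψ t)
        + opKernel q p (Complex.exp (ψ * Complex.I) * (-Complex.I * F i (ray ψ t))) (ray ψ t) * L) *
            E i) - (2 : ℝ) • ∑ i, rayPart q p ψ (F i) * E i := by
  have i1 := fun i => h.integrableOn_opKernel_hZero hω hθ hψ hψ' (hF i)
  have i2 := fun i => h.integrableOn_opKernel hω hψ (F := fun z => -Complex.I * F i z)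
    (continuousOn_const.mul ((hF i).continuousOn_ray hθ hψ'))
    (by simpa using (hF i).integrable ψ hψ')
  have i3 := fun i => (i1 i).mul_const (E i)
  have i4 := fun i => ((i1 i).add ((i2 i).mul_const L)).mul_const (E i)
  refine (integral_sub (integrable_finsetSum _ fun i _ => i4 i)
    ((integrable_finsetSum _ fun i _ => i3 i).smul (2 : ℝ))).trans (congrArg₂ _ rfl ?_)
  refine (integral_smul _ _).trans (congrArg _ ((integral_finsetSum _ fun i _ => i3 i).trans ?_))
  exact Finset.sum_congr rfl fun i _ => integral_mul_const_of_integrable (i1 i)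

section

variable {n : ℕ} {W : Type*} [NormedAddCommGroup W] [NormedSpace ℝ W] [CompleteSpace W]

/-- The operator `Q_s[T]⁻¹` as a function on `ℂ_J`. -/
def qFun (T : ClosedOp n W) (J : Cl n) (z : ℂ) : CliffordModule n W →L[ℝ] CliffordModule n W :=
  qInv T (pp J z)

/-- The operator `T Q_s[T]⁻¹` as a function on `ℂ_J`. -/
def tqFun (T : ClosedOp n W) (J : Cl n) (z : ℂ) : CliffordModule n W →L[ℝ] CliffordModule n W :=
  tqInv T (pp J z)

omit [CompleteSpace W] in
theorem qFun_I (T : ClosedOp n W) (J : Cl n) : qFun T J Complex.I = qInv T J := by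
  rw [qFun, pp_I]

variable {T : ClosedOp n W} {J : Cl n}

/-- The factor `-I * c` stems from `ds_J = ds / J`. Splitting off `leftMul J` leaves two kernels
built from `q` and `p` alone, as in the calculus for intrinsic functions. -/
theorem sResolvent_mul_leftMul_pp (hJ : J ∈ unitSphere n) (z c : ℂ) :
    sResolvent T (pp J z) ∘L leftMul (pp J (-Complex.I * c)) =
      opKernel (qFun T J) (tqFun T J) c z +
        opKernel (qFun T J) (tqFun T J) (-Complex.I * c) z * leftMul J := by
  have hJJ : ∀ v : CliffordModule n W, leftMul J (leftMul J v) = -v := fun v => by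
    rw [← leftMul_mul_apply, unitSphere_mul_self hJ, ← leftMulL_apply, map_neg, leftMulL_apply,
      leftMul_one]
    rfl
  rw [sResolvent_pp hJ, leftMul_pp]
  refine ContinuousLinearMap.ext fun v => ?_
  simp only [opKernel, sub_apply, add_apply, smul_apply, ContinuousLinearMap.comp_apply,
    mul_apply_eq_comp, ContinuousLinearMap.id_apply, map_add, map_smul, hJJ, map_neg, qFun, tqFun,
    Complex.mul_re, Complex.mul_im, Complex.neg_re, Complex.neg_im, Complex.I_re, Complex.I_im,
    Complex.conj_re, Complex.conj_im]
  module

/-- The integrand of `rayIntegral` in terms of components. -/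
theorem sResolvent_mul_component {θ : ℝ} (hJ : J ∈ unitSphere n) {f : Cl n → Cl n}
    {F : Finset (Fin n) → ℂ → ℂ} (h : HasComponents θ f F) {ψ t : ℝ} (ht : ray ψ t ∈ csector θ) :
    sResolvent T (polar J t ψ) ∘L
        leftMul (planePoint J (Real.sin ψ) (-Real.cos ψ) * f (polar J t ψ)) =
      ∑ A, (opKernel (qFun T J) (tqFun T J) (Complex.exp (ψ * Complex.I) * F A (ray ψ t)) (ray ψ t)
        + opKernel (qFun T J) (tqFun T J)
          (Complex.exp (ψ * Complex.I) * (-Complex.I * F A (ray ψ t))) (ray ψ t) * leftMul J) *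
            leftMul (basisElt A) := by
  have h1 : planePoint J (Real.sin ψ) (-Real.cos ψ) =
      pp J (-Complex.I * Complex.exp (ψ * Complex.I)) := by
    simp [pp, Complex.exp_ofReal_mul_I_re, Complex.exp_ofReal_mul_I_im]
  rw [polar_eq_pp, h _ ht J hJ, h1, cl_mul_sum, leftMul_sum]
  change sResolvent T (pp J (ray ψ t)) * _ = _
  rw [Finset.mul_sum]
  refine Finset.sum_congr rfl fun A _ => ?_
  rw [← cl_mul_assoc, ← pp_mul hJ, leftMul_mul, mul_assoc, mul_left_comm (Complex.exp _),
    ← sResolvent_mul_leftMul_pp hJ]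
  rfl

theorem sResolvent_mul_component_conj {θ : ℝ} (hJ : J ∈ unitSphere n) {f : Cl n → Cl n}
    {F : Finset (Fin n) → ℂ → ℂ} (h : HasComponents θ f F) (hF : ∀ A, HZero θ (F A))
    (hq : ∀ z, qFun T J (conj z) = qFun T J z) (hp : ∀ z, tqFun T J (conj z) = tqFun T J z)
    {ψ t : ℝ} (ht : ray ψ t ∈ csector θ) :
    sResolvent T (polar J t (-ψ)) ∘L
        leftMul (planePoint J (Real.sin (-ψ)) (-Real.cos (-ψ)) * f (polar J t (-ψ))) =
      sResolvent T (polar J t ψ) ∘L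
        leftMul (planePoint J (Real.sin ψ) (-Real.cos ψ) * f (polar J t ψ)) -
      (2 : ℝ) • ∑ A, opKernel (qFun T J) (tqFun T J)
        (Complex.exp (ψ * Complex.I) * F A (ray ψ t)) (ray ψ t) * leftMul (basisElt A) := by
  have hr : ray (-ψ) t = conj (ray ψ t) := ray_neg ψ t
  have he : Complex.exp ((-ψ : ℝ) * Complex.I) = conj (Complex.exp (ψ * Complex.I)) := by
    rw [← Complex.exp_conj]; simp
  rw [sResolvent_mul_component hJ h ht,
    sResolvent_mul_component hJ h (hr ▸ conj_mem_csector ht), Finset.smul_sum,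
    ← Finset.sum_sub_distrib]
  refine Finset.sum_congr rfl fun A _ => ?_
  have e1 : Complex.exp ((-ψ : ℝ) * Complex.I) * F A (ray (-ψ) t) =
      conj (Complex.exp (ψ * Complex.I) * F A (ray ψ t)) := by
    rw [hr, he, (hF A).map_conj _ ht, map_mul]
  have e2 : Complex.exp ((-ψ : ℝ) * Complex.I) * (-Complex.I * F A (ray (-ψ) t)) =
      conj (-(Complex.exp (ψ * Complex.I) * (-Complex.I * F A (ray ψ t)))) := by
    rw [mul_left_comm, e1]
    simp only [map_mul, map_neg, Complex.conj_I]
    ring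
  rw [e1, e2, hr]
  exact opKernel_conj_add_mul hq hp _ _ _ _ _

theorem rayIntegral_sub_two_pi (T : ClosedOp n W) (J : Cl n) (ψ : ℝ) (f : Cl n → Cl n) :
    rayIntegral T J (ψ - 2 * Real.pi) f = rayIntegral T J ψ f := by
  simp only [rayIntegral, polar, Real.cos_sub_two_pi, Real.sin_sub_two_pi]

theorem rayIntegral_neg {ω θ ψ : ℝ} (hω : ω ∈ Ioo 0 (Real.pi / 2)) (hθ : θ ∈ Ioo 0 (Real.pi / 2))
    (hψ : ψ ∈ Ioo ω (Real.pi - ω)) (hψ' : ψ ∈ angles θ) (hJ : J ∈ unitSphere n)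
    (hR : ResolventPair ω (qFun T J) (tqFun T J)) {f : Cl n → Cl n}
    {F : Finset (Fin n) → ℂ → ℂ} (h : HasComponents θ f F) (hF : ∀ A, HZero θ (F A)) :
    rayIntegral T J (-ψ) f = rayIntegral T J ψ f -
      (2 : ℝ) • ∑ A, rayPart (qFun T J) (tqFun T J) ψ (F A) * leftMul (basisElt A) := by
  have hmem : ∀ t ∈ Ioi (0 : ℝ), ray ψ t ∈ csector θ := fun t ht =>
    ray_mem_csector_of_mem_angles hθ hψ' ht
  have e1 : rayIntegral T J (-ψ) f = _ := setIntegral_congr_fun measurableSet_Ioi fun t ht =>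
    (sResolvent_mul_component_conj hJ h hF hR.q_conj hR.p_conj (hmem t ht)).trans
      (congrArg (· - _) (sResolvent_mul_component hJ h (hmem t ht)))
  have e2 : rayIntegral T J ψ f = _ := setIntegral_congr_fun measurableSet_Ioi fun t ht =>
    sResolvent_mul_component hJ h (hmem t ht)
  rw [e1, e2]
  exact hR.integral_sub_sum_rayPart hω hθ hψ hψ' hF _ _

/-- The four rays form two conjugate pairs, because the angle `π + φ` agrees with `-(π - φ)` modulo
`2 π`. By `rayIntegral_neg` each pair leaves only twice the intrinsic part, which turns the
prefactor `(2 π)⁻¹` into `π⁻¹`. -/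
theorem omegaCalc_eq {ω θ φ : ℝ} (hω : ω ∈ Ioo 0 (Real.pi / 2)) (hθ : θ < Real.pi / 2)
    (hφ : φ ∈ Ioo ω θ) (hJ : J ∈ unitSphere n) (hR : ResolventPair ω (qFun T J) (tqFun T J))
    {f : Cl n → Cl n} {F : Finset (Fin n) → ℂ → ℂ} (h : HasComponents θ f F)
    (hF : ∀ A, HZero θ (F A)) :
    omegaCalc T φ J f = ∑ A, holCalc (qFun T J) (tqFun T J) φ (F A) * leftMul (basisElt A) := by
  have hθ' : θ ∈ Ioo 0 (Real.pi / 2) := ⟨hω.1.trans (hφ.1.trans hφ.2), hθ⟩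
  have hφ0 := hω.1.trans hφ.1
  have h1 := rayIntegral_neg hω hθ' ⟨hφ.1, by linarith [hφ.2, hφ.1]⟩ (mem_angles_of_lt hφ0 hφ.2)
    hJ hR h hF
  have h2 := rayIntegral_neg hω hθ' (ψ := Real.pi - φ) ⟨by linarith [hφ.2, hφ.1], by linarith [hφ.1]⟩
    (pi_sub_mem_angles_of_lt hφ0 hφ.2) hJ hR h hF
  have h3 : rayIntegral T J (Real.pi + φ) f = rayIntegral T J (-(Real.pi - φ)) f := by
    rw [← rayIntegral_sub_two_pi T J (Real.pi + φ)]
    congr 1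
    ring
  rw [omegaCalc, h3, h1, h2]
  simp only [holCalc, smul_mul_assoc, sub_mul]
  rw [← Finset.smul_sum, Finset.sum_sub_distrib]
  generalize ∑ A, rayPart (qFun T J) (tqFun T J) (Real.pi - φ) (F A) * leftMul (basisElt A) = x
  generalize ∑ A, rayPart (qFun T J) (tqFun T J) φ (F A) * leftMul (basisElt A) = y
  rw [mul_inv]
  module

theorem HasBndForm.hasComponents {θ : ℝ} (hθ : θ ∈ Ioo 0 (Real.pi / 2))
    {f ft : Cl n → Cl n} {f0 finf : Cl n}
    {F : Finset (Fin n) → ℂ → ℂ} (h : HasBndForm θ f f0 finf ft) (hF : HasComponents θ ft F) :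
    HasComponents θ f fun A z => finf A + (f0 A - finf A : ℝ) * rho z + F A z := by
  intro z hz J hJ
  rw [h _ (pp_mem_doubleSector hθ hJ hz), hF z hz J hJ, paraInv_one_add_mul_self hJ]
  have e : ∀ A, pp J (finf A + (f0 A - finf A : ℝ) * rho z + F A z) * basisElt A =
      finf A • basisElt A + pp J (rho z) * ((f0 - finf) A • basisElt A) +
        pp J (F A z) * basisElt A := fun A => by
    rw [pp_add, pp_add, pp_mul hJ, pp_ofReal, pp_ofReal, cl_add_mul, cl_add_mul, cl_smul_mul,
      cl_smul_mul, cl_one_mul, cl_one_mul, cl_smul_mul, cl_mul_smul]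
    rfl
  rw [Finset.sum_congr rfl fun A _ => e A, Finset.sum_add_distrib, Finset.sum_add_distrib,
    ← cl_mul_sum, ← cl_eq_sum, ← cl_eq_sum]

/-- Only the decompositions contained in `IsExt` matter: their constants assemble into Clifford
numbers and their decaying parts into a function in `SHZero θ`. -/
theorem shBnd_of_isExt {θ φ : ℝ} (hθ : θ ∈ Ioo 0 (Real.pi / 2)) (hJ : J ∈ unitSphere n)
    {f : Cl n → Cl n} {F : Finset (Fin n) → ℂ → ℂ} (h : HasComponents θ f F)
    {X : Finset (Fin n) → CliffordModule n W →L[ℝ] CliffordModule n W}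
    (hX : ∀ A, IsExt (qFun T J) (tqFun T J) θ φ (F A) (X A)) : SHBnd θ f := by
  choose a₀ a F' hF' hF _ using hX
  let f0 : Cl n := WithLp.toLp 2 a₀
  let finf : Cl n := WithLp.toLp 2 a
  refine ⟨f0, finf, fun s => f s - (finf + paraInv (1 + s * s) * (f0 - finf)),
    (shZero_iff hθ hJ).2 ⟨F', fun z hz J' hJ' => ?_, hF'⟩, fun s _ => (add_sub_cancel _ _).symm⟩
  have h0 : HasComponents θ (fun s => finf + paraInv (1 + s * s) * (f0 - finf) + 0)
      fun A z => finf A + (f0 A - finf A : ℝ) * rho z + 0 :=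
    HasBndForm.hasComponents hθ (ft := fun _ => 0) (fun s _ => rfl) fun z _ J _ => by
      simp [pp_zero, cl_zero_mul]
  have h1 := h0 z hz J' hJ'
  simp only [add_zero] at h1
  change f (pp J' z) - _ = _
  rw [h1, h z hz J' hJ', ← Finset.sum_sub_distrib]
  refine Finset.sum_congr rfl fun A _ => ?_
  have e : F A z = (finf A + (f0 A - finf A : ℝ) * rho z) + F' A z := by
    rw [hF A z hz]; simp [f0, finf]
  rw [e, pp_add, cl_add_mul, add_sub_cancel_left]

theorem extCalc_eq {ω θ φ : ℝ} (hω : ω ∈ Ioo 0 (Real.pi / 2)) (hθ : θ < Real.pi / 2)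
    (hφ : φ ∈ Ioo ω θ) (hJ : J ∈ unitSphere n) (hR : ResolventPair ω (qFun T J) (tqFun T J))
    {f : Cl n → Cl n} {F : Finset (Fin n) → ℂ → ℂ} (h : HasComponents θ f F) (hf : SHBnd θ f) :
    ∃ X : Finset (Fin n) → CliffordModule n W →L[ℝ] CliffordModule n W,
      (∀ A, IsExt (qFun T J) (tqFun T J) θ φ (F A) (X A)) ∧
        extCalc T θ φ J f = ∑ A, X A * leftMul (basisElt A) := by
  have hθ' : θ ∈ Ioo 0 (Real.pi / 2) := ⟨hω.1.trans (hφ.1.trans hφ.2), hθ⟩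
  unfold extCalc
  rw [dif_pos hf]
  -- The decomposition selected in the definition is replaced by an arbitrary one; nothing beyond
  -- its defining property is used.
  obtain ⟨h1, h2⟩ := hf.choose_spec.choose_spec.choose_spec
  generalize hf.choose_spec.choose_spec.choose = ft at *
  generalize hf.choose_spec.choose = finf at *
  generalize hf.choose = f0 at *
  obtain ⟨F', hF, hF'⟩ := (shZero_iff hθ' hJ).1 h1
  refine ⟨_, fun A => ⟨f0 A, finf A, F' A, hF' A, fun z hz => ?_, rfl⟩, ?_⟩
  · have := h.unique (h2.hasComponents hθ' hF) hJ A hz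
    simpa using this
  · rw [omegaCalc_eq hω hθ hφ hJ hR hF hF']
    simp only [add_mul, Finset.sum_add_distrib, smul_mul_assoc, one_mul]
    congr 2
    · exact leftMul_eq_sum finf
    · rw [leftMul_eq_sum (f0 - finf), qFun_I]
      change qInv T J * _ = _
      rw [Finset.mul_sum]
      refine Finset.sum_congr rfl fun A _ => ?_
      exact (ContinuousLinearMap.comp_smul _ _ _)

theorem isExt_zero {A : Type*} [NormedRing A] [NormedAlgebra ℝ A] (q p : ℂ → A) (θ φ : ℝ) :
    IsExt q p θ φ (fun _ => 0) 0 := by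
  refine ⟨0, 0, fun _ => 0, hZero_zero θ, fun z _ => by simp, ?_⟩
  have := holCalc_const_mul q p φ 0 fun _ => 0
  simp only [mul_zero, zero_smul] at this
  simp [this]

/-- The components other than `∅` vanish, so by uniqueness their operators are zero and the sum
reduces to one intrinsic term. -/
theorem extCalc_eq_of_hasComponent {ω θ φ : ℝ} (hω : ω ∈ Ioo 0 (Real.pi / 2))
    (hθ : θ < Real.pi / 2) (hφ : φ ∈ Ioo ω θ) (hJ : J ∈ unitSphere n)
    (hR : ResolventPair ω (qFun T J) (tqFun T J)) {g : Cl n → Cl n} {G : ℂ → ℂ}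
    (h : HasComponent θ g G) (hg : SHBnd θ g) :
    IsExt (qFun T J) (tqFun T J) θ φ G (extCalc T θ φ J g) := by
  obtain ⟨X, hX, hX'⟩ := extCalc_eq hω hθ hφ hJ hR h.hasComponents hg
  have h0 : ∀ A, A ≠ ∅ → X A = 0 := fun A hA =>
    (hX A).unique ⟨hω.1.trans hφ.1, hφ.2⟩ hθ (isExt_zero _ _ _ _) fun z _ => by simp [hA]
  rw [hX', Finset.sum_eq_single ∅]
  · rw [basisElt_empty, leftMul_one]
    have h1 := hX ∅
    simp only [if_true] at h1
    have h2 : X ∅ * ContinuousLinearMap.id ℝ (CliffordModule n W) = X ∅ := mul_one _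
    rwa [h2]
  · intro A _ hA
    rw [h0 A hA, zero_mul]
  · simp

theorem nBnd_iff {θ : ℝ} (φ : ℝ) (hθ : θ ∈ Ioo 0 (Real.pi / 2)) (hJ : J ∈ unitSphere n)
    {g : Cl n → Cl n} :
    NBnd θ g ↔ ∃ G X, HasComponent θ g G ∧ IsExt (qFun T J) (tqFun T J) θ φ G X := by
  have e : ∀ (a₀ a : ℝ), ∀ z : ℂ, ∀ J' ∈ unitSphere n,
      a • (1 : Cl n) + paraInv (1 + pp J' z * pp J' z) * (a₀ • (1 : Cl n) - a • (1 : Cl n)) =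
        pp J' (a + (a₀ - a) * rho z) := fun a₀ a z J' hJ' => by
    rw [paraInv_one_add_mul_self hJ', ← sub_smul, cl_mul_smul, cl_mul_one, pp_add, pp_ofReal,
      ← Complex.ofReal_sub, pp_mul hJ', pp_ofReal, cl_smul_mul, cl_one_mul]
  constructor
  · rintro ⟨g0, ginf, gt, h1, h2⟩
    obtain ⟨G, hG, hG'⟩ := (nZero_iff hθ hJ).1 h1
    refine ⟨fun z => ginf + (g0 - ginf) * rho z + G z, _, fun z hz J' hJ' => ?_,
      g0, ginf, G, hG', fun z _ => rfl, rfl⟩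
    rw [h2 _ (pp_mem_doubleSector hθ hJ' hz), e g0 ginf z J' hJ', hG z hz J' hJ', ← pp_add]
  · rintro ⟨G, X, hG, g0, ginf, G', hG', h1, -⟩
    refine ⟨g0, ginf, fun s => g s - (ginf • (1 : Cl n) +
      paraInv (1 + s * s) * (g0 • (1 : Cl n) - ginf • (1 : Cl n))),
      (nZero_iff hθ hJ).2 ⟨G', fun z hz J' hJ' => ?_, hG'⟩, fun s _ => (add_sub_cancel _ _).symm⟩
    change g (pp J' z) - _ = _
    rw [e g0 ginf z J' hJ', hG z hz J' hJ', h1 z hz, pp_add, add_sub_cancel_left]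

theorem NBnd.shBnd {θ : ℝ} (hθ : θ ∈ Ioo 0 (Real.pi / 2)) (hJ : J ∈ unitSphere n)
    {g : Cl n → Cl n} (h : NBnd θ g) : SHBnd θ g := by
  obtain ⟨g0, ginf, gt, h1, h2⟩ := h
  obtain ⟨G, hG, hG'⟩ := (nZero_iff hθ hJ).1 h1
  refine ⟨_, _, gt, (shZero_iff hθ hJ).2 ⟨_, hG.hasComponents, fun A => ?_⟩, h2⟩
  by_cases hA : A = ∅
  · simpa [hA] using hG'
  · simpa [hA] using hZero_zero θ

end

/-! ## The product rule -/

section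

variable {n : ℕ} {W : Type*} [NormedAddCommGroup W] [NormedSpace ℝ W] [CompleteSpace W]
  {T : ClosedOp n W} {J : Cl n}

/-- Rewrites the unbounded operator as an equation between bounded ones; injectivity is what makes
the graph of the inverse the flipped graph. -/
theorem mem_graph_hInfty {θ φ : ℝ} {e f : Cl n → Cl n}
    (he : Function.Injective (extCalc T θ φ J e)) {v w : CliffordModule n W} :
    (v, w) ∈ (hInfty T θ φ J e f).graph ↔
      extCalc T θ φ J e w = extCalc T θ φ J (fun s => e s * f s) v := by
  have hk : LinearMap.ker (ofBounded (extCalc T θ φ J e)).toFun = ⊥ := by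
    refine LinearMap.ker_eq_bot.2 fun x y hxy => Subtype.ext (he ?_)
    exact hxy
  unfold hInfty
  rw [mem_graph_pcomp]
  simp only [LinearPMap.inverse_graph hk, mem_graph_ofBounded, Submodule.mem_map]
  constructor
  · rintro ⟨x, h1, ⟨y, z⟩, h2, h3⟩
    obtain ⟨rfl, rfl⟩ : z = x ∧ y = w := by simpa using h3
    rw [h1]
    exact mem_graph_ofBounded.1 h2
  · intro h
    exact ⟨_, rfl, (w, _), mem_graph_ofBounded.2 h, rfl⟩

theorem mem_domain_iff_exists_graph {V : Type*} [NormedAddCommGroup V] [NormedSpace ℝ V]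
    {A : V →ₗ.[ℝ] V} {v : V} : v ∈ A.domain ↔ ∃ w, (v, w) ∈ A.graph :=
  LinearPMap.mem_domain_iff

variable {ω θ φ : ℝ}

/-- If `a` regularizes `g` within the intrinsic class and `b` regularizes `f`, then `(a b)(g f) = (a
g)(b f)`, and `(a b)(T) = a(T) b(T)` is a composition of injective operators. -/
theorem SHReg.mul (hω : ω ∈ Ioo 0 (Real.pi / 2)) (hθ : θ < Real.pi / 2) (hφ : φ ∈ Ioo ω θ)
    (hJ : J ∈ unitSphere n) (hR : ResolventPair ω (qFun T J) (tqFun T J)) {g f : Cl n → Cl n}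
    (hg : NReg T θ φ J g) (hf : SHReg T θ φ J f) : SHReg T θ φ J fun s => g s * f s := by
  have hθ' : θ ∈ Ioo 0 (Real.pi / 2) := ⟨hω.1.trans (hφ.1.trans hφ.2), hθ⟩
  obtain ⟨hg1, a, ha1, ha2, ha3⟩ := hg
  obtain ⟨hf1, b, hb1, hb2, hb3⟩ := hf
  obtain ⟨G, hG, hG'⟩ := (intrinsic_iff hθ' hJ).1 hg1
  obtain ⟨F, hF, hF'⟩ := (sh_iff hθ' hJ).1 hf1
  obtain ⟨A, -, hA, -⟩ := (nBnd_iff (T := T) φ hθ' hJ).1 ha1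
  obtain ⟨B, -, hB, -⟩ := (nBnd_iff (T := T) φ hθ' hJ).1 hb1
  have xA := extCalc_eq_of_hasComponent hω hθ hφ hJ hR hA (ha1.shBnd hθ' hJ)
  have xB := extCalc_eq_of_hasComponent hω hθ hφ hJ hR hB (hb1.shBnd hθ' hJ)
  have xAG := extCalc_eq_of_hasComponent hω hθ hφ hJ hR (hA.mul hG) (ha2.shBnd hθ' hJ)
  obtain ⟨Y, hY, -⟩ := extCalc_eq hω hθ hφ hJ hR (hB.mul_hasComponents hF) hb2
  have xAB := hR.isExt_mul hω hφ hθ xA xB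
  have hAB : NBnd θ fun s => a s * b s := (nBnd_iff (T := T) φ hθ' hJ).2 ⟨_, _, hA.mul hB, xAB⟩
  refine ⟨(sh_iff hθ' hJ).2 ⟨_, hG.mul_hasComponents hF, fun C => hG'.mul (hF' C)⟩,
    fun s => a s * b s, hAB, ?_, ?_⟩
  · refine shBnd_of_isExt (φ := φ) (T := T) hθ' hJ
      ((hA.mul hB).mul_hasComponents (hG.mul_hasComponents hF))
      (X := fun C => extCalc T θ φ J (fun s => a s * g s) * Y C) fun C => ?_
    have h1 := hR.isExt_mul hω hφ hθ xAG (hY C)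
    convert h1 using 2
    ring
  · have h1 := (extCalc_eq_of_hasComponent hω hθ hφ hJ hR (hA.mul hB) (hAB.shBnd hθ' hJ)).unique
      ⟨hω.1.trans hφ.1, hφ.2⟩ hθ xAB fun _ _ => rfl
    rw [h1]
    exact ha3.comp hb3

theorem product_rule (hω : ω ∈ Ioo 0 (Real.pi / 2)) (hθ : θ < Real.pi / 2) (hφ : φ ∈ Ioo ω θ)
    (hJ : J ∈ unitSphere n) (hR : ResolventPair ω (qFun T J) (tqFun T J)) {g f : Cl n → Cl n}
    (hg : NReg T θ φ J g) (hf : SHReg T θ φ J f) :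
    SHReg T θ φ J (fun s => g s * f s) ∧
      ∀ e₁ e₂ e₃ : Cl n → Cl n, IsRegularizer T θ φ J e₁ f → IsRegularizer T θ φ J e₂ g →
        IsRegularizer T θ φ J e₃ (fun s => g s * f s) →
          pcomp (hInfty T θ φ J e₂ g) (hInfty T θ φ J e₁ f)
              ≤ hInfty T θ φ J e₃ (fun s => g s * f s) ∧
            (pcomp (hInfty T θ φ J e₂ g) (hInfty T θ φ J e₁ f)).domain =
              (hInfty T θ φ J e₃ (fun s => g s * f s)).domain ⊓ (hInfty T θ φ J e₁ f).domain := by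
  refine ⟨SHReg.mul hω hθ hφ hJ hR hg hf, fun e₁ e₂ e₃ h1 h2 h3 => ?_⟩
  have hθ' : θ ∈ Ioo 0 (Real.pi / 2) := ⟨hω.1.trans (hφ.1.trans hφ.2), hθ⟩
  obtain ⟨G, hG, -⟩ := (intrinsic_iff hθ' hJ).1 hg.1
  obtain ⟨F, hF, -⟩ := (sh_iff hθ' hJ).1 hf.1
  obtain ⟨E₁, -, hE₁, -⟩ := (nBnd_iff (T := T) φ hθ' hJ).1 h1.1
  obtain ⟨E₂, -, hE₂, -⟩ := (nBnd_iff (T := T) φ hθ' hJ).1 h2.1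
  obtain ⟨E₃, -, hE₃, -⟩ := (nBnd_iff (T := T) φ hθ' hJ).1 h3.1
  have x₁ := extCalc_eq_of_hasComponent hω hθ hφ hJ hR hE₁ (h1.1.shBnd hθ' hJ)
  have x₂ := extCalc_eq_of_hasComponent hω hθ hφ hJ hR hE₂ (h2.1.shBnd hθ' hJ)
  have x₃ := extCalc_eq_of_hasComponent hω hθ hφ hJ hR hE₃ (h3.1.shBnd hθ' hJ)
  have z₂ := extCalc_eq_of_hasComponent hω hθ hφ hJ hR (hE₂.mul hG) h2.2.1
  obtain ⟨Y, hY, hY'⟩ := extCalc_eq hω hθ hφ hJ hR (hE₁.mul_hasComponents hF) h1.2.1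
  obtain ⟨R, hRr, hR'⟩ := extCalc_eq hω hθ hφ hJ hR
    (hE₃.mul_hasComponents (hG.mul_hasComponents hF)) h3.2.1
  -- Both products represent the same function, so they coincide by uniqueness of the extended
  -- calculus.
  have comm : ∀ {P Q : ℂ → ℂ} {X Z : CliffordModule n W →L[ℝ] CliffordModule n W},
      IsExt (qFun T J) (tqFun T J) θ φ P X → IsExt (qFun T J) (tqFun T J) θ φ Q Z →
        X * Z = Z * X := fun hX hZ =>
    (hR.isExt_mul hω hφ hθ hX hZ).unique ⟨hω.1.trans hφ.1, hφ.2⟩ hθ (hR.isExt_mul hω hφ hθ hZ hX)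
      fun _ _ => mul_comm _ _
  have i₁ := h1.2.2
  have i₂ := h2.2.2
  have i₃ := h3.2.2
  have g₁ := fun v w => mem_graph_hInfty (f := f) i₁ (v := v) (w := w)
  have g₂ := fun v w => mem_graph_hInfty (f := g) i₂ (v := v) (w := w)
  have g₃ := fun v w => mem_graph_hInfty (f := fun s => g s * f s) i₃ (v := v) (w := w)
  generalize extCalc T θ φ J e₁ = X₁ at *
  generalize extCalc T θ φ J e₂ = X₂ at *
  generalize extCalc T θ φ J e₃ = X₃ at *
  generalize extCalc T θ φ J (fun s => e₂ s * g s) = Z at *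
  generalize extCalc T θ φ J (fun s => e₁ s * f s) = P₁ at *
  generalize extCalc T θ φ J (fun s => e₃ s * (g s * f s)) = P₃ at *
  -- Both sides are the operator of `e₁ e₂ e₃ g f`; the comparison is made component by component,
  -- where all factors are scalar functions.
  have key : X₃ * (Z * P₁) = X₁ * (X₂ * P₃) := by
    rw [hY', hR']
    simp only [Finset.mul_sum, ← mul_assoc]
    refine Finset.sum_congr rfl fun A _ => ?_
    congr 1
    refine (hR.isExt_mul hω hφ hθ (hR.isExt_mul hω hφ hθ x₃ z₂) (hY A)).unique
      ⟨hω.1.trans hφ.1, hφ.2⟩ hθ (hR.isExt_mul hω hφ hθ (hR.isExt_mul hω hφ hθ x₁ x₂) (hRr A))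
      fun _ _ => ?_
    ring
  have key' : ∀ v, X₃ (Z (P₁ v)) = X₁ (X₂ (P₃ v)) := fun v => DFunLike.congr_fun key v
  have c₁₂ : ∀ v, X₁ (X₂ v) = X₂ (X₁ v) := fun v => DFunLike.congr_fun (comm x₁ x₂) v
  have c₁₃ : ∀ v, X₁ (X₃ v) = X₃ (X₁ v) := fun v => DFunLike.congr_fun (comm x₁ x₃) v
  have c₂₃ : ∀ v, X₂ (X₃ v) = X₃ (X₂ v) := fun v => DFunLike.congr_fun (comm x₂ x₃) v
  have c₁z : ∀ v, X₁ (Z v) = Z (X₁ v) := fun v => DFunLike.congr_fun (comm x₁ z₂) v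
  constructor
  · refine LinearPMap.le_of_le_graph ?_
    rintro ⟨v, w⟩ hvw
    obtain ⟨u, hu, hw⟩ := mem_graph_pcomp.1 hvw
    rw [g₁] at hu
    rw [g₂] at hw
    rw [g₃]
    -- The desired equation `X₃ w = P₃ v` is verified after applying the injective `X₁ X₂`:
    -- commuting operators and the equations for `u` and `w` lead to `X₃ Z P₁ v`, and `key'`
    -- applies.
    apply i₂
    apply i₁
    rw [← key', ← hu, ← c₁z, ← hw, ← c₁₃, c₂₃]
  · ext v
    simp only [Submodule.mem_inf, mem_domain_iff_exists_graph, mem_graph_pcomp, g₁, g₂, g₃]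
    constructor
    · rintro ⟨w, u, hu, hw⟩
      refine ⟨⟨w, ?_⟩, u, hu⟩
      apply i₂
      apply i₁
      rw [← key', ← hu, ← c₁z, ← hw, ← c₁₃, c₂₃]
    · rintro ⟨⟨w, hw⟩, u, hu⟩
      refine ⟨w, u, hu, ?_⟩
      -- Conversely `X₂ w = Z u` is tested with `X₁ X₃`. The existence of `u` is exactly the
      -- additional condition `v ∈ dom f(T)`.
      apply i₁
      apply i₃
      rw [← c₁₃, ← c₂₃, hw, ← key', ← hu, c₁z]

end

end CliffordCalc

end

theorem mainTheorem9 {n : ℕ} {W : Type*} [NormedAddCommGroup W] [NormedSpace ℝ W]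
    [CompleteSpace W] (T : CliffordCalc.ClosedOp n W) (ω θ : ℝ)
    (hω : ω ∈ Set.Ioo 0 (Real.pi / 2)) (hθ : θ ∈ Set.Ioo ω (Real.pi / 2))
    (hT : CliffordCalc.IsBisectorial T ω)
    (φ : ℝ) (hφ : φ ∈ Set.Ioo ω θ) (J : CliffordCalc.Cl n) (hJ : J ∈ CliffordCalc.unitSphere n)
    (g f : CliffordCalc.Cl n → CliffordCalc.Cl n)
    (hg : CliffordCalc.NReg T θ φ J g) (hf : CliffordCalc.SHReg T θ φ J f) :
    CliffordCalc.SHReg T θ φ J (fun s => g s * f s) ∧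
      ∀ e₁ e₂ e₃ : CliffordCalc.Cl n → CliffordCalc.Cl n,
        CliffordCalc.IsRegularizer T θ φ J e₁ f →
        CliffordCalc.IsRegularizer T θ φ J e₂ g →
        CliffordCalc.IsRegularizer T θ φ J e₃ (fun s => g s * f s) →
          CliffordCalc.pcomp (CliffordCalc.hInfty T θ φ J e₂ g) (CliffordCalc.hInfty T θ φ J e₁ f)
              ≤ CliffordCalc.hInfty T θ φ J e₃ (fun s => g s * f s) ∧
            (CliffordCalc.pcomp (CliffordCalc.hInfty T θ φ J e₂ g)
                (CliffordCalc.hInfty T θ φ J e₁ f)).domain =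
              (CliffordCalc.hInfty T θ φ J e₃ (fun s => g s * f s)).domain ⊓
                (CliffordCalc.hInfty T θ φ J e₁ f).domain := by
  -- An angle strictly between `ω` and `φ`: above `ω` the resolvent bounds are uniform, and below
  -- `φ` the integration rays stay inside the cone where they hold.
  have hω' : (ω + φ) / 2 ∈ Set.Ioo ω (Real.pi / 2) :=
    ⟨by linarith [hφ.1], by linarith [hφ.1, hφ.2, hθ.2]⟩
  exact CliffordCalc.product_rule ⟨hω.1.trans hω'.1, hω'.2⟩ hθ.2
    ⟨by linarith [hφ.1], hφ.2⟩ hJ (CliffordCalc.resolventPair_of_isBisectorial hω hω' hT hJ) hg hf
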